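/- Work on $\mathbb T\times\mathbb R$, $\mathbb T=\mathbb R/2\pi\mathbb Z$, with $\langle k,\xi\rangle=\sqrt{1+k^2+\xi^2}$, the Fourier transform normalised by $$f(X,Y)=\frac1{2\pi}\sum_{k\in\mathbb Z}\int_{\mathbb R}e^{i(kX+\xi Y)}\hat f(k,\xi)\,d\xi ,$$ and $\|f\|_{H^a}^2=\sum_{k}\int\langle k,\xi\rangle^{2a}|\hat f(k,\xi)|^2d\xi$ (for vectors, $\|(f_1,\dots,f_m)\|_{H^a}^2=\sum_i\|f_i\|_{H^a}^2$). For $t\ge 0$ let $\nabla_L=(\nabla_L^1,\nabla_L^2)=(\partial_X,\partial_Y-t\partial_X)$, $\mathrm{div}_L v=\nabla_L^1v_1+\nabla_L^2v_2$, $\Delta_L=\partial_X^2+(\partial_Y-t\partial_X)^2$, and let $\langle\nabla_L\rangle^{a}$ be the Fourier multiplier with symbol $\langle k,\xi-kt\rangle^{a}$. Consider the Boussinesq perturbation system around Couette flow in the moving frame, for real $u=(u_1,u_2)$ and $\vartheta$, $$\begin{cases}u_t-\nu\Delta_Lu+(u_2,0)+\nabla_Lp+(0,\gamma^2\vartheta)=-u\cdot\nabla_Lu,\\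 \vartheta_t-\mu\Delta_L\vartheta-u_2=-u\cdot\nabla_L\vartheta,\\ \mathrm{div}_L\,u=0,\qquad u|_{t=0}=u_{in},\ \ \vartheta|_{t=0}=\vartheta_{in}.\end{cases}$$ A solution on $[0,T]$ means $(u,\vartheta)\in C([0,T];H^{s+1/2})$ attaining the initial data and satisfying the equations for every $t\in[0,T]$ in the sense of tempered distributions on $\mathbb T\times\mathbb R$: the time derivatives of the pairings of $u$ and $\vartheta$ with fixed test functions are those prescribed by the equations, where the test functions are smooth, $2\pi$-periodic in $X$, and rapidly decreasing in $Y$ with all derivatives, $u\cdot\nabla_L$ is written in divergence form, and the momentum equation at time $t$ is tested with vector fields $\varphi$ satisfying $\mathrm{div}_L\varphi=0$ at that time (which eliminates $p$). **Proposition.** Let $\gamma>\frac12$, $s>\frac32$, $0<\varepsilon<1/\gamma$. There exist constants $c_1>0$ and $\widetilde C>0$, depending only on $\gamma,s,\varepsilon$, such that the following holds for all $\nu,\mu$ with $\kappa=\min\{\nu,\mu\}\in(0,1)$ and $\frac{\nu+\mu}{2\gamma\sqrt{\nu\mu}}<2-\varepsilon$. If $(u,\vartheta)$ is a solution on $[0,T]$,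 for some $T>0$, with initial data satisfying $$\|(u_{in},\vartheta_{in})\|_{H^{s+1/2}}\le c_1\kappa^{1/3},$$ then $$\|\langle\nabla_L\rangle^{1/2}(u,\vartheta)(t)\|_{H^s}\le\widetilde C\,\|(u_{in},\vartheta_{in})\|_{H^{s+1/2}}\qquad\text{for all }0\le t\le\min\{T,\kappa^{-1/6}\}.$$ -/

import Mathlib

open MeasureTheory Set Filter Topology
open scoped ENNReal ContDiff

noncomputable section

namespace Boussinesq

/-! Functions on `𝕋 × ℝ`, with `𝕋 = ℝ / 2πℤ`, are functions of `(X, Y) : ℝ × ℝ` that are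
`2π`-periodic in `X`; integrals over `𝕋 × ℝ` are integrals over `cell`. -/

/-- One period `(0, 2π] × ℝ` of `𝕋 × ℝ`. -/
def cell : Set (ℝ × ℝ) := Ioc 0 (2 * Real.pi) ×ˢ univ

/-- The measure `∑ₖ ∫ dξ` on the frequency space `ℤ × ℝ`. -/
def freqMeasure : Measure (ℤ × ℝ) := Measure.count.prod volume

/-- The bracket `⟨k, ξ⟩ = √(1 + k² + ξ²)`. -/
def bracket (k ξ : ℝ) : ℝ := √(1 + k ^ 2 + ξ ^ 2)

/-- The inverse Fourier transform on `𝕋 × ℝ`,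
`(X, Y) ↦ (2π)⁻¹ ∑ₖ ∫ e^{i(kX + ξY)} g(k, ξ) dξ`. -/
def invFourier (g : ℤ × ℝ → ℂ) (z : ℝ × ℝ) : ℂ :=
  ((2 * Real.pi)⁻¹ : ℝ) *
    (∫ p : ℤ × ℝ, Complex.exp (Complex.I * (((p.1 : ℝ) * z.1 + p.2 * z.2 : ℝ) : ℂ)) * g p
      ∂freqMeasure)

/-- `g` is an integrable Fourier transform of `f`: the inversion formula
`f(X, Y) = (2π)⁻¹ ∑ₖ ∫ e^{i(kX + ξY)} g(k, ξ) dξ` holds with an absolutely convergent right-hand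
side. Such a `g` is unique up to null sets, and every `f ∈ H^a(𝕋 × ℝ)` with `a > 1` has one. -/
structure HasFourier (f : ℝ × ℝ → ℂ) (g : ℤ × ℝ → ℂ) : Prop where
  integrable : Integrable g freqMeasure
  inversion : ∀ᵐ z : ℝ × ℝ, f z = invFourier g z

open Classical in
/-- The Fourier transform `f̂` of `f` (with value `0` if `f` has no integrable one). -/
def fourierT (f : ℝ × ℝ → ℂ) : ℤ × ℝ → ℂ :=
  if h : ∃ g, HasFourier f g then h.choose else 0

open Classical in
/-- The Sobolev norm `‖f‖_{H^a} = (∑ₖ ∫ ⟨k, ξ⟩^{2a} |f̂(k, ξ)|² dξ)^{1/2}`, for `a > 1`; it is `∞`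
if `f` is not in `H^a`, in particular if `f` has no integrable Fourier transform. -/
def sobolevNorm (a : ℝ) (f : ℝ × ℝ → ℂ) : ℝ≥0∞ :=
  if ∃ g, HasFourier f g then
    (∫⁻ p : ℤ × ℝ, (ENNReal.ofReal (bracket p.1 p.2 ^ (2 * a)) * ‖fourierT f p‖ₑ ^ 2)
      ∂freqMeasure) ^ (1 / 2 : ℝ)
  else ⊤

/-- The norm of a velocity-temperature triple,
`‖(u, ϑ)‖_{H^a} = (‖u₁‖² + ‖u₂‖² + ‖ϑ‖²)^{1/2}` with norms in `H^a`. -/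
def pairNorm (a : ℝ) (u : Fin 2 → ℝ × ℝ → ℂ) (θ : ℝ × ℝ → ℂ) : ℝ≥0∞ :=
  ((∑ i, sobolevNorm a (u i) ^ 2) + sobolevNorm a θ ^ 2) ^ (1 / 2 : ℝ)

/-- A real function viewed as a complex one. -/
def toC (f : ℝ × ℝ → ℝ) : ℝ × ℝ → ℂ := fun z => (f z : ℂ)

/-- The Fourier multiplier `⟨∇_L⟩^a` at time `t`, with symbol `⟨k, ξ - kt⟩^a`. -/
def bracketGradL (t a : ℝ) (f : ℝ × ℝ → ℂ) : ℝ × ℝ → ℂ :=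
  invFourier fun p => ((bracket p.1 (p.2 - p.1 * t) ^ a : ℝ) : ℂ) * fourierT f p

/-- `∂_X`. -/
def dX (φ : ℝ × ℝ → ℂ) : ℝ × ℝ → ℂ := fun z => deriv (fun x => φ (x, z.2)) z.1

/-- `∂_Y`. -/
def dY (φ : ℝ × ℝ → ℂ) : ℝ × ℝ → ℂ := fun z => deriv (fun y => φ (z.1, y)) z.2

/-- The components of `∇_L = (∂_X, ∂_Y - t ∂_X)`. -/
def gradL (t : ℝ) (j : Fin 2) (φ : ℝ × ℝ → ℂ) : ℝ × ℝ → ℂ :=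
  ![dX φ, fun z => dY φ z - t * dX φ z] j

/-- `Δ_L = ∂_X² + (∂_Y - t ∂_X)²`. -/
def lapL (t : ℝ) (φ : ℝ × ℝ → ℂ) : ℝ × ℝ → ℂ :=
  fun z => ∑ j, gradL t j (gradL t j φ) z

/-- Test functions on `𝕋 × ℝ`: smooth, `2π`-periodic in `X`, and rapidly decreasing in `Y`
together with all derivatives. -/
structure IsTest (φ : ℝ × ℝ → ℂ) : Prop where
  smooth : ContDiff ℝ ∞ φ
  periodic : ∀ x y, φ (x + 2 * Real.pi, y) = φ (x, y)
  decay : ∀ m n : ℕ, ∃ C : ℝ, ∀ z, |z.2| ^ m * ‖iteratedFDeriv ℝ n φ z‖ ≤ C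

/-- `f ∈ C([0, T]; H^a)`. -/
def ContinuousInSobolev (a T : ℝ) (f : ℝ → ℝ × ℝ → ℝ) : Prop :=
  ∀ t ∈ Icc 0 T, sobolevNorm a (toC (f t)) < ⊤ ∧
    Tendsto (fun τ => sobolevNorm a (toC (f τ - f t))) (𝓝[Icc 0 T] t) (𝓝 0)

/-- `(u, ϑ)`, with `u = (u 0, u 1)`, is a solution on `[0, T]` in `C([0, T]; H^a)` of the
perturbation system in the moving frame,

`u_t - ν Δ_L u + (u₂, 0) + ∇_L p + (0, γ² ϑ) = - u · ∇_L u`,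
`ϑ_t - μ Δ_L ϑ - u₂ = - u · ∇_L ϑ`,
`div_L u = 0`,

with initial data `(uin, θin)`. The equations hold in the sense of (tempered) distributions on
`𝕋 × ℝ` at every time. As `div_L u = 0`, the nonlinear terms are `div_L (u ⊗ u)` and
`div_L (ϑ u)`. The pressure is eliminated, as usual, by testing the momentum equation at time `t`
with vector fields `φ` that satisfy `div_L φ = 0` at time `t`. -/
structure IsSolution (ν μ γ a T : ℝ) (uin : Fin 2 → ℝ × ℝ → ℝ) (θin : ℝ × ℝ → ℝ)
    (u : Fin 2 → ℝ → ℝ × ℝ → ℝ) (θ : ℝ → ℝ × ℝ → ℝ) : Prop where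
  continuous_u : ∀ i, ContinuousInSobolev a T (u i)
  continuous_θ : ContinuousInSobolev a T θ
  initial_u : ∀ i, ∀ᵐ z, u i 0 z = uin i z
  initial_θ : ∀ᵐ z, θ 0 z = θin z
  div_free : ∀ t ∈ Icc 0 T, ∀ φ, IsTest φ →
    (∑ j, ∫ z in cell, (u j t z : ℂ) * gradL t j φ z) = 0
  momentum : ∀ t ∈ Icc 0 T, ∀ φ : Fin 2 → ℝ × ℝ → ℂ, (∀ i, IsTest (φ i)) →
    (∀ z, (∑ j, gradL t j (φ j) z) = 0) →
    HasDerivWithinAt (fun τ => ∑ i, ∫ z in cell, (u i τ z : ℂ) * φ i z)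
      (ν * (∑ i, ∫ z in cell, (u i t z : ℂ) * lapL t (φ i) z)
        - (∫ z in cell, (u 1 t z : ℂ) * φ 0 z)
        - γ ^ 2 * (∫ z in cell, (θ t z : ℂ) * φ 1 z)
        + (∑ i, ∑ j, ∫ z in cell, (u j t z : ℂ) * (u i t z : ℂ) * gradL t j (φ i) z))
      (Icc 0 T) t
  temperature : ∀ t ∈ Icc 0 T, ∀ φ, IsTest φ →
    HasDerivWithinAt (fun τ => ∫ z in cell, (θ τ z : ℂ) * φ z)
      (μ * (∫ z in cell, (θ t z : ℂ) * lapL t φ z)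
        + (∫ z in cell, (u 1 t z : ℂ) * φ z)
        + (∑ j, ∫ z in cell, (u j t z : ℂ) * (θ t z : ℂ) * gradL t j φ z))
      (Icc 0 T) t

end Boussinesq

end

noncomputable section

namespace Boussinesq

/-! The proof is an energy estimate, frequency by frequency for the linear part. In two dimensions a
divergence-free field has Fourier transform `v * nv`, where `nv = (n, m)` is the unit vector
orthogonal to p_t = (k, ξ - kt). The time derivative of a unit vector is orthogonal to it, so the
system becomes, for two scalars v and θ, v' = -(ν|p_t|² + nm) v - γ² m θ - (transport), θ' =
-μ|p_t|² θ + m v - (transport).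

Linear part. The energy density is W (|v|² + γ²|θ|² + n Re(v θ̄)) with W essentially ⟨p⟩^{2s} ⟨p_t⟩.
In |v|² + γ²|θ|² the coupling through m cancels. The logarithmic derivative of ⟨p_t⟩ is nm up to the
factor |p_t|²/⟨p_t⟩², so -nm|v|² + γ² nm|θ|² is left, and this is exactly cancelled by the
derivative of the cross term. The remaining errors are of size |m|³ = |k|³/|p_t|³, whose time
integral is bounded; the ghost weight exp(-c `ghost`) absorbs them. The cross term is dominated by
|v|² + γ²|θ|² because γ > 1/2, and the viscous quadratic form is nonnegative because (ν + μ)² ≤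
16γ²νμ. Viscosity enters only through this sign. This is `linear_energy_le`, and `energy_density_eq`
is the underlying identity.

Nonlinear part. Transport is skew-symmetric, so only the commutator of the weight with transport
survives (`enorm_transport_le`, resting on `abs_wgt_sub_mul_le`), together with one term from the
cross part of the energy, which comes from the pressure (`enorm_pressure_le`). Both cost one factor
1 + t, from |p_t| ≤ (1 + t)|p|. What remains is a trilinear integral with an extra factor
⟨·⟩^{-(s-1/2)} on one frequency. It is square summable over the two-dimensional frequency space
because s > 3/2, and Cauchy-Schwarz and Young conclude (`lintegral_tri_dec_le`).

Conclusion. With A the norm to be bounded, k A(t)² ≤ M A(0)² + L ∫₀ᵗ (1 + τ) A(τ)³ dτ, with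
constants independent of ν and μ (`FreqSol.amplitude_sq_le`). Hence A stays comparable to A(0) as
long as A(0)(t + t²/2) is small (`sq_le_of_integral_cubic`). For A(0) ≤ c₁ κ^{1/3} this holds up to
t = κ^{-1/6}.

Regularity. The solution satisfies the equations only weakly and lies only in H^{s+1/2}. Pairing
with suitable test functions gives the weak equations for v and θ (`IsSolution.freqSol`). The
right-hand sides are continuous in the weighted L² space of order -2, so the weak derivatives are
strong there (`ContL.hasDerivWithinAt_lp`). A Lipschitz cutoff at frequency N makes the energy a
bounded form on that space, hence differentiable; the bounds are uniform in N and N tends to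
infinity at the end. -/

instance : SigmaFinite freqMeasure := by unfold freqMeasure; infer_instance

instance : freqMeasure.IsAddLeftInvariant := by unfold freqMeasure; infer_instance

instance : freqMeasure.IsNegInvariant := by
  unfold freqMeasure
  constructor
  have h : MeasurePreserving (Prod.map (fun k : ℤ => -k) (fun ξ : ℝ => -ξ))
      ((Measure.count : Measure ℤ).prod volume) ((Measure.count : Measure ℤ).prod volume) :=
    (Measure.measurePreserving_neg _).prod (Measure.measurePreserving_neg _)
  exact h.map_eq

/-! ### Sheared frequencies and the measure on frequency space -/

/-- The length `|p_t|` of `p_t = (k, ξ - k t)`. -/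
def modL (t : ℝ) (p : ℤ × ℝ) : ℝ := √((p.1 : ℝ) ^ 2 + (p.2 - p.1 * t) ^ 2)

/-- The bracket `⟨p_t⟩` of `p_t = (k, ξ - k t)`. -/
def jb (t : ℝ) (p : ℤ × ℝ) : ℝ := bracket p.1 (p.2 - p.1 * t)

lemma jb_zero (p : ℤ × ℝ) : jb 0 p = bracket p.1 p.2 := by simp [jb]

lemma jb_sq (t : ℝ) (p : ℤ × ℝ) : jb t p ^ 2 = 1 + (p.1 : ℝ) ^ 2 + (p.2 - p.1 * t) ^ 2 := by
  unfold jb bracket; rw [Real.sq_sqrt (by positivity)]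

lemma modL_sq (t : ℝ) (p : ℤ × ℝ) : modL t p ^ 2 = (p.1 : ℝ) ^ 2 + (p.2 - p.1 * t) ^ 2 := by
  unfold modL; rw [Real.sq_sqrt (by positivity)]

lemma jb_sq_eq (t : ℝ) (p : ℤ × ℝ) : jb t p ^ 2 = 1 + modL t p ^ 2 := by
  rw [jb_sq, modL_sq]; ring

lemma modL_nonneg (t : ℝ) (p : ℤ × ℝ) : 0 ≤ modL t p := Real.sqrt_nonneg _

lemma one_le_jb (t : ℝ) (p : ℤ × ℝ) : 1 ≤ jb t p := by
  unfold jb bracket; rw [Real.one_le_sqrt]; nlinarith [sq_nonneg (p.1 : ℝ), sq_nonneg (p.2 - p.1 * t)]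

lemma jb_pos (t : ℝ) (p : ℤ × ℝ) : 0 < jb t p := lt_of_lt_of_le one_pos (one_le_jb t p)

lemma modL_le_jb (t : ℝ) (p : ℤ × ℝ) : modL t p ≤ jb t p :=
  abs_le_of_sq_le_sq' (by rw [jb_sq_eq]; linarith) (jb_pos t p).le |>.2

@[fun_prop]
lemma measurable_intCast_fst : Measurable (fun p : ℤ × ℝ => (p.1 : ℝ)) :=
  (measurable_from_top (f := fun k : ℤ => (k : ℝ))).comp measurable_fst

@[fun_prop]
lemma measurable_jb (t : ℝ) : Measurable (jb t) := by
  unfold jb bracket; fun_prop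

@[fun_prop]
lemma measurable_modL (t : ℝ) : Measurable (modL t) := by
  unfold modL; fun_prop

/-- The shear `(k, ξ) ↦ (k, ξ - k t)` preserves the frequency measure. -/
lemma measurePreserving_shear (t : ℝ) :
    MeasurePreserving (fun p : ℤ × ℝ => (p.1, p.2 - p.1 * t)) freqMeasure freqMeasure := by
  unfold freqMeasure
  refine MeasurePreserving.skew_product (g := fun (k : ℤ) (ξ : ℝ) => ξ - k * t)
    (MeasurePreserving.id _) ?_ ?_
  · fun_prop
  · exact Eventually.of_forall fun k => (measurePreserving_sub_right volume ((k : ℝ) * t)).map_eq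

lemma lintegral_jb_shear (t : ℝ) (f : ℝ → ℝ≥0∞) (hf : Measurable f) :
    ∫⁻ p, f (jb t p) ∂freqMeasure = ∫⁻ p, f (jb 0 p) ∂freqMeasure := by
  have h := (measurePreserving_shear t).lintegral_comp (f := fun p => f (jb 0 p)) (by fun_prop)
  rw [← h]; simp [jb]

/-- The shear preserves the measure, so t = 0 suffices. There ⟨p⟩^{-2l} is at most the product of (1
+ k²)^{-l/2} and (1 + ξ²)^{-l/2}, and each factor has a finite total for l > 1. With l = s - 1/2
this is where s > 3/2 enters. -/
lemma lintegral_jb_rpow_lt_top {l : ℝ} (hl : 1 < l) (t : ℝ) :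
    ∫⁻ p, ENNReal.ofReal (jb t p ^ (-(2 * l))) ∂freqMeasure < ⊤ := by
  rw [lintegral_jb_shear t (fun x => ENNReal.ofReal (x ^ (-(2 * l)))) (by fun_prop)]
  have hle : ∀ p : ℤ × ℝ, ENNReal.ofReal (jb 0 p ^ (-(2 * l))) ≤
      ENNReal.ofReal ((1 + ‖(p.1 : ℝ)‖ ^ 2) ^ (-l / 2)) *
        ENNReal.ofReal ((1 + ‖p.2‖ ^ 2) ^ (-l / 2)) := by
    intro p
    rw [← ENNReal.ofReal_mul (by positivity)]
    apply ENNReal.ofReal_le_ofReal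
    have h0 : jb 0 p ^ (-(2 * l)) = (jb 0 p ^ 2) ^ (-l / 2) * (jb 0 p ^ 2) ^ (-l / 2) := by
      rw [← Real.rpow_natCast (jb 0 p) 2, ← Real.rpow_mul (jb_pos _ _).le,
        ← Real.rpow_add (jb_pos _ _)]
      congr 1; push_cast; ring
    rw [h0, jb_sq, Real.norm_eq_abs, Real.norm_eq_abs, sq_abs, sq_abs]
    have e1 : (1 + (p.1 : ℝ) ^ 2 + (p.2 - p.1 * 0) ^ 2) ^ (-l / 2) ≤
        (1 + (p.1 : ℝ) ^ 2) ^ (-l / 2) :=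
      Real.rpow_le_rpow_of_nonpos (by positivity) (by nlinarith) (by linarith)
    have e2 : (1 + (p.1 : ℝ) ^ 2 + (p.2 - p.1 * 0) ^ 2) ^ (-l / 2) ≤
        (1 + p.2 ^ 2) ^ (-l / 2) :=
      Real.rpow_le_rpow_of_nonpos (by positivity) (by nlinarith) (by linarith)
    gcongr
  refine lt_of_le_of_lt (lintegral_mono hle) ?_
  unfold freqMeasure
  rw [lintegral_prod_mul (f := fun k : ℤ => ENNReal.ofReal ((1 + ‖(k : ℝ)‖ ^ 2) ^ (-l / 2)))
    (g := fun ξ : ℝ => ENNReal.ofReal ((1 + ‖ξ‖ ^ 2) ^ (-l / 2))) (by fun_prop) (by fun_prop)]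
  refine ENNReal.mul_lt_top ?_ ?_
  · rw [lintegral_count]
    have hs : Summable (fun k : ℤ => (1 + ‖(k : ℝ)‖ ^ 2) ^ (-l / 2)) := by
      refine Summable.of_nonneg_of_le (fun k => by positivity) (fun k => ?_)
        ((Real.summable_abs_int_rpow hl).add (summable_of_ne_finset_zero (s := {0})
          (f := fun k : ℤ => if k = 0 then (1 : ℝ) else 0) (by intro b hb; simp at hb; simp [hb])))
      by_cases hk : k = 0
      · subst hk
        have : (0:ℝ) ≤ |((0:ℤ):ℝ)| ^ (-l) := by positivity
        simp
        simpa using this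
      · have hk' : (0:ℝ) < |(k : ℝ)| := by positivity
        simp only [hk, if_false, add_zero]
        calc (1 + ‖(k : ℝ)‖ ^ 2) ^ (-l / 2) ≤ (|(k : ℝ)| ^ 2) ^ (-l / 2) :=
              Real.rpow_le_rpow_of_nonpos (by positivity) (by simp) (by linarith)
          _ = |(k : ℝ)| ^ (-l) := by
              rw [← Real.rpow_natCast, ← Real.rpow_mul hk'.le]; congr 1; push_cast; ring
    rw [← ENNReal.ofReal_tsum_of_nonneg (fun k => by positivity) hs]
    exact ENNReal.ofReal_lt_top
  · have := (integrable_rpow_neg_one_add_norm_sq (E := ℝ) (μ := volume) (r := l)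
      (by simpa using hl)).lintegral_lt_top
    simpa using this

/-- Counting measure has no nonempty null set, so no line {k} × ℝ may be exceptional. -/
lemma ae_freqMeasure_iff {q : ℤ × ℝ → Prop} :
    (∀ᵐ p ∂freqMeasure, q p) ↔ ∀ k : ℤ, ∀ᵐ ξ : ℝ, q (k, ξ) := by
  constructor
  · intro h k
    have := Measure.ae_ae_of_ae_prod (μ := (Measure.count : Measure ℤ)) h
    rw [ae_iff, Measure.count_eq_zero_iff] at this
    have hk : k ∉ {a : ℤ | ¬∀ᵐ y : ℝ, q (a, y)} := by rw [this]; simp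
    simpa using hk
  · intro h
    have hset : {p : ℤ × ℝ | ¬ q p} ⊆ ⋃ k : ℤ, {k} ×ˢ {ξ | ¬ q (k, ξ)} := by
      rintro ⟨k, ξ⟩ hp
      simp only [mem_iUnion]
      exact ⟨k, by simpa using hp⟩
    rw [ae_iff]
    refine measure_mono_null hset (measure_iUnion_null fun k => ?_)
    unfold freqMeasure
    rw [Measure.prod_prod, ae_iff.1 (h k), mul_zero]

/-! ### Test functions concentrated on one line of frequencies -/

/-- The function on `ℤ × ℝ` that equals `h` on the line `{k} × ℝ` and vanishes elsewhere. -/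
def single (k : ℤ) (h : ℝ → ℂ) (p : ℤ × ℝ) : ℂ := if p.1 = k then h p.2 else 0

lemma integral_mul_single (g : ℤ × ℝ → ℂ) (k : ℤ) (h : ℝ → ℂ) 
    (hg : Integrable (fun p => g p * single k h p) freqMeasure) :
    ∫ p, g p * single k h p ∂freqMeasure = ∫ ξ, g (k, ξ) * h ξ := by
  unfold freqMeasure at *
  rw [integral_prod _ hg, integral_countable hg.integral_prod_left, tsum_eq_single k]
  · simp [single, Measure.real]
  · intro l hl
    simp [single, hl]

/-- Smooth, compactly supported functions of one frequency variable. -/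
structure IsBump (h : ℝ → ℂ) : Prop where
  smooth : ContDiff ℝ ∞ h
  compact : HasCompactSupport h

lemma IsBump.integrable {h : ℝ → ℂ} (hh : IsBump h) : Integrable h :=
  hh.smooth.continuous.integrable_of_hasCompactSupport hh.compact

lemma IsBump.mul_left {h m : ℝ → ℂ} (hh : IsBump h) (hm : ContDiff ℝ ∞ m) :
    IsBump (fun ξ => m ξ * h ξ) :=
  ⟨hm.mul hh.smooth, hh.compact.mul_left⟩

/-- `y ↦ (2π)⁻¹ ∫ e^{-iξy} h(ξ) dξ`. -/
def waveH (h : ℝ → ℂ) (y : ℝ) : ℂ :=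
  ((2 * Real.pi)⁻¹ : ℝ) * FourierTransform.fourier h (y / (2 * Real.pi))

/-- The test function `e^{-ikX} (2π)⁻¹ ∫ e^{-iξY} h(ξ) dξ`. -/
def testFn (k : ℤ) (h : ℝ → ℂ) (z : ℝ × ℝ) : ℂ :=
  Complex.exp (-(Complex.I * k) * z.1) * waveH h z.2

/-- The rescaling by 2π converts between the kernel e^{-2πiξy} of the Fourier transform and the
kernel e^{-iξy} used here; the second conclusion is then Fourier inversion. -/
lemma exists_schwartz_waveH {h : ℝ → ℂ} (hh : IsBump h) :
    ∃ S : SchwartzMap ℝ ℂ, ⇑S = waveH h ∧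
      ∀ ξ : ℝ, ∫ y, Complex.exp (Complex.I * ((ξ * y : ℝ) : ℂ)) * S y = h ξ := by
  set h' : SchwartzMap ℝ ℂ := hh.compact.toSchwartzMap hh.smooth with hh'
  have hcoe : ⇑h' = h := by ext; simp [hh']
  have h2π : (2 * Real.pi) ≠ 0 := by positivity
  have h2π' : ((2 * Real.pi)⁻¹) ≠ 0 := by positivity
  let e : ℝ ≃L[ℝ] ℝ := ContinuousLinearEquiv.unitsEquivAut ℝ (Units.mk0 _ h2π')
  have he : ∀ y, e y = y / (2 * Real.pi) := fun y => by
    simp [e, ContinuousLinearEquiv.unitsEquivAut, div_eq_mul_inv]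
  let F : SchwartzMap ℝ ℂ := FourierTransform.fourier h'
  have hF : ⇑F = FourierTransform.fourier h := by
    simp only [F, SchwartzMap.fourier_coe, hcoe]
  refine ⟨(((2 * Real.pi)⁻¹ : ℝ) : ℂ) • SchwartzMap.compCLMOfContinuousLinearEquiv ℂ e F, ?_, ?_⟩
  · ext y
    simp only [smul_apply, SchwartzMap.compCLMOfContinuousLinearEquiv_apply,
      Function.comp, he, hF, smul_eq_mul, waveH]
  · intro ξ
    have hinv : FourierTransformInv.fourierInv (F : ℝ → ℂ) ξ = h ξ := by
      rw [← SchwartzMap.fourierInv_coe]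
      simp only [F, FourierTransform.fourierInv_fourier_eq, hcoe]
    rw [← hinv, Real.fourierInv_eq']
    have hsub := Measure.integral_comp_div
      (fun y : ℝ => Complex.exp (((2 * Real.pi * inner ℝ y ξ : ℝ) : ℂ) * Complex.I) • F y)
      (2 * Real.pi)
    rw [abs_of_pos (by positivity)] at hsub
    have : ∫ y, Complex.exp (((2 * Real.pi * inner ℝ y ξ : ℝ) : ℂ) * Complex.I) • F y =
        ((2 * Real.pi)⁻¹ : ℝ) • ∫ y : ℝ, Complex.exp (((2 * Real.pi * inner ℝ (y / (2 * Real.pi)) ξ : ℝ) : ℂ)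
          * Complex.I) • F (y / (2 * Real.pi)) := by
      rw [hsub, smul_smul, inv_mul_cancel₀ h2π, one_smul]
    rw [this, ← integral_smul]
    congr 1; ext y
    simp only [smul_apply, SchwartzMap.compCLMOfContinuousLinearEquiv_apply,
      Function.comp, he, smul_eq_mul, Complex.real_smul]
    have : (2 * Real.pi * inner ℝ (y / (2 * Real.pi)) ξ) = ξ * y := by
      simp; field_simp
    rw [this, mul_comm Complex.I]
    ring

lemma hasDerivAt_waveH {h : ℝ → ℂ} (hh : IsBump h) (y : ℝ) :
    HasDerivAt (waveH h) (waveH (fun ξ => -(Complex.I * ξ) * h ξ) y) y := by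
  have h2π : ((2 * Real.pi : ℝ) : ℂ) ≠ 0 := by exact_mod_cast (by positivity : (2 * Real.pi) ≠ 0)
  have hi : Integrable (fun x : ℝ => x • h x) := by
    have hb : IsBump (fun x : ℝ => (x : ℂ) * h x) := hh.mul_left Complex.ofRealCLM.contDiff
    simpa only [Complex.real_smul] using hb.integrable
  have h1 := Real.hasDerivAt_fourier hh.integrable hi (y / (2 * Real.pi))
  have h2 : HasDerivAt (fun y : ℝ => y / (2 * Real.pi)) (1 / (2 * Real.pi)) y :=
    (hasDerivAt_id y).div_const _
  have h3 := (h1.scomp y h2).const_mul (((2 * Real.pi)⁻¹ : ℝ) : ℂ)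
  refine h3.congr_deriv ?_
  unfold waveH
  rw [Complex.real_smul]
  congr 1
  have : (fun x : ℝ => (-2 * (Real.pi : ℂ) * Complex.I * x) • h x) =
      ((2 * Real.pi : ℝ) : ℂ) • (fun ξ : ℝ => -(Complex.I * ξ) * h ξ) := by
    ext x; simp; ring
  rw [this, Real.fourier_real_eq, Real.fourier_real_eq]
  simp only [Pi.smul_apply]
  rw [show (fun v : ℝ => Real.fourierChar (-(v * (y / (2 * Real.pi)))) •
      ((2 * Real.pi : ℝ) : ℂ) • (-(Complex.I * v) * h v)) = fun v : ℝ =>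
      ((2 * Real.pi : ℝ) : ℂ) • Real.fourierChar (-(v * (y / (2 * Real.pi)))) •
       (-(Complex.I * v) * h v) from by ext v; rw [smul_comm]]
  rw [integral_smul, smul_eq_mul, ← mul_assoc]
  rw [show ((1 / (2 * Real.pi) : ℝ) : ℂ) * ((2 * Real.pi : ℝ) : ℂ) = 1 by
    rw [← Complex.ofReal_mul]; rw [one_div, inv_mul_cancel₀ (by positivity)]; simp, one_mul]

lemma contDiff_expX (k : ℤ) : ContDiff ℝ ∞ (fun x : ℝ => Complex.exp (-(Complex.I * k) * x)) := by
  have : ContDiff ℝ ∞ (fun x : ℝ => (x : ℂ)) := Complex.ofRealCLM.contDiff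
  fun_prop

lemma norm_expX (k : ℤ) (x : ℝ) : ‖Complex.exp (-(Complex.I * k) * x)‖ = 1 := by
  rw [Complex.norm_exp]; simp

lemma norm_iteratedFDeriv_expX (k : ℤ) (n : ℕ) (x : ℝ) :
    ‖iteratedFDeriv ℝ n (fun x : ℝ => Complex.exp (-(Complex.I * k) * x)) x‖ = |(k : ℝ)| ^ n := by
  have h : ∀ n, iteratedDeriv n (fun x : ℝ => Complex.exp (-(Complex.I * k) * x)) =
      fun x : ℝ => (-(Complex.I * k)) ^ n * Complex.exp (-(Complex.I * k) * x) := by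
    intro n
    induction n with
    | zero => ext; simp
    | succ n ih =>
      rw [iteratedDeriv_succ, ih]
      ext x
      have : HasDerivAt (fun x : ℝ => Complex.exp (-(Complex.I * k) * x))
          (Complex.exp (-(Complex.I * k) * x) * (-(Complex.I * k))) x := by
        have h1 : HasDerivAt (fun x : ℝ => -(Complex.I * k) * (x : ℂ)) (-(Complex.I * k)) x := by
          simpa using (Complex.ofRealCLM.hasDerivAt (x := x)).const_mul (-(Complex.I * k))
        exact h1.cexp
      rw [(this.const_mul _).deriv]; ring
  rw [norm_iteratedFDeriv_eq_norm_iteratedDeriv, h]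
  rw [norm_mul, norm_expX, norm_pow]; simp

lemma isTest_testFn (k : ℤ) {h : ℝ → ℂ} (hh : IsBump h) : IsTest (testFn k h) := by
  obtain ⟨S, hS, -⟩ := exists_schwartz_waveH hh
  have hSm : ContDiff ℝ ∞ (waveH h) := hS ▸ S.smooth ⊤
  have h1 : ContDiff ℝ ∞ (fun z : ℝ × ℝ => Complex.exp (-(Complex.I * k) * z.1)) :=
    (contDiff_expX k).comp contDiff_fst
  have h2 : ContDiff ℝ ∞ (fun z : ℝ × ℝ => waveH h z.2) := hSm.comp contDiff_snd
  refine ⟨h1.mul h2, fun x y => ?_, fun m n => ?_⟩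
  · simp only [testFn]
    congr 1
    rw [Complex.exp_eq_exp_iff_exists_int]
    refine ⟨-k, ?_⟩
    push_cast; ring
  · choose C hC using fun j => S.decay m j
    refine ⟨∑ i ∈ Finset.range (n + 1), (n.choose i : ℝ) * |(k : ℝ)| ^ i * C (n - i), fun z => ?_⟩
    have hb := norm_iteratedFDeriv_mul_le h1 h2 z (n := n) (by exact_mod_cast le_top)
    have e1 : ∀ i, ‖iteratedFDeriv ℝ i (fun z : ℝ × ℝ => Complex.exp (-(Complex.I * k) * z.1)) z‖
        ≤ |(k : ℝ)| ^ i := by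
      intro i
      have := (ContinuousLinearMap.fst ℝ ℝ ℝ).iteratedFDeriv_comp_right (contDiff_expX k) z
        (i := i) (by exact_mod_cast le_top)
      have h3 : (fun z : ℝ × ℝ => Complex.exp (-(Complex.I * k) * z.1)) =
        (fun x : ℝ => Complex.exp (-(Complex.I * k) * x)) ∘ (ContinuousLinearMap.fst ℝ ℝ ℝ) := rfl
      rw [h3, this]
      refine (ContinuousMultilinearMap.norm_compContinuousLinearMap_le _ _).trans ?_
      rw [norm_iteratedFDeriv_expX]
      refine mul_le_of_le_one_right (by positivity) ?_
      exact Finset.prod_le_one (fun _ _ => norm_nonneg _) fun _ _ => ContinuousLinearMap.norm_fst_le ..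
    have e2 : ∀ i, |z.2| ^ m * ‖iteratedFDeriv ℝ i (fun z : ℝ × ℝ => waveH h z.2) z‖ ≤ C i := by
      intro i
      have := (ContinuousLinearMap.snd ℝ ℝ ℝ).iteratedFDeriv_comp_right hSm z
        (i := i) (by exact_mod_cast le_top)
      have h3 : (fun z : ℝ × ℝ => waveH h z.2) = (waveH h) ∘ (ContinuousLinearMap.snd ℝ ℝ ℝ) := rfl
      rw [h3, this]
      refine le_trans ?_ ((hC i).2 z.2)
      rw [hS, Real.norm_eq_abs]
      gcongr
      refine (ContinuousMultilinearMap.norm_compContinuousLinearMap_le _ _).trans ?_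
      refine mul_le_of_le_one_right (by positivity) ?_
      exact Finset.prod_le_one (fun _ _ => norm_nonneg _) fun _ _ => ContinuousLinearMap.norm_snd_le ..
    calc |z.2| ^ m * ‖iteratedFDeriv ℝ n (testFn k h) z‖
        ≤ |z.2| ^ m * ∑ i ∈ Finset.range (n + 1), (n.choose i : ℝ) *
          ‖iteratedFDeriv ℝ i (fun z : ℝ × ℝ => Complex.exp (-(Complex.I * k) * z.1)) z‖ *
          ‖iteratedFDeriv ℝ (n - i) (fun z : ℝ × ℝ => waveH h z.2) z‖ :=
          mul_le_mul_of_nonneg_left hb (by positivity)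
      _ = ∑ i ∈ Finset.range (n + 1), (n.choose i : ℝ) *
          ‖iteratedFDeriv ℝ i (fun z : ℝ × ℝ => Complex.exp (-(Complex.I * k) * z.1)) z‖ *
          (|z.2| ^ m * ‖iteratedFDeriv ℝ (n - i) (fun z : ℝ × ℝ => waveH h z.2) z‖) := by
          rw [Finset.mul_sum]; refine Finset.sum_congr rfl fun i _ => by ring
      _ ≤ _ := by
          refine Finset.sum_le_sum fun i _ => ?_
          gcongr
          · exact e1 i
          · exact e2 _

/-- The symbol `p_t = (k, ξ - k t)` of `-i ∇_L`. -/
def sym (t : ℝ) (p : ℤ × ℝ) (j : Fin 2) : ℝ := ![(p.1 : ℝ), p.2 - p.1 * t] j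

lemma waveH_const_mul (c : ℂ) (h : ℝ → ℂ) (y : ℝ) :
    waveH (fun ξ => c * h ξ) y = c * waveH h y := by
  unfold waveH
  have : FourierTransform.fourier (fun ξ => c * h ξ) = c • FourierTransform.fourier h := by
    ext w
    rw [Real.fourier_real_eq, Pi.smul_apply, Real.fourier_real_eq, ← integral_smul]
    congr 1; ext v
    rw [smul_comm, smul_eq_mul]
  rw [this]; simp; ring

lemma waveH_add {h₁ h₂ : ℝ → ℂ} (hh₁ : IsBump h₁) (hh₂ : IsBump h₂) (y : ℝ) :
    waveH (fun ξ => h₁ ξ + h₂ ξ) y = waveH h₁ y + waveH h₂ y := by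
  unfold waveH
  have : FourierTransform.fourier (fun ξ => h₁ ξ + h₂ ξ) =
      FourierTransform.fourier h₁ + FourierTransform.fourier h₂ := by
    ext w
    simp only [Pi.add_apply, Real.fourier_eq, smul_add]
    exact integral_add ((Real.fourierIntegral_convergent_iff w).2 hh₁.integrable)
      ((Real.fourierIntegral_convergent_iff w).2 hh₂.integrable)
  rw [this]; simp; ring

lemma gradL_testFn (t : ℝ) (j : Fin 2) (k : ℤ) {h : ℝ → ℂ} (hh : IsBump h) :
    gradL t j (testFn k h) = testFn k (fun ξ => -(Complex.I * sym t (k, ξ) j) * h ξ) := by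
  have hX : ∀ z, dX (testFn k h) z = -(Complex.I * k) * testFn k h z := by
    intro z
    have h1 : HasDerivAt (fun x : ℝ => -(Complex.I * k) * (x : ℂ)) (-(Complex.I * k)) z.1 := by
      simpa using (Complex.ofRealCLM.hasDerivAt (x := z.1)).const_mul (-(Complex.I * k))
    have := (h1.cexp.mul_const (waveH h z.2)).deriv
    simp only [dX, testFn]
    rw [this]; ring
  have hY : ∀ z, dY (testFn k h) z = testFn k (fun ξ => -(Complex.I * ξ) * h ξ) z := by
    intro z
    have := ((hasDerivAt_waveH hh z.2).const_mul (Complex.exp (-(Complex.I * k) * z.1))).deriv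
    simp only [dY, testFn]
    rw [this]
  ext z
  fin_cases j
  · simp only [gradL, sym, Fin.zero_eta, Matrix.cons_val_zero, hX]
    simp only [testFn, Complex.ofReal_intCast]
    rw [waveH_const_mul]; ring
  · simp only [gradL, sym, Fin.mk_one, Matrix.cons_val_one, Matrix.cons_val_fin_one, hX, hY]
    simp only [testFn]
    have hb1 : IsBump (fun ξ : ℝ => -(Complex.I * ξ) * h ξ) := 
      hh.mul_left (by have : ContDiff ℝ ∞ (fun x : ℝ => (x : ℂ)) := Complex.ofRealCLM.contDiff
                      fun_prop)
    have hb2 : IsBump (fun ξ : ℝ => (t * (Complex.I * k)) * h ξ) := hh.mul_left (by fun_prop)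
    have := waveH_add hb1 hb2 z.2
    rw [waveH_const_mul] at this
    rw [show (fun ξ : ℝ => -(Complex.I * ((ξ - k * t : ℝ) : ℂ)) * h ξ) = 
      fun ξ : ℝ => -(Complex.I * ξ) * h ξ + (t * (Complex.I * k)) * h ξ from by
        ext ξ; push_cast; ring, this]
    ring

/-- The character `(k, ξ) ↦ e^{i(kX + ξY)}`. -/
def eChar (z : ℝ × ℝ) (p : ℤ × ℝ) : ℂ :=
  Complex.exp (Complex.I * (((p.1 : ℝ) * z.1 + p.2 * z.2 : ℝ) : ℂ))

lemma invFourier_eq (g : ℤ × ℝ → ℂ) (z : ℝ × ℝ) :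
    invFourier g z = ((2 * Real.pi)⁻¹ : ℝ) * ∫ p, eChar z p * g p ∂freqMeasure := rfl

lemma norm_eChar (z : ℝ × ℝ) (p : ℤ × ℝ) : ‖eChar z p‖ = 1 := by
  rw [eChar, mul_comm, Complex.norm_exp_ofReal_mul_I]

lemma eChar_add (z : ℝ × ℝ) (p q : ℤ × ℝ) : eChar z (p + q) = eChar z p * eChar z q := by
  simp only [eChar, ← Complex.exp_add]; congr 1; push_cast [Prod.fst_add, Prod.snd_add]; ring

lemma measurable_eChar : Measurable (fun x : (ℝ × ℝ) × (ℤ × ℝ) => eChar x.1 x.2) := by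
  unfold eChar
  have : Measurable (fun x : (ℝ × ℝ) × (ℤ × ℝ) => (x.2.1 : ℝ)) :=
    measurable_intCast_fst.comp measurable_snd
  fun_prop

lemma measurable_eChar_right (z : ℝ × ℝ) : Measurable (eChar z) := by
  unfold eChar; fun_prop

lemma integrable_eChar_mul {g : ℤ × ℝ → ℂ} (hg : Integrable g freqMeasure) (z : ℝ × ℝ) :
    Integrable (fun p => eChar z p * g p) freqMeasure :=
  hg.bdd_mul (c := 1) (measurable_eChar_right z).aestronglyMeasurable
    (Eventually.of_forall fun p => (norm_eChar z p).le)

lemma volume_restrict_cell : (volume : Measure (ℝ × ℝ)).restrict cell =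
    (volume.restrict (Ioc 0 (2 * Real.pi))).prod volume := by
  rw [cell, Measure.volume_eq_prod, ← Measure.prod_restrict, Measure.restrict_univ]

lemma integral_exp_int (n : ℤ) :
    ∫ x in Ioc 0 (2 * Real.pi), Complex.exp (Complex.I * n * x) =
      if n = 0 then ((2 * Real.pi : ℝ) : ℂ) else 0 := by
  rw [← intervalIntegral.integral_of_le (by positivity)]
  split_ifs with h
  · subst h; simp
  · rw [integral_exp_mul_complex (by simp [h])]
    have : Complex.exp (Complex.I * n * ((2 * Real.pi : ℝ) : ℂ)) = 1 := by
      rw [Complex.exp_eq_one_iff]; exact ⟨n, by push_cast; ring⟩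
    rw [this]; simp

/-- After Fubini, integration over one period in X selects the frequency k, and integration in Y
returns h(ξ) by inversion. Testing in physical space is thus testing the Fourier transform against
bumps on the line {k} × ℝ. -/
lemma integral_cell_invFourier_mul_testFn {g : ℤ × ℝ → ℂ} (hg : Integrable g freqMeasure)
    (k : ℤ) {h : ℝ → ℂ} (hh : IsBump h) :
    ∫ z in cell, invFourier g z * testFn k h z = ∫ p, g p * single k h p ∂freqMeasure := by
  obtain ⟨S, hS, hinv⟩ := exists_schwartz_waveH hh
  have hSi : Integrable S := S.integrable
  have hexp : Continuous (fun x : ℝ => Complex.exp (-(Complex.I * k) * x)) :=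
    (contDiff_expX k).continuous
  have hφ : Integrable (testFn k h) (volume.restrict cell) := by
    rw [volume_restrict_cell]
    have h1 : Integrable (fun x : ℝ => Complex.exp (-(Complex.I * k) * x))
        (volume.restrict (Ioc 0 (2 * Real.pi))) := hexp.integrableOn_Ioc
    have := h1.mul_prod hSi
    rw [hS] at this; exact this
  have hprod : Integrable (fun x : (ℝ × ℝ) × (ℤ × ℝ) => eChar x.1 x.2 * (testFn k h x.1 * g x.2))
      ((volume.restrict cell).prod freqMeasure) :=
    (hφ.mul_prod hg).bdd_mul (c := 1) measurable_eChar.aestronglyMeasurable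
      (Eventually.of_forall fun p => (norm_eChar _ _).le)
  have hinner : ∀ p : ℤ × ℝ, ∫ z in cell, eChar z p * (testFn k h z * g p) =
      ((2 * Real.pi : ℝ) : ℂ) * (g p * single k h p) := by
    intro p
    have e : ∀ z : ℝ × ℝ, eChar z p * (testFn k h z * g p) =
        g p * (Complex.exp (Complex.I * ((p.1 - k : ℤ) : ℂ) * z.1) *
          (Complex.exp (Complex.I * ((p.2 * z.2 : ℝ) : ℂ)) * S z.2)) := by
      intro z
      rw [testFn, eChar, ← hS]
      rw [show Complex.I * (((p.1 : ℝ) * z.1 + p.2 * z.2 : ℝ) : ℂ) = Complex.I * p.1 * z.1 +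
        Complex.I * ((p.2 * z.2 : ℝ) : ℂ) by push_cast; ring, Complex.exp_add,
        show Complex.I * ((p.1 - k : ℤ) : ℂ) * z.1 = Complex.I * p.1 * z.1 +
          -(Complex.I * k) * z.1 by push_cast; ring, Complex.exp_add]
      ring
    simp_rw [e]
    rw [integral_const_mul, volume_restrict_cell,
      integral_prod_mul (fun x : ℝ => Complex.exp (Complex.I * ((p.1 - k : ℤ) : ℂ) * x))
        (fun y : ℝ => Complex.exp (Complex.I * ((p.2 * y : ℝ) : ℂ)) * S y),
      integral_exp_int, hinv]
    by_cases hk : p.1 = k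
    · simp [single, hk]; ring
    · simp [single, hk, sub_eq_zero]
  calc ∫ z in cell, invFourier g z * testFn k h z
      = ∫ z in cell, ((2 * Real.pi)⁻¹ : ℝ) * ∫ p, eChar z p * (testFn k h z * g p) ∂freqMeasure := by
        congr 1; ext z
        rw [invFourier_eq, mul_assoc, ← integral_mul_const]
        congr 2; ext p; ring
    _ = ((2 * Real.pi)⁻¹ : ℝ) * ∫ p, (∫ z in cell, eChar z p * (testFn k h z * g p)) ∂freqMeasure := by
        rw [integral_const_mul, integral_integral_swap hprod]
    _ = _ := by
        simp_rw [hinner]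
        rw [integral_const_mul, ← mul_assoc, ← Complex.ofReal_mul,
          inv_mul_cancel₀ (by positivity)]; simp

lemma HasFourier.integral_cell_mul_testFn {f : ℝ × ℝ → ℂ} {g : ℤ × ℝ → ℂ} (hf : HasFourier f g)
    (k : ℤ) {h : ℝ → ℂ} (hh : IsBump h) :
    ∫ z in cell, f z * testFn k h z = ∫ p, g p * single k h p ∂freqMeasure := by
  rw [← integral_cell_invFourier_mul_testFn hf.integrable k hh]
  refine integral_congr_ae ?_
  filter_upwards [ae_restrict_of_ae hf.inversion] with z hz
  rw [hz]

/-! ### Uniqueness of the Fourier transform and reality -/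

/-- Smooth, compactly supported functions on the line `{k} × ℝ` of frequencies; for `k = 0` they
vanish near the origin. -/
structure IsBumpAt (k : ℤ) (h : ℝ → ℂ) : Prop extends IsBump h where
  off_zero : k = 0 → (0 : ℝ) ∉ tsupport h

/-- On the line k = 0 the bumps see only the complement of the origin, which loses just a null set.
The restriction is needed later, since `nv` is singular at the zero frequency. -/
lemma ae_eq_zero_of_integral_bump {w : ℤ × ℝ → ℂ}
    (hw : ∀ k : ℤ, LocallyIntegrable (fun ξ => w (k, ξ)))
    (h0 : ∀ k h, IsBumpAt k h → ∫ ξ, w (k, ξ) * h ξ = 0) : w =ᵐ[freqMeasure] 0 := by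
  refine ae_freqMeasure_iff.2 fun k => ?_
  set U : Set ℝ := if k = 0 then {0}ᶜ else univ with hU
  have hUo : IsOpen U := by
    rw [hU]; split_ifs
    · exact isOpen_compl_singleton
    · exact isOpen_univ
  have := hUo.ae_eq_zero_of_integral_contDiff_smul_eq_zero ((hw k).locallyIntegrableOn U)
    (fun g hg hgc hgU => by
      have hb : IsBumpAt k (fun ξ => (g ξ : ℂ)) := by
        have hsub : tsupport (fun ξ => (g ξ : ℂ)) ⊆ tsupport g := by
          apply closure_mono
          intro x hx
          simpa using hx
        refine ⟨⟨Complex.ofRealCLM.contDiff.comp hg, hgc.mono ?_⟩, fun hk h => ?_⟩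
        · intro x hx; simpa using hx
        · have := hgU (hsub h)
          simp [hU, hk] at this
      rw [← h0 k _ hb]
      congr 1; ext ξ
      rw [Complex.real_smul, mul_comm])
  have hne : ∀ᵐ ξ : ℝ, ξ ≠ 0 := by
    rw [ae_iff]; simp
  filter_upwards [this, hne] with ξ h1 h2
  apply h1
  rw [hU]; split_ifs
  · exact h2
  · trivial

lemma integrable_slice {g : ℤ × ℝ → ℂ} (hg : Integrable g freqMeasure) (k : ℤ) :
    Integrable (fun ξ => g (k, ξ)) := by
  have := Integrable.prod_right_ae (μ := (Measure.count : Measure ℤ)) hg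
  rw [ae_iff, Measure.count_eq_zero_iff] at this
  have hk : k ∉ {a : ℤ | ¬Integrable (fun ξ => g (a, ξ))} := by rw [this]; simp
  simpa using hk

lemma IsBump.bounded {h : ℝ → ℂ} (hh : IsBump h) : ∃ C, 0 ≤ C ∧ ∀ ξ, ‖h ξ‖ ≤ C := by
  obtain ⟨C, hC⟩ := hh.compact.exists_bound_of_continuous hh.smooth.continuous
  exact ⟨C, (norm_nonneg _).trans (hC 0), hC⟩

lemma IsBump.measurable_single {h : ℝ → ℂ} (hh : IsBump h) (k : ℤ) : Measurable (single k h) := by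
  have := hh.smooth.continuous.measurable
  unfold single
  refine Measurable.ite ?_ (by fun_prop) measurable_const
  exact measurable_fst (measurableSet_singleton k)

lemma IsBump.integrable_mul_single {g : ℤ × ℝ → ℂ} (hg : Integrable g freqMeasure) {h : ℝ → ℂ}
    (hh : IsBump h) (k : ℤ) : Integrable (fun p => g p * single k h p) freqMeasure := by
  obtain ⟨C, hC0, hC⟩ := hh.bounded
  refine hg.mul_bdd (c := C) (hh.measurable_single k).aestronglyMeasurable
    (Eventually.of_forall fun p => ?_)
  unfold single; split_ifs
  · exact hC _
  · simpa using hC0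

lemma HasFourier.unique {f : ℝ × ℝ → ℂ} {g₁ g₂ : ℤ × ℝ → ℂ} (h₁ : HasFourier f g₁)
    (h₂ : HasFourier f g₂) : g₁ =ᵐ[freqMeasure] g₂ := by
  have hi := h₁.integrable.sub h₂.integrable
  have : (g₁ - g₂) =ᵐ[freqMeasure] 0 := by
    refine ae_eq_zero_of_integral_bump (fun k => (integrable_slice hi k).locallyIntegrable)
      fun k h hh => ?_
    rw [← integral_mul_single _ _ _ (hh.toIsBump.integrable_mul_single hi k)]
    simp only [Pi.sub_apply, sub_mul]
    rw [integral_sub (hh.toIsBump.integrable_mul_single h₁.integrable k)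
      (hh.toIsBump.integrable_mul_single h₂.integrable k),
      ← h₁.integral_cell_mul_testFn k hh.toIsBump, ← h₂.integral_cell_mul_testFn k hh.toIsBump,
      sub_self]
  filter_upwards [this] with p hp
  simpa [sub_eq_zero] using hp

lemma hasFourier_fourierT {f : ℝ × ℝ → ℂ} (h : ∃ g, HasFourier f g) :
    HasFourier f (fourierT f) := by
  rw [fourierT, dif_pos h]; exact h.choose_spec

lemma HasFourier.fourierT_ae_eq {f : ℝ × ℝ → ℂ} {g : ℤ × ℝ → ℂ} (h : HasFourier f g) :
    fourierT f =ᵐ[freqMeasure] g :=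
  (hasFourier_fourierT ⟨g, h⟩).unique h

lemma HasFourier.sub {f₁ f₂ : ℝ × ℝ → ℂ} {g₁ g₂ : ℤ × ℝ → ℂ} (h₁ : HasFourier f₁ g₁)
    (h₂ : HasFourier f₂ g₂) : HasFourier (fun z => f₁ z - f₂ z) (fun p => g₁ p - g₂ p) := by
  refine ⟨h₁.integrable.sub h₂.integrable, ?_⟩
  filter_upwards [h₁.inversion, h₂.inversion] with z e1 e2
  rw [e1, e2, invFourier_eq, invFourier_eq, invFourier_eq, ← mul_sub,
    ← integral_sub (integrable_eChar_mul h₁.integrable z) (integrable_eChar_mul h₂.integrable z)]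
  simp only [mul_sub]

lemma HasFourier.congr {f₁ f₂ : ℝ × ℝ → ℂ} {g : ℤ × ℝ → ℂ} (h₁ : HasFourier f₁ g)
    (h : ∀ᵐ z : ℝ × ℝ, f₁ z = f₂ z) : HasFourier f₂ g := by
  refine ⟨h₁.integrable, ?_⟩
  filter_upwards [h₁.inversion, h] with z e1 e2
  rw [← e2, e1]

/-- For real f, conjugating the inversion formula shows that the reflected conjugate of g is another
Fourier transform of f; uniqueness does the rest. -/
lemma HasFourier.conj_neg {f : ℝ × ℝ → ℝ} {g : ℤ × ℝ → ℂ} (h : HasFourier (toC f) g) :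
    ∀ᵐ p ∂freqMeasure, g (-p) = (starRingEnd ℂ) (g p) := by
  have hstar : HasFourier (toC f) (fun p => (starRingEnd ℂ) (g (-p))) := by
    refine ⟨?_, ?_⟩
    · have := (Complex.conjCLE.toContinuousLinearMap.integrable_comp h.integrable.comp_neg)
      exact this
    · filter_upwards [h.inversion] with z hz
      have : toC f z = (starRingEnd ℂ) (toC f z) := by simp [toC]
      rw [this, hz, invFourier_eq, invFourier_eq, map_mul, Complex.conj_ofReal, ← integral_conj]
      congr 1
      rw [← integral_neg_eq_self]
      congr 1; ext p
      rw [map_mul]; congr 1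
      unfold eChar
      rw [← Complex.exp_conj, map_mul, Complex.conj_I, Complex.conj_ofReal]
      congr 1; push_cast [Prod.fst_neg, Prod.snd_neg]; ring
  have h1 := h.unique hstar
  have h2 := (Measure.measurePreserving_neg freqMeasure).quasiMeasurePreserving.ae h1
  filter_upwards [h2] with p hp
  simpa using hp

/-! ### Products and convolutions -/

/-- The convolution `(2π)⁻¹ ∑∫ f(q) g(p - q) dq`, the Fourier transform of a product. -/
def conv (f g : ℤ × ℝ → ℂ) (p : ℤ × ℝ) : ℂ :=
  ((2 * Real.pi)⁻¹ : ℝ) * ∫ q, f q * g (p - q) ∂freqMeasure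

lemma integrable_conv_integrand {f g : ℤ × ℝ → ℂ} (hf : Integrable f freqMeasure)
    (hg : Integrable g freqMeasure) :
    Integrable (fun x : (ℤ × ℝ) × (ℤ × ℝ) => f x.2 * g (x.1 - x.2))
      (freqMeasure.prod freqMeasure) := 
  hf.convolution_integrand (ContinuousLinearMap.mul ℂ ℂ) hg

lemma HasFourier.mul {f₁ f₂ : ℝ × ℝ → ℂ} {g₁ g₂ : ℤ × ℝ → ℂ} (h₁ : HasFourier f₁ g₁)
    (h₂ : HasFourier f₂ g₂) : HasFourier (fun z => f₁ z * f₂ z) (conv g₁ g₂) := by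
  have hint := integrable_conv_integrand h₁.integrable h₂.integrable
  refine ⟨hint.integral_prod_left.const_mul _, ?_⟩
  filter_upwards [h₁.inversion, h₂.inversion] with z e1 e2
  rw [e1, e2]
  simp only [invFourier_eq]
  have hint' : Integrable (fun x : (ℤ × ℝ) × (ℤ × ℝ) => eChar z x.1 * (g₁ x.2 * g₂ (x.1 - x.2)))
      (freqMeasure.prod freqMeasure) :=
    hint.bdd_mul (c := 1) ((measurable_eChar_right z).comp measurable_fst).aestronglyMeasurable
      (Eventually.of_forall fun p => (norm_eChar _ _).le)
  have hin : ∀ q, ∫ p, eChar z p * (g₁ q * g₂ (p - q)) ∂freqMeasure =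
      eChar z q * g₁ q * ∫ r, eChar z r * g₂ r ∂freqMeasure := by
    intro q
    rw [← integral_add_right_eq_self _ q, ← integral_const_mul]
    congr 1; ext r
    rw [eChar_add, add_sub_cancel_right]; ring
  calc _ = ((2 * Real.pi)⁻¹ : ℝ) * (((2 * Real.pi)⁻¹ : ℝ) *
        ∫ q, ∫ p, eChar z p * (g₁ q * g₂ (p - q)) ∂freqMeasure ∂freqMeasure) := by
        simp_rw [hin]; rw [integral_mul_const]; ring
    _ = ((2 * Real.pi)⁻¹ : ℝ) * (((2 * Real.pi)⁻¹ : ℝ) *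
        ∫ p, ∫ q, eChar z p * (g₁ q * g₂ (p - q)) ∂freqMeasure ∂freqMeasure) := by
        rw [integral_integral_swap (f := fun p q => eChar z p * (g₁ q * g₂ (p - q))) hint']
    _ = _ := by
        congr 1; rw [← integral_const_mul]; congr 1; ext p
        rw [conv, integral_const_mul]; ring

/-! ### The direction orthogonal to `p_t` -/

lemma modL_pos {p : ℤ × ℝ} (hp : p ≠ 0) (t : ℝ) : 0 < modL t p := by
  unfold modL
  rw [Real.sqrt_pos]
  by_cases h : p.1 = 0
  · have h2 : p.2 ≠ 0 := fun h2 => hp (Prod.ext h h2)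
    simp [h]; positivity
  · have : (p.1 : ℝ) ≠ 0 := by exact_mod_cast h
    positivity

lemma ae_ne_zero : ∀ᵐ p ∂freqMeasure, p ≠ 0 := by
  rw [ae_freqMeasure_iff]
  intro k
  have hne : ∀ᵐ ξ : ℝ, ξ ≠ 0 := by rw [ae_iff]; simp
  filter_upwards [hne] with ξ h1 h2
  exact h1 (by simpa using congrArg Prod.snd h2)

/-- The unit vector `(ξ - k t, -k) / |p_t|` orthogonal to `p_t`. -/
def nv (t : ℝ) (p : ℤ × ℝ) (j : Fin 2) : ℝ := ![(p.2 - p.1 * t) / modL t p, -p.1 / modL t p] j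

lemma nv_zero (t : ℝ) (p : ℤ × ℝ) : nv t p 0 = (p.2 - p.1 * t) / modL t p := rfl
lemma nv_one (t : ℝ) (p : ℤ × ℝ) : nv t p 1 = -p.1 / modL t p := rfl
lemma sym_zero (t : ℝ) (p : ℤ × ℝ) : sym t p 0 = p.1 := rfl
lemma sym_one (t : ℝ) (p : ℤ × ℝ) : sym t p 1 = p.2 - p.1 * t := rfl

lemma measurable_nv (t : ℝ) (j : Fin 2) : Measurable (fun p => nv t p j) := by
  fin_cases j
  · simp only [Fin.zero_eta, nv_zero]; fun_prop
  · simp only [Fin.mk_one, nv_one]; fun_prop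

lemma measurable_sym (t : ℝ) (j : Fin 2) : Measurable (fun p => sym t p j) := by
  fin_cases j
  · simp only [Fin.zero_eta, sym_zero]; fun_prop
  · simp only [Fin.mk_one, sym_one]; fun_prop

lemma nv_sq_add {p : ℤ × ℝ} (hp : p ≠ 0) (t : ℝ) : nv t p 0 ^ 2 + nv t p 1 ^ 2 = 1 := by
  have h := modL_pos hp t
  have h2 := modL_sq t p
  rw [nv_zero, nv_one]
  field_simp
  rw [h2]; ring

lemma nv_sq_add_le (t : ℝ) (p : ℤ × ℝ) : nv t p 0 ^ 2 + nv t p 1 ^ 2 ≤ 1 := by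
  by_cases hp : p = 0
  · subst hp; simp [nv_zero, nv_one]
  · exact (nv_sq_add hp t).le

lemma abs_nv_le (t : ℝ) (p : ℤ × ℝ) (j : Fin 2) : |nv t p j| ≤ 1 := by
  have h := nv_sq_add_le t p
  rw [← sq_le_one_iff_abs_le_one]
  fin_cases j
  · simp only [Fin.zero_eta]; nlinarith [sq_nonneg (nv t p 1)]
  · simp only [Fin.mk_one]; nlinarith [sq_nonneg (nv t p 0)]

lemma sym_mul_nv (t : ℝ) (p : ℤ × ℝ) : sym t p 0 * nv t p 0 + sym t p 1 * nv t p 1 = 0 := by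
  rw [nv_zero, nv_one, sym_zero, sym_one]; ring

lemma sym_eq {p : ℤ × ℝ} (hp : p ≠ 0) (t : ℝ) :
    sym t p 0 = -(modL t p * nv t p 1) ∧ sym t p 1 = modL t p * nv t p 0 := by
  have h := (modL_pos hp t).ne'
  rw [nv_zero, nv_one, sym_zero, sym_one]
  constructor <;> field_simp

lemma abs_sym_le (t : ℝ) (p : ℤ × ℝ) (j : Fin 2) : |sym t p j| ≤ modL t p := by
  refine Real.abs_le_sqrt ?_
  fin_cases j
  · simp only [Fin.zero_eta, sym_zero]; nlinarith [sq_nonneg (p.2 - p.1 * t)]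
  · simp only [Fin.mk_one, sym_one]; nlinarith [sq_nonneg (p.1 : ℝ)]

/-- The inner product p_τ · p_t equals (|p_τ|² + |p_t|² - k²(τ - t)²)/2. Hence one minus the cosine
of the angle is at most k²(τ - t)²/(2|p_τ||p_t|), and k² ≤ |p_τ||p_t|. The quadratic order in τ - t
expresses that the derivative of a unit vector is orthogonal to it. -/
lemma one_sub_nv_mul_nv {p : ℤ × ℝ} (hp : p ≠ 0) (t τ : ℝ) :
    0 ≤ 1 - (nv τ p 0 * nv t p 0 + nv τ p 1 * nv t p 1) ∧
      1 - (nv τ p 0 * nv t p 0 + nv τ p 1 * nv t p 1) ≤ (τ - t) ^ 2 / 2 := by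
  have h1 := nv_sq_add hp t
  have h2 := nv_sq_add hp τ
  refine ⟨by nlinarith [sq_nonneg (nv τ p 0 - nv t p 0), sq_nonneg (nv τ p 1 - nv t p 1)], ?_⟩
  have ht := modL_pos hp t
  have hτ := modL_pos hp τ
  have e1 := modL_sq t p
  have e2 := modL_sq τ p
  have hk : (p.1 : ℝ) ^ 2 ≤ modL τ p * modL t p := by
    refine abs_le_of_sq_le_sq' ?_ (by positivity) |>.2
    rw [mul_pow, e1, e2]
    nlinarith [mul_nonneg (sq_nonneg (p.1 : ℝ)) (sq_nonneg (p.2 - p.1 * t)),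
      mul_nonneg (sq_nonneg (p.1 : ℝ)) (sq_nonneg (p.2 - p.1 * τ)),
      mul_nonneg (sq_nonneg (p.2 - p.1 * t)) (sq_nonneg (p.2 - p.1 * τ))]
  rw [nv_zero, nv_zero, nv_one, nv_one]
  have : (p.2 - p.1 * τ) / modL τ p * ((p.2 - p.1 * t) / modL t p) +
      -p.1 / modL τ p * (-p.1 / modL t p) =
      ((p.2 - p.1 * τ) * (p.2 - p.1 * t) + p.1 ^ 2) / (modL τ p * modL t p) := by
    field_simp
  rw [this, sub_le_iff_le_add, ← sub_le_iff_le_add', le_div_iff₀ (by positivity)]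
  nlinarith [sq_nonneg (modL τ p - modL t p), mul_le_mul_of_nonneg_left hk (sq_nonneg (τ - t))]

lemma abs_nv_sub_le {p : ℤ × ℝ} (hp : p ≠ 0) (t τ : ℝ) (j : Fin 2) :
    |nv τ p j - nv t p j| ≤ |τ - t| := by
  have h1 := nv_sq_add hp t
  have h2 := nv_sq_add hp τ
  have h3 := (one_sub_nv_mul_nv hp t τ).2
  rw [← sq_le_sq]
  fin_cases j
  · simp only [Fin.zero_eta]; nlinarith [sq_nonneg (nv τ p 1 - nv t p 1)]
  · simp only [Fin.mk_one]; nlinarith [sq_nonneg (nv τ p 0 - nv t p 0)]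

lemma contDiffAt_nv (t : ℝ) (k : ℤ) (j : Fin 2) {ξ : ℝ} (h : (k, ξ) ≠ (0 : ℤ × ℝ)) :
    ContDiffAt ℝ ∞ (fun ξ : ℝ => ((nv t (k, ξ) j : ℝ) : ℂ)) ξ := by
  have hpos := modL_pos h t
  have hm : ContDiffAt ℝ ∞ (fun ξ : ℝ => modL t (k, ξ)) ξ := by
    unfold modL at *
    refine ContDiffAt.sqrt (f := fun ξ : ℝ => (k : ℝ) ^ 2 + (ξ - k * t) ^ 2) (by fun_prop) ?_
    exact (Real.sqrt_pos.1 hpos).ne'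
  have : ContDiffAt ℝ ∞ (fun ξ : ℝ => nv t (k, ξ) j) ξ := by
    fin_cases j
    · simp only [Fin.zero_eta, nv_zero]
      exact ContDiffAt.div (by fun_prop) hm hpos.ne'
    · simp only [Fin.mk_one, nv_one]
      exact ContDiffAt.div (by fun_prop) hm hpos.ne'
  exact Complex.ofRealCLM.contDiff.contDiffAt.comp ξ this

/-- The only singularity of `nv` is the zero frequency, which the support of a bump on the line k =
0 avoids. -/
lemma IsBumpAt.nv_mul {k : ℤ} {h : ℝ → ℂ} (hh : IsBumpAt k h) (t : ℝ) (j : Fin 2) :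
    IsBump (fun ξ => nv t (k, ξ) j * h ξ) := by
  refine ⟨contDiff_iff_contDiffAt.2 fun ξ => ?_, hh.compact.mul_left⟩
  by_cases hξ : ξ ∈ tsupport h
  · refine (contDiffAt_nv t k j fun h0 => ?_).mul hh.smooth.contDiffAt
    rw [Prod.mk_eq_zero] at h0
    exact hh.off_zero h0.1 (h0.2 ▸ hξ)
  · have : (fun ξ => (nv t (k, ξ) j : ℂ) * h ξ) =ᶠ[𝓝 ξ] fun _ => 0 := by
      filter_upwards [notMem_tsupport_iff_eventuallyEq.1 hξ] with x hx
      simp [hx]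
    exact contDiffAt_const.congr_of_eventuallyEq this

lemma contDiff_sym (t : ℝ) (k : ℤ) (j : Fin 2) :
    ContDiff ℝ ∞ (fun ξ : ℝ => ((sym t (k, ξ) j : ℝ) : ℂ)) := by
  refine Complex.ofRealCLM.contDiff.comp ?_
  fin_cases j
  · exact contDiff_const (c := (k : ℝ))
  · exact (contDiff_id.sub contDiff_const : ContDiff ℝ ∞ fun ξ : ℝ => ξ - k * t)

lemma IsBump.sym_mul {h : ℝ → ℂ} (hh : IsBump h) (t : ℝ) (k : ℤ) (j : Fin 2) :
    IsBump (fun ξ => -(Complex.I * sym t (k, ξ) j) * h ξ) :=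
  hh.mul_left ((contDiff_const.mul (contDiff_sym t k j)).neg)

lemma single_mul (k : ℤ) (m : ℤ × ℝ → ℂ) (h : ℝ → ℂ) (p : ℤ × ℝ) :
    single k (fun ξ => m (k, ξ) * h ξ) p = m p * single k h p := by
  unfold single
  split_ifs with hp
  · rw [← hp]
  · simp

lemma lapL_testFn (t : ℝ) (k : ℤ) {h : ℝ → ℂ} (hh : IsBump h) :
    lapL t (testFn k h) = testFn k (fun ξ => ((-(modL t (k, ξ) ^ 2) : ℝ) : ℂ) * h ξ) := by
  ext z
  simp only [lapL, Fin.sum_univ_two]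
  rw [gradL_testFn t 0 k hh, gradL_testFn t 1 k hh, gradL_testFn t 0 k (hh.sym_mul t k 0),
    gradL_testFn t 1 k (hh.sym_mul t k 1)]
  simp only [testFn]
  rw [← mul_add, ← waveH_add ((hh.sym_mul t k 0).sym_mul t k 0) ((hh.sym_mul t k 1).sym_mul t k 1)]
  congr 2
  ext ξ
  rw [modL_sq, sym_zero, sym_one]
  push_cast
  linear_combination (h ξ * (k ^ 2 + (ξ - k * t) ^ 2)) * Complex.I_sq

lemma IsBump.modL_mul {h : ℝ → ℂ} (hh : IsBump h) (t : ℝ) (k : ℤ) :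
    IsBump (fun ξ => ((-(modL t (k, ξ) ^ 2) : ℝ) : ℂ) * h ξ) := by
  refine hh.mul_left (Complex.ofRealCLM.contDiff.comp ?_)
  simp only [modL_sq]
  refine ContDiff.neg ?_
  fun_prop

/-- This follows from p_t ⊥ `nv` and makes these fields admissible in the momentum equation at time
t. -/
lemma sum_gradL_testFn_nv (t : ℝ) {k : ℤ} {h : ℝ → ℂ} (hh : IsBumpAt k h) (z : ℝ × ℝ) :
    ∑ j, gradL t j (testFn k (fun ξ => nv t (k, ξ) j * h ξ)) z = 0 := by
  rw [Fin.sum_univ_two, gradL_testFn t 0 k (hh.nv_mul t 0), gradL_testFn t 1 k (hh.nv_mul t 1)]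
  simp only [testFn]
  have : (fun ξ => -(Complex.I * sym t (k, ξ) 1) * (nv t (k, ξ) 1 * h ξ)) =
      fun ξ => (-1 : ℂ) * (-(Complex.I * sym t (k, ξ) 0) * (nv t (k, ξ) 0 * h ξ)) := by
    ext ξ
    have : ((sym t (k, ξ) 0 * nv t (k, ξ) 0 + sym t (k, ξ) 1 * nv t (k, ξ) 1 : ℝ) : ℂ) = 0 := by
      rw [sym_mul_nv]; simp
    push_cast at this
    linear_combination (-Complex.I * h ξ) * this
  rw [this, waveH_const_mul]; ring

lemma conv_congr {f f' g g' : ℤ × ℝ → ℂ} (hf : f =ᵐ[freqMeasure] f') (hg : g =ᵐ[freqMeasure] g')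
    (p : ℤ × ℝ) : conv f g p = conv f' g' p := by
  unfold conv
  congr 1
  refine integral_congr_ae ?_
  have := (Measure.measurePreserving_sub_left freqMeasure p).quasiMeasurePreserving.ae hg
  filter_upwards [hf, this] with q h1 h2
  rw [h1, h2]

lemma integrable_conv {f g : ℤ × ℝ → ℂ} (hf : Integrable f freqMeasure)
    (hg : Integrable g freqMeasure) : Integrable (conv f g) freqMeasure :=
  (integrable_conv_integrand hf hg).integral_prod_left.const_mul _

/-! ### Weighted norms on frequency space -/

/-- The norm of `⟨p⟩^σ f` in `L²`. -/
def wnorm (σ : ℝ) (f : ℤ × ℝ → ℂ) : ℝ≥0∞ :=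
  eLpNorm (fun p => ((jb 0 p ^ σ : ℝ) : ℂ) * f p) 2 freqMeasure

lemma wnorm_congr {σ : ℝ} {f g : ℤ × ℝ → ℂ} (h : f =ᵐ[freqMeasure] g) : wnorm σ f = wnorm σ g :=
  eLpNorm_congr_ae (by filter_upwards [h] with p hp; rw [hp])

lemma eLpNorm_two_eq (f : ℤ × ℝ → ℂ) :
    eLpNorm f 2 freqMeasure = (∫⁻ p, ‖f p‖ₑ ^ 2 ∂freqMeasure) ^ (1 / 2 : ℝ) := by
  rw [eLpNorm_eq_lintegral_rpow_enorm_toReal (by norm_num) (by norm_num)]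
  simp

lemma eLpNorm_two_sq (f : ℤ × ℝ → ℂ) :
    eLpNorm f 2 freqMeasure ^ 2 = ∫⁻ p, ‖f p‖ₑ ^ 2 ∂freqMeasure := by
  rw [eLpNorm_two_eq, ← ENNReal.rpow_natCast, ← ENNReal.rpow_mul]; norm_num

lemma enorm_ofReal_mul_sq {c : ℝ} (hc : 0 ≤ c) (z : ℂ) :
    ‖(c : ℂ) * z‖ₑ ^ 2 = ENNReal.ofReal (c ^ 2) * ‖z‖ₑ ^ 2 := by
  rw [enorm_mul, mul_pow, ENNReal.ofReal_pow hc]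
  congr 2
  rw [← ofReal_norm, Complex.norm_real, Real.norm_of_nonneg hc]

lemma sobolevNorm_eq {a : ℝ} {f : ℝ × ℝ → ℂ} (h : ∃ g, HasFourier f g) :
    sobolevNorm a f = wnorm a (fourierT f) := by
  rw [sobolevNorm, if_pos h, wnorm, eLpNorm_two_eq]
  congr 1
  refine lintegral_congr fun p => ?_
  rw [enorm_ofReal_mul_sq (Real.rpow_nonneg (jb_pos 0 p).le _), ← jb_zero,
    ← Real.rpow_mul_natCast (jb_pos 0 p).le]
  congr 3; push_cast; ring

lemma HasFourier.sobolevNorm_eq {a : ℝ} {f : ℝ × ℝ → ℂ} {g : ℤ × ℝ → ℂ} (h : HasFourier f g) :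
    sobolevNorm a f = wnorm a g := by
  rw [Boussinesq.sobolevNorm_eq ⟨g, h⟩, wnorm_congr h.fourierT_ae_eq]

lemma exists_hasFourier {a : ℝ} {f : ℝ × ℝ → ℂ} (h : sobolevNorm a f < ⊤) :
    ∃ g, HasFourier f g := by
  by_contra hn
  rw [sobolevNorm, if_neg hn] at h
  exact lt_irrefl _ h

/-- The `L²` norm of `⟨p⟩^{-σ}`. -/
def wconst (σ : ℝ) : ℝ≥0∞ :=
  eLpNorm (fun p : ℤ × ℝ => ((jb 0 p ^ (-σ) : ℝ) : ℂ)) 2 freqMeasure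

lemma eLpNorm_jb_rpow_lt_top {σ : ℝ} (hσ : 1 < σ) (t : ℝ) :
    eLpNorm (fun p : ℤ × ℝ => ((jb t p ^ (-σ) : ℝ) : ℂ)) 2 freqMeasure < ⊤ := by
  rw [eLpNorm_two_eq]
  refine ENNReal.rpow_lt_top_of_nonneg (by norm_num) ?_
  refine ne_of_eq_of_ne ?_ (lintegral_jb_rpow_lt_top hσ t).ne
  refine lintegral_congr fun p => ?_
  have := enorm_ofReal_mul_sq (Real.rpow_nonneg (jb_pos t p).le (-σ)) 1
  simp only [mul_one, enorm_one, one_pow] at this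
  rw [this, ← Real.rpow_mul_natCast (jb_pos t p).le]
  congr 2; push_cast; ring

lemma wconst_lt_top {σ : ℝ} (hσ : 1 < σ) : wconst σ < ⊤ := eLpNorm_jb_rpow_lt_top hσ 0

lemma aestronglyMeasurable_jb_mul {f : ℤ × ℝ → ℂ} (hf : AEStronglyMeasurable f freqMeasure)
    (σ t : ℝ) : AEStronglyMeasurable (fun p => ((jb t p ^ σ : ℝ) : ℂ) * f p) freqMeasure := by
  have h : Measurable (fun p => ((jb t p ^ σ : ℝ) : ℂ)) := by fun_prop
  exact h.aestronglyMeasurable.mul hf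

/-- Cauchy-Schwarz after writing f as ⟨p⟩^{-σ} times ⟨p⟩^σ f. The constant is finite for σ > 1. -/
lemma eLpNorm_one_le_wnorm (σ : ℝ) {f : ℤ × ℝ → ℂ} (hf : AEStronglyMeasurable f freqMeasure) :
    eLpNorm f 1 freqMeasure ≤ wconst σ * wnorm σ f := by
  have hm : Measurable (fun p => ((jb 0 p ^ (-σ) : ℝ) : ℂ)) := by fun_prop
  have := eLpNorm_smul_le_mul_eLpNorm (p := 2) (q := 2) (r := 1)
    (aestronglyMeasurable_jb_mul hf σ 0) hm.aestronglyMeasurable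
  refine le_of_eq_of_le (congrArg (fun g => eLpNorm g 1 freqMeasure) ?_) this
  ext p
  simp only [Pi.smul_apply', smul_eq_mul]
  rw [← mul_assoc, ← Complex.ofReal_mul, ← Real.rpow_add (jb_pos 0 p)]
  simp

lemma eLpNorm_two_le_wnorm {σ : ℝ} (hσ : 0 ≤ σ) (f : ℤ × ℝ → ℂ) :
    eLpNorm f 2 freqMeasure ≤ wnorm σ f := by
  refine eLpNorm_mono fun p => ?_
  rw [norm_mul, Complex.norm_real, Real.norm_of_nonneg (Real.rpow_nonneg (jb_pos 0 p).le _)]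
  exact le_mul_of_one_le_left (norm_nonneg _) (Real.one_le_rpow (one_le_jb 0 p) hσ)

lemma wnorm_add_le {σ : ℝ} {f g : ℤ × ℝ → ℂ} (hf : AEStronglyMeasurable f freqMeasure)
    (hg : AEStronglyMeasurable g freqMeasure) :
    wnorm σ (fun p => f p + g p) ≤ wnorm σ f + wnorm σ g := by
  refine le_of_eq_of_le ?_ (eLpNorm_add_le (aestronglyMeasurable_jb_mul hf σ 0)
    (aestronglyMeasurable_jb_mul hg σ 0) (by norm_num))
  unfold wnorm
  congr 1; ext p; simp [mul_add]

/-- If `|m| ≤ c` then multiplication by `m` is bounded by `c` in weighted norms. -/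
lemma wnorm_mul_le {σ c : ℝ} {m f : ℤ × ℝ → ℂ} (hm : ∀ᵐ p ∂freqMeasure, ‖m p‖ ≤ c) :
    wnorm σ (fun p => m p * f p) ≤ ENNReal.ofReal c * wnorm σ f := by
  unfold wnorm
  have : ∀ᵐ p ∂freqMeasure, ‖((jb 0 p ^ σ : ℝ) : ℂ) * (m p * f p)‖ ≤
      c * ‖((jb 0 p ^ σ : ℝ) : ℂ) * f p‖ := by
    filter_upwards [hm] with p hp
    rw [norm_mul, norm_mul, norm_mul]
    nlinarith [mul_le_mul_of_nonneg_right hp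
      (mul_nonneg (norm_nonneg ((jb 0 p ^ σ : ℝ) : ℂ)) (norm_nonneg (f p)))]
  exact eLpNorm_le_mul_eLpNorm_of_ae_le_mul this 2

/-! ### The system in frequency variables -/

/-- The vector field with component `w` along the unit vector `nv`. -/
def vel (t : ℝ) (w : ℤ × ℝ → ℂ) (j : Fin 2) (p : ℤ × ℝ) : ℂ := nv t p j * w p

/-- The Fourier transform of `div_L (u f)`, where `u` is the divergence-free field of `w`. -/
def adv (t : ℝ) (w f : ℤ × ℝ → ℂ) (p : ℤ × ℝ) : ℂ :=
  ∑ j, Complex.I * sym t p j * conv (vel t w j) f p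

/-- The right-hand side of the equation for the scalar velocity `v = û · nv`. -/
def rhsV (ν γ t : ℝ) (w f : ℤ × ℝ → ℂ) (p : ℤ × ℝ) : ℂ :=
  -(ν * modL t p ^ 2 + nv t p 0 * nv t p 1 : ℝ) * w p - (γ ^ 2 * nv t p 1 : ℝ) * f p
    - ∑ i, nv t p i * adv t w (vel t w i) p

/-- The right-hand side of the equation for the temperature. -/
def rhsT (μ t : ℝ) (w f : ℤ × ℝ → ℂ) (p : ℤ × ℝ) : ℂ :=
  -(μ * modL t p ^ 2 : ℝ) * f p + nv t p 1 * w p - adv t w f p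

/-- The Boussinesq perturbation system in frequency variables: `û = v nv`, and `θ` is the Fourier
transform of the temperature. -/
structure FreqSol (ν μ γ σ T : ℝ) (v θ : ℝ → ℤ × ℝ → ℂ) : Prop where
  meas_v : ∀ t ∈ Icc 0 T, AEStronglyMeasurable (v t) freqMeasure
  meas_θ : ∀ t ∈ Icc 0 T, AEStronglyMeasurable (θ t) freqMeasure
  norm_v : ∀ t ∈ Icc 0 T, wnorm σ (v t) < ⊤
  norm_θ : ∀ t ∈ Icc 0 T, wnorm σ (θ t) < ⊤
  cont_v : ∀ t ∈ Icc 0 T,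
    Tendsto (fun τ => wnorm σ (fun p => v τ p - v t p)) (𝓝[Icc 0 T] t) (𝓝 0)
  cont_θ : ∀ t ∈ Icc 0 T,
    Tendsto (fun τ => wnorm σ (fun p => θ τ p - θ t p)) (𝓝[Icc 0 T] t) (𝓝 0)
  real_v : ∀ t ∈ Icc 0 T, ∀ᵐ p ∂freqMeasure, v t (-p) = -(starRingEnd ℂ) (v t p)
  weak_v : ∀ t ∈ Icc 0 T, ∀ k h, IsBumpAt k h →
    HasDerivWithinAt (fun τ => ∫ p, v τ p * single k h p ∂freqMeasure)
      (∫ p, rhsV ν γ t (v t) (θ t) p * single k h p ∂freqMeasure) (Icc 0 T) t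
  weak_θ : ∀ t ∈ Icc 0 T, ∀ k h, IsBumpAt k h →
    HasDerivWithinAt (fun τ => ∫ p, θ τ p * single k h p ∂freqMeasure)
      (∫ p, rhsT μ t (v t) (θ t) p * single k h p ∂freqMeasure) (Icc 0 T) t

lemma HasFourier.pairing {f : ℝ × ℝ → ℂ} {g : ℤ × ℝ → ℂ} (hf : HasFourier f g) {k : ℤ}
    {h : ℝ → ℂ} {m : ℤ × ℝ → ℂ} (hb : IsBump (fun ξ => m (k, ξ) * h ξ)) :
    Integrable (fun p => g p * (m p * single k h p)) freqMeasure ∧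
    ∫ z in cell, f z * testFn k (fun ξ => m (k, ξ) * h ξ) z =
      ∫ p, g p * (m p * single k h p) ∂freqMeasure := by
  have h1 := hb.integrable_mul_single hf.integrable k
  have h2 := hf.integral_cell_mul_testFn k hb
  simp only [single_mul] at h1 h2
  exact ⟨h1, h2⟩

section Extraction

variable {ν μ γ σ T : ℝ} {uin : Fin 2 → ℝ × ℝ → ℝ} {θin : ℝ × ℝ → ℝ}
  {u : Fin 2 → ℝ → ℝ × ℝ → ℝ} {θ : ℝ → ℝ × ℝ → ℝ}

/-- The component of the Fourier transform of `u` along `nv`. -/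
def velT (u : Fin 2 → ℝ → ℝ × ℝ → ℝ) (t : ℝ) (p : ℤ × ℝ) : ℂ :=
  ∑ i, nv t p i * fourierT (toC (u i t)) p

/-- The Fourier transform of the temperature. -/
def tempT (θ : ℝ → ℝ × ℝ → ℝ) (t : ℝ) : ℤ × ℝ → ℂ := fourierT (toC (θ t))

lemma ContinuousInSobolev.hasFourier {f : ℝ → ℝ × ℝ → ℝ} (h : ContinuousInSobolev σ T f) {t : ℝ}
    (ht : t ∈ Icc 0 T) : HasFourier (toC (f t)) (fourierT (toC (f t))) :=
  hasFourier_fourierT (exists_hasFourier (h t ht).1)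

lemma ContinuousInSobolev.wnorm_lt_top {f : ℝ → ℝ × ℝ → ℝ} (h : ContinuousInSobolev σ T f) {t : ℝ}
    (ht : t ∈ Icc 0 T) : wnorm σ (fourierT (toC (f t))) < ⊤ := by
  rw [← sobolevNorm_eq (exists_hasFourier (h t ht).1)]; exact (h t ht).1

lemma ContinuousInSobolev.tendsto_wnorm {f : ℝ → ℝ × ℝ → ℝ} (h : ContinuousInSobolev σ T f)
    {t : ℝ} (ht : t ∈ Icc 0 T) :
    Tendsto (fun τ => wnorm σ (fun p => fourierT (toC (f τ)) p - fourierT (toC (f t)) p))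
      (𝓝[Icc 0 T] t) (𝓝 0) := by
  refine (h t ht).2.congr' ?_
  filter_upwards [self_mem_nhdsWithin] with τ hτ
  have := (h.hasFourier hτ).sub (h.hasFourier ht)
  rw [← this.sobolevNorm_eq]
  congr 1; ext z; simp [toC]

lemma IsSolution.sum_sym_mul (hsol : IsSolution ν μ γ σ T uin θin u θ) {t : ℝ}
    (ht : t ∈ Icc 0 T) :
    ∀ᵐ p ∂freqMeasure, ∑ j, (sym t p j : ℂ) * fourierT (toC (u j t)) p = 0 := by
  have hF := fun j => (hsol.continuous_u j).hasFourier ht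
  refine ae_eq_zero_of_integral_bump (fun k => ?_) fun k h hh => ?_
  · have hj : ∀ j, LocallyIntegrable
        (fun ξ => (sym t (k, ξ) j : ℂ) * fourierT (toC (u j t)) (k, ξ)) := fun j => by
      have h1 := ((integrable_slice (hF j).integrable k).locallyIntegrable).locallyIntegrableOn univ
      have h2 := h1.continuousOn_mul (contDiff_sym t k j).continuous.continuousOn
        isOpen_univ.isLocallyClosed
      rwa [locallyIntegrableOn_univ] at h2
    simp only [Fin.sum_univ_two]
    exact (hj 0).add (hj 1)
  · have hp := fun j => (hF j).pairing (m := fun p => -(Complex.I * sym t p j))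
      (hh.toIsBump.sym_mul t k j)
    have hd := hsol.div_free t ht _ (isTest_testFn k hh.toIsBump)
    have hz : ∀ j, ∫ z in cell, (u j t z : ℂ) * gradL t j (testFn k h) z =
        ∫ p, fourierT (toC (u j t)) p * (-(Complex.I * sym t p j) * single k h p) ∂freqMeasure := by
      intro j
      rw [gradL_testFn t j k hh.toIsBump]
      exact (hp j).2
    simp only [hz, Fin.sum_univ_two] at hd
    rw [← integral_add (hp 0).1 (hp 1).1] at hd
    have e : ∀ p : ℤ × ℝ, fourierT (toC (u 0 t)) p * (-(Complex.I * sym t p 0) * single k h p) +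
        fourierT (toC (u 1 t)) p * (-(Complex.I * sym t p 1) * single k h p) =
        -Complex.I * ((∑ j, (sym t p j : ℂ) * fourierT (toC (u j t)) p) * single k h p) := by
      intro p; rw [Fin.sum_univ_two]; ring
    simp_rw [e] at hd
    have hint : Integrable (fun p => (∑ j, (sym t p j : ℂ) * fourierT (toC (u j t)) p) *
        single k h p) freqMeasure := by
      have := ((hp 0).1.add (hp 1).1).const_mul Complex.I
      refine this.congr (Eventually.of_forall fun p => ?_)
      simp only [Pi.add_apply, e]
      rw [← mul_assoc]; simp
    rw [integral_const_mul] at hd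
    rw [← integral_mul_single _ _ _ hint]
    simpa using hd

/-- The transform of u is orthogonal to p_t, and in dimension two the orthogonal complement of p_t
is spanned by `nv`. -/
lemma IsSolution.fourierT_u (hsol : IsSolution ν μ γ σ T uin θin u θ) {t : ℝ}
    (ht : t ∈ Icc 0 T) (j : Fin 2) :
    fourierT (toC (u j t)) =ᵐ[freqMeasure] vel t (velT u t) j := by
  filter_upwards [hsol.sum_sym_mul ht, ae_ne_zero] with p h1 h2
  have hm := modL_pos h2 t
  have hn := nv_sq_add h2 t
  obtain ⟨e0, e1⟩ := sym_eq h2 t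
  simp only [vel, velT, Fin.sum_univ_two] at h1 ⊢
  rw [e0, e1] at h1
  have hm' : (modL t p : ℂ) ≠ 0 := by exact_mod_cast hm.ne'
  have hn' : (nv t p 0 : ℂ) ^ 2 + (nv t p 1 : ℂ) ^ 2 = 1 := by exact_mod_cast hn
  have h3 : (nv t p 0 : ℂ) * fourierT (toC (u 1 t)) p =
      (nv t p 1 : ℂ) * fourierT (toC (u 0 t)) p := by
    apply mul_left_cancel₀ hm'
    push_cast at h1
    linear_combination h1
  fin_cases j
  · simp only [Fin.zero_eta]
    linear_combination -(fourierT (toC (u 0 t)) p) * hn' - (nv t p 1 : ℂ) * h3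
  · simp only [Fin.mk_one]
    linear_combination -(fourierT (toC (u 1 t)) p) * hn' + (nv t p 0 : ℂ) * h3

end Extraction

lemma integrable_fun_sub {f g : ℤ × ℝ → ℂ} (hf : Integrable f freqMeasure)
    (hg : Integrable g freqMeasure) : Integrable (fun p => f p - g p) freqMeasure := hf.sub hg

lemma integrable_of_wnorm {σ : ℝ} (hσ : 1 < σ) {f : ℤ × ℝ → ℂ}
    (hf : AEStronglyMeasurable f freqMeasure) (h : wnorm σ f < ⊤) : Integrable f freqMeasure :=
  memLp_one_iff_integrable.1
    ⟨hf, (eLpNorm_one_le_wnorm σ hf).trans_lt (ENNReal.mul_lt_top (wconst_lt_top hσ) h)⟩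

/-- Pairings with a function that varies quadratically slowly have zero derivative. -/
lemma hasDerivWithinAt_zero_of_sq_bound {S : Set ℝ} {t C : ℝ} {f : ℝ → ℂ} (h0 : f t = 0)
    (hb : ∀ᶠ τ in 𝓝[S] t, ‖f τ‖ ≤ C * (τ - t) ^ 2) : HasDerivWithinAt f 0 S t := by
  rw [hasDerivWithinAt_iff_isLittleO]
  simp only [h0, sub_zero, smul_zero]
  have h1 : f =O[𝓝[S] t] fun τ => (τ - t) ^ 2 := by
    refine Asymptotics.IsBigO.of_bound C ?_
    filter_upwards [hb] with τ hτ
    rwa [Real.norm_eq_abs, abs_of_nonneg (sq_nonneg _)]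
  refine h1.trans_isLittleO ?_
  have h2 : Tendsto (fun τ : ℝ => τ - t) (𝓝[S] t) (𝓝 0) := by
    have : Tendsto (fun τ : ℝ => τ - t) (𝓝 t) (𝓝 (t - t)) := tendsto_id.sub_const t
    rw [sub_self] at this
    exact this.mono_left nhdsWithin_le_nhds
  have h3 : (fun τ : ℝ => τ - t) =o[𝓝[S] t] (fun _ => (1 : ℝ)) :=
    (Asymptotics.isLittleO_one_iff ℝ).2 h2
  simpa [sq] using h3.mul_isBigO (Asymptotics.isBigO_refl (fun τ : ℝ => τ - t) _)

lemma enorm_integral_mul_le {f m : ℤ × ℝ → ℂ} {c : ℝ}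
    (hm : ∀ᵐ p ∂freqMeasure, ‖m p‖ ≤ c) :
    ‖∫ p, f p * m p ∂freqMeasure‖ₑ ≤ ENNReal.ofReal c * eLpNorm f 1 freqMeasure := by
  refine (enorm_integral_le_lintegral_enorm _).trans ?_
  rw [← eLpNorm_one_eq_lintegral_enorm]
  refine eLpNorm_le_mul_eLpNorm_of_ae_le_mul ?_ 1
  filter_upwards [hm] with p hp
  rw [norm_mul, mul_comm]
  exact mul_le_mul_of_nonneg_right hp (norm_nonneg _)

section Extraction

variable {ν μ γ σ T : ℝ} {uin : Fin 2 → ℝ × ℝ → ℝ} {θin : ℝ × ℝ → ℝ}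
  {u : Fin 2 → ℝ → ℝ × ℝ → ℝ} {θ : ℝ → ℝ × ℝ → ℝ}

lemma aestronglyMeasurable_nv_mul (t : ℝ) (i : Fin 2) {f : ℤ × ℝ → ℂ}
    (hf : AEStronglyMeasurable f freqMeasure) :
    AEStronglyMeasurable (fun p => (nv t p i : ℂ) * f p) freqMeasure :=
  (Complex.measurable_ofReal.comp (measurable_nv t i)).aestronglyMeasurable.mul hf

lemma norm_nv_le (t : ℝ) (i : Fin 2) (p : ℤ × ℝ) : ‖(nv t p i : ℂ)‖ ≤ 1 := by
  rw [Complex.norm_real]; exact abs_nv_le t p i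

lemma IsSolution.meas_u (hsol : IsSolution ν μ γ σ T uin θin u θ) {t : ℝ} (ht : t ∈ Icc 0 T)
    (i : Fin 2) : AEStronglyMeasurable (fourierT (toC (u i t))) freqMeasure :=
  ((hsol.continuous_u i).hasFourier ht).integrable.aestronglyMeasurable

lemma IsSolution.meas_velT (hsol : IsSolution ν μ γ σ T uin θin u θ) {t : ℝ} (ht : t ∈ Icc 0 T) :
    AEStronglyMeasurable (velT u t) freqMeasure := by
  unfold velT
  simp only [Fin.sum_univ_two]
  exact (aestronglyMeasurable_nv_mul t 0 (hsol.meas_u ht 0)).add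
    (aestronglyMeasurable_nv_mul t 1 (hsol.meas_u ht 1))

lemma IsSolution.wnorm_velT (hsol : IsSolution ν μ γ σ T uin θin u θ) {t : ℝ}
    (ht : t ∈ Icc 0 T) : wnorm σ (velT u t) < ⊤ := by
  unfold velT
  simp only [Fin.sum_univ_two]
  refine (wnorm_add_le (aestronglyMeasurable_nv_mul t 0 (hsol.meas_u ht 0))
    (aestronglyMeasurable_nv_mul t 1 (hsol.meas_u ht 1))).trans_lt ?_
  refine ENNReal.add_lt_top.2 ⟨?_, ?_⟩
  all_goals
    refine (wnorm_mul_le (c := 1) (Eventually.of_forall (norm_nv_le t _))).trans_lt ?_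
    exact ENNReal.mul_lt_top ENNReal.ofReal_lt_top ((hsol.continuous_u _).wnorm_lt_top ht)

lemma IsSolution.tendsto_velT (hsol : IsSolution ν μ γ σ T uin θin u θ) {t : ℝ}
    (ht : t ∈ Icc 0 T) :
    Tendsto (fun τ => wnorm σ (fun p => velT u τ p - velT u t p)) (𝓝[Icc 0 T] t) (𝓝 0) := by
  set U := fun (i : Fin 2) τ => fourierT (toC (u i τ)) with hU
  have hb : ∀ τ ∈ Icc 0 T, ∀ i, wnorm σ (fun p => (nv τ p i : ℂ) * U i τ p - nv t p i * U i t p) ≤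
      wnorm σ (fun p => U i τ p - U i t p) + ENNReal.ofReal |τ - t| * wnorm σ (U i t) := by
    intro τ hτ i
    have e : (fun p => (nv τ p i : ℂ) * U i τ p - nv t p i * U i t p) = fun p =>
        (nv τ p i : ℂ) * (U i τ p - U i t p) + ((nv τ p i - nv t p i : ℝ) : ℂ) * U i t p := by
      ext p; push_cast; ring
    have hm := (hsol.meas_u hτ i).sub (hsol.meas_u ht i)
    rw [e]
    refine (wnorm_add_le (aestronglyMeasurable_nv_mul τ i hm) ?_).trans (add_le_add ?_ ?_)
    · have : Measurable (fun p => ((nv τ p i - nv t p i : ℝ) : ℂ)) :=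
        Complex.measurable_ofReal.comp ((measurable_nv τ i).sub (measurable_nv t i))
      exact this.aestronglyMeasurable.mul (hsol.meas_u ht i)
    · simpa using wnorm_mul_le (σ := σ) (c := 1) (f := fun p => U i τ p - U i t p)
        (Eventually.of_forall (norm_nv_le τ i))
    · refine wnorm_mul_le ?_
      filter_upwards [ae_ne_zero] with p hp
      rw [Complex.norm_real]
      exact abs_nv_sub_le hp t τ i
  have hlim : ∀ i, Tendsto (fun τ => wnorm σ (fun p => U i τ p - U i t p) +
      ENNReal.ofReal |τ - t| * wnorm σ (U i t)) (𝓝[Icc 0 T] t) (𝓝 0) := by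
    intro i
    have h1 : Tendsto (fun τ : ℝ => ENNReal.ofReal |τ - t|) (𝓝[Icc 0 T] t) (𝓝 0) := by
      have : Continuous (fun τ : ℝ => ENNReal.ofReal |τ - t|) :=
        ENNReal.continuous_ofReal.comp (by fun_prop)
      have := this.tendsto t
      simp only [sub_self, abs_zero, ENNReal.ofReal_zero] at this
      exact this.mono_left nhdsWithin_le_nhds
    have h2 := ENNReal.Tendsto.mul_const h1
      (Or.inr ((hsol.continuous_u i).wnorm_lt_top ht).ne)
    simpa using ((hsol.continuous_u i).tendsto_wnorm ht).add h2
  have hsum := (hlim 0).add (hlim 1)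
  rw [add_zero] at hsum
  refine tendsto_of_tendsto_of_tendsto_of_le_of_le' tendsto_const_nhds hsum
    (Eventually.of_forall fun _ => zero_le) ?_
  filter_upwards [self_mem_nhdsWithin] with τ hτ
  refine le_trans ?_ (add_le_add (hb τ hτ 0) (hb τ hτ 1))
  refine le_of_eq_of_le ?_ (wnorm_add_le ?_ ?_)
  · congr 1; ext p; simp only [velT, Fin.sum_univ_two, hU]; ring
  · exact (aestronglyMeasurable_nv_mul τ _ (hsol.meas_u hτ _)).fun_sub
      (aestronglyMeasurable_nv_mul t _ (hsol.meas_u ht _))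
  · exact (aestronglyMeasurable_nv_mul τ _ (hsol.meas_u hτ _)).fun_sub
      (aestronglyMeasurable_nv_mul t _ (hsol.meas_u ht _))

/-- Because `nv` is odd, reality of u turns into v(-p) = -conj v(p), with a minus sign. -/
lemma nv_neg (t : ℝ) (p : ℤ × ℝ) (j : Fin 2) : nv t (-p) j = -nv t p j := by
  have hm : modL t (-p) = modL t p := by
    unfold modL; congr 1; push_cast [Prod.fst_neg, Prod.snd_neg]; ring
  fin_cases j
  · simp only [Fin.zero_eta, nv_zero, hm, Prod.fst_neg, Prod.snd_neg]; push_cast; ring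
  · simp only [Fin.mk_one, nv_one, hm, Prod.fst_neg]; push_cast; ring

lemma IsSolution.velT_neg (hsol : IsSolution ν μ γ σ T uin θin u θ) {t : ℝ} (ht : t ∈ Icc 0 T) :
    ∀ᵐ p ∂freqMeasure, velT u t (-p) = -(starRingEnd ℂ) (velT u t p) := by
  filter_upwards [((hsol.continuous_u 0).hasFourier ht).conj_neg,
    ((hsol.continuous_u 1).hasFourier ht).conj_neg] with p h0 h1
  simp only [velT, Fin.sum_univ_two, nv_neg, h0, h1, map_add, map_mul, Complex.conj_ofReal]
  push_cast; ring

lemma IsSolution.temperature_freq (hsol : IsSolution ν μ γ σ T uin θin u θ) {t : ℝ}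
    (ht : t ∈ Icc 0 T) {k : ℤ} {h : ℝ → ℂ} (hh : IsBumpAt k h) :
    HasDerivWithinAt (fun τ => ∫ p, tempT θ τ p * single k h p ∂freqMeasure)
      (∫ p, rhsT μ t (velT u t) (tempT θ t) p * single k h p ∂freqMeasure) (Icc 0 T) t := by
  have hΘ := fun {τ} (hτ : τ ∈ Icc 0 T) => hsol.continuous_θ.hasFourier hτ
  have hU := fun j => (hsol.continuous_u j).hasFourier ht
  have hb := hh.toIsBump
  have hw := hsol.temperature t ht _ (isTest_testFn k hb)
  refine (hw.congr (fun τ hτ => ?_) ?_).congr_deriv ?_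
  · exact ((hΘ hτ).integral_cell_mul_testFn k hb).symm
  · exact ((hΘ ht).integral_cell_mul_testFn k hb).symm
  · have h1 := (hΘ ht).pairing (m := fun p => ((-(modL t p ^ 2) : ℝ) : ℂ)) (hb.modL_mul t k)
    have h2 := (hU 1).integral_cell_mul_testFn k hb
    have h2i := hb.integrable_mul_single (hU 1).integrable k
    have h3 := fun j => ((hU j).mul (hΘ ht)).pairing (m := fun p => -(Complex.I * sym t p j))
      (hb.sym_mul t k j)
    have e1 := h1.2
    have e3 := fun j => (h3 j).2
    rw [lapL_testFn t k hb]
    simp only [gradL_testFn t _ k hb, Fin.sum_univ_two]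
    simp only [toC] at e1 e3 h2
    rw [e1, h2, e3, e3, ← integral_const_mul, ← integral_add (h1.1.const_mul _) h2i,
      ← integral_add (h3 0).1 (h3 1).1,
      ← integral_add ((h1.1.const_mul _).fun_add h2i) ((h3 0).1.fun_add (h3 1).1)]
    refine integral_congr_ae ?_
    filter_upwards [hsol.fourierT_u ht 1] with p hp
    have c0 := conv_congr (hsol.fourierT_u ht 0) (ae_eq_refl (tempT θ t)) p
    have c1 := conv_congr (hsol.fourierT_u ht 1) (ae_eq_refl (tempT θ t)) p
    simp only [rhsT, adv, Fin.sum_univ_two, ← c0, ← c1]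
    simp only [tempT, vel] at hp ⊢
    rw [hp]
    push_cast; ring

/-- The test field must be divergence free at the time t of differentiation, so `nv` is frozen at t,
whereas the scalar velocity at time τ is taken along `nv` at τ. The two pairings differ by the
factor 1 - nv(τ) · nv(t), which is quadratic in τ - t and does not affect the derivative at t. The
damping term nv₀ nv₁ is the projection of (u₂, 0) on `nv`. -/
lemma IsSolution.momentum_freq (hσ : 1 < σ) (hsol : IsSolution ν μ γ σ T uin θin u θ) {t : ℝ}
    (ht : t ∈ Icc 0 T) {k : ℤ} {h : ℝ → ℂ} (hh : IsBumpAt k h) :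
    HasDerivWithinAt (fun τ => ∫ p, velT u τ p * single k h p ∂freqMeasure)
      (∫ p, rhsV ν γ t (velT u t) (tempT θ t) p * single k h p ∂freqMeasure) (Icc 0 T) t := by
  have hΘ := hsol.continuous_θ.hasFourier ht
  have hU := fun j {τ} (hτ : τ ∈ Icc 0 T) => (hsol.continuous_u j).hasFourier hτ
  have hb := hh.toIsBump
  have hvi : ∀ {τ}, τ ∈ Icc 0 T → Integrable (velT u τ) freqMeasure := fun hτ =>
    integrable_of_wnorm hσ (hsol.meas_velT hτ) (hsol.wnorm_velT hτ)
  have hw := hsol.momentum t ht (fun i => testFn k (fun ξ => nv t (k, ξ) i * h ξ))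
    (fun i => isTest_testFn k (hh.nv_mul t i)) (sum_gradL_testFn_nv t hh)
  obtain ⟨Ch, hCh0, hCh⟩ := hb.bounded
  have hs : ∀ p, ‖single k h p‖ ≤ Ch := fun p => by
    unfold single; split_ifs
    · exact hCh _
    · simpa using hCh0
  -- the part of the pairing due to the rotation of `nv`
  set D : ℝ → ℂ := fun τ => ∫ p, velT u τ p *
    (((1 - (nv τ p 0 * nv t p 0 + nv τ p 1 * nv t p 1) : ℝ) : ℂ) * single k h p) ∂freqMeasure
    with hD
  have hDb : ∀ τ p, p ≠ 0 →
      ‖((1 - (nv τ p 0 * nv t p 0 + nv τ p 1 * nv t p 1) : ℝ) : ℂ) * single k h p‖ ≤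
        Ch * (τ - t) ^ 2 := by
    intro τ p hp
    obtain ⟨a1, a2⟩ := one_sub_nv_mul_nv hp t τ
    rw [norm_mul, Complex.norm_real, Real.norm_of_nonneg a1]
    nlinarith [hs p, norm_nonneg (single k h p), sq_nonneg (τ - t)]
  have hDder : HasDerivWithinAt D 0 (Icc 0 T) t := by
    refine hasDerivWithinAt_zero_of_sq_bound
      (C := Ch * (wconst σ * (1 + wnorm σ (velT u t))).toReal) ?_ ?_
    · have : ∀ᵐ p ∂freqMeasure, velT u t p *
        (((1 - (nv t p 0 * nv t p 0 + nv t p 1 * nv t p 1) : ℝ) : ℂ) * single k h p) = 0 := by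
        filter_upwards [ae_ne_zero] with p hp
        have := hDb t p hp
        simp only [sub_self, ne_eq, OfNat.ofNat_ne_zero, not_false_eq_true, zero_pow,
          mul_zero, norm_le_zero_iff] at this
        rw [this, mul_zero]
      simp only [hD]
      rw [integral_congr_ae this, integral_zero]
    -- Near t the norm of the velocity is at most one plus its value at t, so the quadratic bound
    -- has a constant independent of τ.
    · have hsmall : ∀ᶠ τ in 𝓝[Icc 0 T] t, wnorm σ (fun p => velT u τ p - velT u t p) < 1 :=
        (hsol.tendsto_velT ht).eventually_lt_const (by norm_num)
      filter_upwards [hsmall, self_mem_nhdsWithin] with τ h1 hτ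
      have hle : wnorm σ (velT u τ) ≤ 1 + wnorm σ (velT u t) := by
        refine le_of_eq_of_le ?_ ((wnorm_add_le ((hsol.meas_velT hτ).sub (hsol.meas_velT ht))
          (hsol.meas_velT ht)).trans (add_le_add h1.le le_rfl))
        congr 1; ext p; simp
      have hfin : wconst σ * (1 + wnorm σ (velT u t)) < ⊤ := ENNReal.mul_lt_top (wconst_lt_top hσ)
        (ENNReal.add_lt_top.2 ⟨by norm_num, hsol.wnorm_velT ht⟩)
      have := enorm_integral_mul_le (f := velT u τ) (m := fun p =>
        ((1 - (nv τ p 0 * nv t p 0 + nv τ p 1 * nv t p 1) : ℝ) : ℂ) * single k h p)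
        (c := Ch * (τ - t) ^ 2) (by filter_upwards [ae_ne_zero] with p hp using hDb τ p hp)
      have h2 := this.trans (mul_le_mul_right ((eLpNorm_one_le_wnorm σ (hsol.meas_velT hτ)).trans
        (mul_le_mul_right hle _)) _)
      have h3 := ENNReal.toReal_mono (ENNReal.mul_lt_top ENNReal.ofReal_lt_top hfin).ne h2
      rw [toReal_enorm, ENNReal.toReal_mul, ENNReal.toReal_ofReal (by positivity)] at h3
      refine h3.trans (le_of_eq (by ring))
  have hpair : ∀ τ ∈ Icc 0 T, ∫ p, velT u τ p * single k h p ∂freqMeasure =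
      (∑ i, ∫ z in cell, (u i τ z : ℂ) * testFn k (fun ξ => nv t (k, ξ) i * h ξ) z) + D τ := by
    intro τ hτ
    have hp := fun i => (hU i hτ).pairing (m := fun p => (nv t p i : ℂ)) (hh.nv_mul t i)
    have e := fun i => (hp i).2
    simp only [toC] at e
    have hDi : Integrable (fun p => velT u τ p *
        (((1 - (nv τ p 0 * nv t p 0 + nv τ p 1 * nv t p 1) : ℝ) : ℂ) * single k h p))
        freqMeasure := by
      refine (hvi hτ).mul_bdd (c := Ch * (τ - t) ^ 2) ?_ ?_
      · refine ((Complex.measurable_ofReal.comp ?_).mul (hb.measurable_single k)).aestronglyMeasurable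
        exact measurable_const.sub (((measurable_nv τ 0).mul (measurable_nv t 0)).add
          ((measurable_nv τ 1).mul (measurable_nv t 1)))
      · filter_upwards [ae_ne_zero] with p hp using hDb τ p hp
    rw [Fin.sum_univ_two, e, e, ← integral_add (hp 0).1 (hp 1).1,
      ← integral_add ((hp 0).1.fun_add (hp 1).1) hDi]
    refine integral_congr_ae ?_
    filter_upwards [hsol.fourierT_u hτ 0, hsol.fourierT_u hτ 1] with p h0 h1
    simp only [vel] at h0 h1
    rw [h0, h1]
    push_cast; ring
  refine ((hw.add hDder).congr hpair (hpair t ht)).congr_deriv ?_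
  rw [add_zero]
  have l1 := fun i => (hU i ht).pairing (m := fun p => ((-(modL t p ^ 2) : ℝ) : ℂ) * nv t p i)
    (h := h) (k := k) (by
      have := (hh.nv_mul t i).modL_mul t k
      simpa only [mul_assoc] using this)
  have l2 := (hU 1 ht).pairing (m := fun p => (nv t p 0 : ℂ)) (hh.nv_mul t 0)
  have l3 := hΘ.pairing (m := fun p => (nv t p 1 : ℂ)) (hh.nv_mul t 1)
  have l4 := fun i j => ((hU j ht).mul (hU i ht)).pairing
    (m := fun p => -(Complex.I * sym t p j) * nv t p i) (h := h) (k := k) (by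
      have := (hh.nv_mul t i).sym_mul t k j
      simpa only [mul_assoc] using this)
  have e1 := fun i => (l1 i).2
  have e2 := l2.2
  have e3 := l3.2
  have e4 := fun i j => (l4 i j).2
  simp only [toC, mul_assoc] at e1 e2 e3 e4
  simp only [fun i => lapL_testFn t k (hh.nv_mul t i), fun i j => gradL_testFn t j k (hh.nv_mul t i),
    Fin.sum_univ_two]
  simp only [mul_assoc, e1, e2, e3, e4]
  have i1 := fun i => (l1 i).1
  have i4 := fun i j => (l4 i j).1
  have i2 := l2.1
  have i3 := l3.1
  simp only [mul_assoc] at i1 i2 i3 i4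
  rw [← integral_add (i1 0) (i1 1), ← integral_const_mul, ← integral_const_mul,
    ← integral_add (i4 0 0) (i4 0 1), ← integral_add (i4 1 0) (i4 1 1),
    ← integral_sub (((i1 0).fun_add (i1 1)).const_mul _) i2,
    ← integral_sub (integrable_fun_sub (((i1 0).fun_add (i1 1)).const_mul _) i2) (i3.const_mul _),
    ← integral_add ((i4 0 0).fun_add (i4 0 1)) ((i4 1 0).fun_add (i4 1 1)),
    ← integral_add (integrable_fun_sub (integrable_fun_sub
        (((i1 0).fun_add (i1 1)).const_mul _) i2) (i3.const_mul _))
      (((i4 0 0).fun_add (i4 0 1)).fun_add ((i4 1 0).fun_add (i4 1 1)))]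
  refine integral_congr_ae ?_
  filter_upwards [hsol.fourierT_u ht 0, hsol.fourierT_u ht 1, ae_ne_zero] with p h0 h1 hp
  have c := fun i j => conv_congr (hsol.fourierT_u ht j) (hsol.fourierT_u ht i) p
  have hn : (nv t p 0 : ℂ) ^ 2 + (nv t p 1 : ℂ) ^ 2 = 1 := by exact_mod_cast nv_sq_add hp t
  simp only [rhsV, adv, Fin.sum_univ_two, ← c]
  simp only [tempT, vel] at h0 h1 ⊢
  rw [h0, h1]
  push_cast
  linear_combination (-(ν * modL t p ^ 2 * velT u t p * single k h p)) * hn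

lemma IsSolution.freqSol (hσ : 1 < σ) (hsol : IsSolution ν μ γ σ T uin θin u θ) :
    FreqSol ν μ γ σ T (velT u) (tempT θ) where
  meas_v _ ht := hsol.meas_velT ht
  meas_θ _ ht := (hsol.continuous_θ.hasFourier ht).integrable.aestronglyMeasurable
  norm_v _ ht := hsol.wnorm_velT ht
  norm_θ _ ht := hsol.continuous_θ.wnorm_lt_top ht
  cont_v _ ht := hsol.tendsto_velT ht
  cont_θ _ ht := hsol.continuous_θ.tendsto_wnorm ht
  real_v _ ht := hsol.velT_neg ht
  weak_v _ ht _ _ hh := hsol.momentum_freq hσ ht hh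
  weak_θ _ ht _ _ hh := hsol.temperature_freq ht hh

end Extraction

/-! ### Triangle inequalities and the cost of the shear -/

/-- The vector `p_t` as a complex number. -/
def cvec (t : ℝ) (p : ℤ × ℝ) : ℂ := ⟨p.1, p.2 - p.1 * t⟩

lemma norm_cvec (t : ℝ) (p : ℤ × ℝ) : ‖cvec t p‖ = modL t p := by
  rw [Complex.norm_eq_sqrt_sq_add_sq]; rfl

lemma cvec_add (t : ℝ) (p q : ℤ × ℝ) : cvec t (p + q) = cvec t p + cvec t q := by
  apply Complex.ext <;> simp [cvec]; ring

lemma cvec_neg (t : ℝ) (p : ℤ × ℝ) : cvec t (-p) = -cvec t p := by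
  apply Complex.ext <;> simp [cvec]; ring

lemma modL_neg (t : ℝ) (p : ℤ × ℝ) : modL t (-p) = modL t p := by
  rw [← norm_cvec, cvec_neg, norm_neg, norm_cvec]

lemma jb_neg (t : ℝ) (p : ℤ × ℝ) : jb t (-p) = jb t p := by
  rw [← sq_eq_sq₀ (jb_pos _ _).le (jb_pos _ _).le, jb_sq_eq, jb_sq_eq, modL_neg]

lemma modL_add_le (t : ℝ) (p q : ℤ × ℝ) : modL t (p + q) ≤ modL t p + modL t q := by
  simp only [← norm_cvec, cvec_add]; exact norm_add_le _ _

lemma jb_add_le (t : ℝ) (p q : ℤ × ℝ) : jb t (p + q) ≤ jb t p + modL t q := by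
  have h0 := modL_nonneg t q
  refine abs_le_of_sq_le_sq' ?_ (add_nonneg (jb_pos t p).le h0) |>.2
  have h1 := modL_add_le t p q
  rw [add_sq, jb_sq_eq, jb_sq_eq]
  nlinarith [modL_nonneg t p, modL_nonneg t (p + q), modL_le_jb t p]

lemma abs_jb_sub_le (t : ℝ) (q r : ℤ × ℝ) : |jb t (q + r) - jb t r| ≤ modL t q := by
  rw [abs_le]
  constructor
  · have := jb_add_le t (q + r) (-q)
    rw [modL_neg, show q + r + -q = r by abel] at this; linarith
  · have := jb_add_le t r q
    rw [add_comm r q] at this; linarith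

/-- The moving derivative ∂_Y - t∂_X costs at most 1 + t fixed derivatives. This is the source of
every power of 1 + t in the nonlinear estimates. -/
lemma modL_le_mul {t : ℝ} (ht : 0 ≤ t) (p : ℤ × ℝ) : modL t p ≤ (1 + t) * modL 0 p := by
  have e : cvec t p = cvec 0 p + (-(p.1 * t) : ℝ) * Complex.I := by
    apply Complex.ext <;> simp [cvec]; ring
  have h1 : |(p.1 : ℝ)| ≤ modL 0 p := abs_sym_le 0 p 0
  rw [← norm_cvec, e]
  refine (norm_add_le _ _).trans ?_
  rw [norm_cvec, norm_mul, Complex.norm_I, mul_one, Complex.norm_real, Real.norm_eq_abs, abs_neg,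
    abs_mul, abs_of_nonneg ht]
  nlinarith

lemma jb_le_mul {t : ℝ} (ht : 0 ≤ t) (p : ℤ × ℝ) : jb t p ≤ (1 + t) * jb 0 p := by
  refine abs_le_of_sq_le_sq' ?_ (mul_nonneg (by linarith) (jb_pos 0 p).le) |>.2
  have h := modL_le_mul ht p
  have h2 := modL_nonneg t p
  rw [mul_pow, jb_sq_eq, jb_sq_eq]
  nlinarith [mul_pow (1 + t) (modL 0 p) 2, pow_le_pow_left₀ h2 h 2]

/-- Unit vectors depend on the vector with a Lipschitz constant inverse to its length. -/
lemma abs_nv_sub_mul_le {p r : ℤ × ℝ} (hp : p ≠ 0) (hr : r ≠ 0) (t : ℝ) :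
    |nv t p 0 - nv t r 0| * modL t r ≤ 2 * modL t (p - r) := by
  have h1 := modL_pos hp t
  have h2 := modL_pos hr t
  have hsub : cvec t (p - r) = cvec t p - cvec t r := by
    rw [sub_eq_add_neg, cvec_add, cvec_neg]; rfl
  have e : (nv t p 0 - nv t r 0) * modL t r =
      nv t p 0 * (modL t r - modL t p) + ((cvec t p).im - (cvec t r).im) := by
    simp only [nv_zero, cvec]; field_simp; ring
  have habs : |nv t p 0 - nv t r 0| * modL t r = |(nv t p 0 - nv t r 0) * modL t r| := by
    rw [abs_mul, abs_of_pos h2]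
  rw [habs, e]
  refine (abs_add_le _ _).trans ?_
  have e1 : |modL t r - modL t p| ≤ modL t (p - r) := by
    rw [← norm_cvec, ← norm_cvec, ← norm_cvec, hsub, abs_sub_comm]; exact abs_norm_sub_norm_le _ _
  have e2 : |(cvec t p).im - (cvec t r).im| ≤ modL t (p - r) := by
    rw [← Complex.sub_im, ← hsub, ← norm_cvec]; exact Complex.abs_im_le_norm _
  rw [abs_mul]
  nlinarith [abs_nv_le t p 0, abs_nonneg (modL t r - modL t p), abs_nonneg (nv t p 0)]

/-! ### The ghost weight -/

/-- The ghost weight exponent `∫₀ᵗ |k|³ / |p_τ|³ dτ`. -/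
def ghost (t : ℝ) (p : ℤ × ℝ) : ℝ := (p.1.sign : ℝ) * (nv 0 p 0 - nv t p 0)

lemma hasDerivAt_modL {p : ℤ × ℝ} (hp : p ≠ 0) (t : ℝ) :
    HasDerivAt (fun t => modL t p) (modL t p * (nv t p 0 * nv t p 1)) t := by
  have h := modL_pos hp t
  have h1 : HasDerivAt (fun t => (p.1 : ℝ) ^ 2 + (p.2 - p.1 * t) ^ 2)
      (2 * (p.2 - p.1 * t) * (-p.1)) t := by
    have h0 : HasDerivAt (fun t : ℝ => p.2 - p.1 * t) (-(p.1 : ℝ)) t := by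
      simpa using ((hasDerivAt_id t).const_mul (p.1 : ℝ)).const_sub p.2
    simpa using (h0.pow 2).const_add ((p.1 : ℝ) ^ 2)
  have h2 := h1.sqrt (by rw [← modL_sq]; positivity)
  refine h2.congr_deriv ?_
  rw [nv_zero, nv_one, show √((p.1 : ℝ) ^ 2 + (p.2 - p.1 * t) ^ 2) = modL t p from rfl]
  field_simp

/-- The function n₁³ = -k³/|p_t|³ has the bounded primitive n₀; this gives the ghost exponent its
closed form and the uniform bound 2. -/
lemma hasDerivAt_nv_zero {p : ℤ × ℝ} (hp : p ≠ 0) (t : ℝ) :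
    HasDerivAt (fun t => nv t p 0) (nv t p 1 ^ 3) t := by
  have h := modL_pos hp t
  have h0 : HasDerivAt (fun t : ℝ => p.2 - p.1 * t) (-(p.1 : ℝ)) t := by
    simpa using ((hasDerivAt_id t).const_mul (p.1 : ℝ)).const_sub p.2
  have h1 := h0.div (hasDerivAt_modL hp t) h.ne'
  refine h1.congr_deriv ?_
  have e := modL_sq t p
  rw [nv_zero, nv_one]
  field_simp
  rw [e]; ring

lemma hasDerivAt_ghost (p : ℤ × ℝ) (t : ℝ) :
    HasDerivAt (fun t => ghost t p) (|nv t p 1| ^ 3) t := by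
  by_cases hk : p.1 = 0
  · have : (fun t => ghost t p) = fun _ => 0 := by ext t; simp [ghost, hk]
    rw [this]
    simpa [nv_one, hk] using hasDerivAt_const t (0 : ℝ)
  · have hp : p ≠ 0 := fun h => hk (by rw [h]; rfl)
    have h1 := ((hasDerivAt_nv_zero hp t).const_sub (nv 0 p 0)).const_mul (p.1.sign : ℝ)
    refine h1.congr_deriv ?_
    have hm := modL_pos hp t
    rcases lt_or_gt_of_ne hk with h | h
    · have : 0 ≤ nv t p 1 := by
        rw [nv_one]
        have : (p.1 : ℝ) < 0 := by exact_mod_cast h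
        exact div_nonneg (by linarith) hm.le
      rw [Int.sign_eq_neg_one_of_neg h, abs_of_nonneg this]; push_cast; ring
    · have : nv t p 1 ≤ 0 := by
        rw [nv_one]
        have : (0 : ℝ) < (p.1 : ℝ) := by exact_mod_cast h
        exact div_nonpos_of_nonpos_of_nonneg (by linarith) hm.le
      rw [Int.sign_eq_one_of_pos h, abs_of_nonpos this]; push_cast; ring

lemma ghost_nonneg {t : ℝ} (ht : 0 ≤ t) (p : ℤ × ℝ) : 0 ≤ ghost t p := by
  have hm : Monotone (fun t => ghost t p) :=
    monotone_of_hasDerivAt_nonneg (hasDerivAt_ghost p) fun t => by positivity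
  simpa [ghost] using hm ht

lemma abs_sign_le (k : ℤ) : |(k.sign : ℝ)| ≤ 1 := by
  rcases lt_trichotomy k 0 with h | h | h
  · rw [Int.sign_eq_neg_one_of_neg h]; simp
  · subst h; simp
  · rw [Int.sign_eq_one_of_pos h]; simp

lemma abs_ghost_le (t : ℝ) (p : ℤ × ℝ) : |ghost t p| ≤ |nv 0 p 0 - nv t p 0| := by
  rw [ghost, abs_mul]
  exact mul_le_of_le_one_left (abs_nonneg _) (abs_sign_le _)

lemma abs_ghost_le_two (t : ℝ) (p : ℤ × ℝ) : |ghost t p| ≤ 2 := by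
  refine (abs_ghost_le t p).trans ((abs_sub _ _).trans ?_)
  linarith [abs_nv_le 0 p 0, abs_nv_le t p 0]

lemma one_sub_abs_nv_mul_le (t : ℝ) (p : ℤ × ℝ) (hp : p ≠ 0) :
    (1 - |nv t p 0|) * modL t p ≤ |(p.1 : ℝ)| := by
  have h := modL_pos hp t
  have : |nv t p 0| * modL t p = |p.2 - p.1 * t| := by
    rw [nv_zero, abs_div, abs_of_pos h]; field_simp
  rw [sub_mul, this, one_mul, ← norm_cvec]
  have := Complex.norm_le_abs_re_add_abs_im (cvec t p)
  simp only [cvec] at this ⊢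
  linarith

/-- If ξ and ξ - kt have the same sign, both values of n₀ lie near the same endpoint ±1, at a
distance controlled by |k| over the length of the vector. Otherwise |ξ - kt| ≤ |k|t, so |p_t| ≤ (1 +
t)|k|, and the bound 2 for the exponent is enough. -/
lemma abs_ghost_mul_le {t : ℝ} (ht : 0 ≤ t) (p : ℤ × ℝ) :
    |ghost t p| * modL t p ≤ 2 * (1 + t) * |(p.1 : ℝ)| := by
  by_cases hk : p.1 = 0
  · simp [ghost, hk]
  have hp : p ≠ 0 := fun h => hk (by rw [h]; rfl)
  have h0 := modL_pos hp 0
  have h1 := modL_pos hp t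
  have hle := modL_le_mul ht p
  have hk0 := abs_nonneg (p.1 : ℝ)
  rcases le_total 0 (p.2 * (p.2 - p.1 * t)) with hs | hs
  · have hn : 0 ≤ nv 0 p 0 * nv t p 0 := by
      rw [nv_zero, nv_zero, div_mul_div_comm]
      simp only [mul_zero, sub_zero]
      positivity
    have hd : |nv 0 p 0 - nv t p 0| ≤ (1 - |nv 0 p 0|) + (1 - |nv t p 0|) := by
      have a1 := abs_nv_le 0 p 0
      have a2 := abs_nv_le t p 0
      rcases mul_nonneg_iff.1 hn with ⟨b1, b2⟩ | ⟨b1, b2⟩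
      · rw [abs_of_nonneg b1, abs_of_nonneg b2] at *
        rw [abs_le]; constructor <;> linarith
      · rw [abs_of_nonpos b1, abs_of_nonpos b2] at *
        rw [abs_le]; constructor <;> linarith
    have e0 := one_sub_abs_nv_mul_le 0 p hp
    have e1 := one_sub_abs_nv_mul_le t p hp
    have hx : 0 ≤ 1 - |nv 0 p 0| := by linarith [abs_nv_le 0 p 0]
    calc |ghost t p| * modL t p ≤ ((1 - |nv 0 p 0|) + (1 - |nv t p 0|)) * modL t p := by
          gcongr; exact (abs_ghost_le t p).trans hd
      _ = (1 - |nv 0 p 0|) * modL t p + (1 - |nv t p 0|) * modL t p := by ring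
      _ ≤ (1 - |nv 0 p 0|) * ((1 + t) * modL 0 p) + |(p.1 : ℝ)| := by gcongr
      _ = (1 + t) * ((1 - |nv 0 p 0|) * modL 0 p) + |(p.1 : ℝ)| := by ring
      _ ≤ (1 + t) * |(p.1 : ℝ)| + |(p.1 : ℝ)| := by gcongr
      _ ≤ _ := by nlinarith
  · have hb : |p.2 - p.1 * t| ≤ |(p.1 : ℝ)| * t := by
      have : |(p.1 : ℝ)| * t = |p.1 * t| := by rw [abs_mul, abs_of_nonneg ht]
      rw [this, ← sq_le_sq]
      nlinarith [sq_nonneg p.2]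
    have hm : modL t p ≤ |(p.1 : ℝ)| + |p.2 - p.1 * t| := by
      rw [← norm_cvec]; exact Complex.norm_le_abs_re_add_abs_im (cvec t p)
    have := abs_ghost_le_two t p
    nlinarith [abs_nonneg (ghost t p)]

/-- The exponent jumps with the sign of k. When the two first frequencies have the same sign, the
Lipschitz bound for unit vectors applies at times 0 and t. Otherwise both are at most |q₁| in
absolute value, their difference, so `abs_ghost_mul_le` bounds each exponent separately. -/
lemma abs_ghost_sub_mul_le {t : ℝ} (ht : 0 ≤ t) (q r : ℤ × ℝ) :
    |ghost t (q + r) - ghost t r| * modL t r ≤ 6 * ((1 + t) * modL 0 q) := by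
  have hq0 := modL_nonneg 0 q
  have hqt := modL_le_mul ht q
  by_cases hs : 0 < (q + r).1 * r.1
  · have hr1 : r.1 ≠ 0 := fun h => by simp [h] at hs
    have hp1 : (q + r).1 ≠ 0 := fun h => by simp [h] at hs
    have hr : r ≠ 0 := fun h => hr1 (by rw [h]; rfl)
    have hp : q + r ≠ 0 := fun h => hp1 (by rw [h]; rfl)
    have hsign : (q + r).1.sign = r.1.sign := by
      rcases pos_and_pos_or_neg_and_neg_of_mul_pos hs with ⟨a, b⟩ | ⟨a, b⟩
      · rw [Int.sign_eq_one_of_pos a, Int.sign_eq_one_of_pos b]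
      · rw [Int.sign_eq_neg_one_of_neg a, Int.sign_eq_neg_one_of_neg b]
    have d0 := abs_nv_sub_mul_le hp hr 0
    have dt := abs_nv_sub_mul_le hp hr t
    rw [add_sub_cancel_right] at d0 dt
    have hle : |ghost t (q + r) - ghost t r| ≤
        |nv 0 (q + r) 0 - nv 0 r 0| + |nv t (q + r) 0 - nv t r 0| := by
      rw [ghost, ghost, hsign, ← mul_sub, abs_mul]
      refine (mul_le_of_le_one_left (abs_nonneg _) (abs_sign_le _)).trans ?_
      refine le_of_eq_of_le ?_ (abs_sub _ _)
      congr 1; ring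
    calc _ ≤ (|nv 0 (q + r) 0 - nv 0 r 0| + |nv t (q + r) 0 - nv t r 0|) * modL t r := by
          gcongr; exact modL_nonneg t r
      _ = |nv 0 (q + r) 0 - nv 0 r 0| * modL t r + |nv t (q + r) 0 - nv t r 0| * modL t r := by
          ring
      _ ≤ |nv 0 (q + r) 0 - nv 0 r 0| * ((1 + t) * modL 0 r) + 2 * modL t q := by
          gcongr; exact modL_le_mul ht r
      _ = (1 + t) * (|nv 0 (q + r) 0 - nv 0 r 0| * modL 0 r) + 2 * modL t q := by ring
      _ ≤ (1 + t) * (2 * modL 0 q) + 2 * ((1 + t) * modL 0 q) := by gcongr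
      _ ≤ _ := by nlinarith [mul_nonneg (by linarith : 0 ≤ 1 + t) hq0]
  · have hs' : ((q + r).1 : ℝ) * r.1 ≤ 0 := by exact_mod_cast not_lt.1 hs
    have hadd : ((q + r).1 : ℝ) = q.1 + r.1 := by push_cast [Prod.fst_add]; ring
    have hq1 : |(q.1 : ℝ)| ≤ modL 0 q := abs_sym_le 0 q 0
    have hk1 : |((q + r).1 : ℝ)| ≤ |(q.1 : ℝ)| := by
      rw [← sq_le_sq]; rw [hadd] at hs' ⊢; nlinarith [sq_nonneg (r.1 : ℝ)]
    have hk2 : |(r.1 : ℝ)| ≤ |(q.1 : ℝ)| := by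
      rw [← sq_le_sq]; rw [hadd] at hs'; nlinarith [sq_nonneg ((q.1 : ℝ) + r.1)]
    have g1 := abs_ghost_mul_le ht (q + r)
    have g2 := abs_ghost_mul_le ht r
    have hr : modL t r ≤ modL t (q + r) + modL t q := by
      have := modL_add_le t (q + r) (-q)
      rwa [modL_neg, show q + r + -q = r by abel] at this
    calc _ ≤ (|ghost t (q + r)| + |ghost t r|) * modL t r := by
          gcongr
          · exact modL_nonneg t r
          · exact abs_sub _ _
      _ = |ghost t (q + r)| * modL t r + |ghost t r| * modL t r := by ring
      _ ≤ |ghost t (q + r)| * (modL t (q + r) + modL t q) + |ghost t r| * modL t r := by gcongr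
      _ = |ghost t (q + r)| * modL t (q + r) + |ghost t (q + r)| * modL t q +
          |ghost t r| * modL t r := by ring
      _ ≤ 2 * (1 + t) * modL 0 q + 2 * ((1 + t) * modL 0 q) + 2 * (1 + t) * modL 0 q := by
          have a1 := g1.trans (mul_le_mul_of_nonneg_left (hk1.trans hq1) (by linarith))
          have a2 := g2.trans (mul_le_mul_of_nonneg_left (hk2.trans hq1) (by linarith))
          have a3 := mul_le_mul (abs_ghost_le_two t (q + r)) hqt (modL_nonneg t q) (by norm_num)
          linarith
      _ = _ := by ring

lemma abs_rpow_sub_rpow_le {s x y : ℝ} (hs : 1 ≤ s) (hx : 0 ≤ x) (hy : 0 ≤ y) (hxy : x ≤ 2 * y) :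
    |x ^ s - y ^ s| ≤ s * 2 ^ (s - 1) * (y ^ (s - 1) * |x - y|) := by
  have h := Convex.norm_image_sub_le_of_norm_hasDerivWithin_le (s := Icc 0 (2 * y))
    (f := fun z : ℝ => z ^ s) (f' := fun z => s * z ^ (s - 1)) (C := s * (2 * y) ^ (s - 1))
    (x := y) (y := x) (fun z _ => (Real.hasDerivAt_rpow_const (Or.inr hs)).hasDerivWithinAt)
    (fun z hz => by
      rw [Real.norm_of_nonneg (mul_nonneg (by linarith) (Real.rpow_nonneg hz.1 _))]
      exact mul_le_mul_of_nonneg_left (Real.rpow_le_rpow hz.1 hz.2 (by linarith)) (by linarith))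
    (convex_Icc _ _) ⟨hy, by linarith⟩ ⟨hx, hxy⟩
  rw [Real.mul_rpow (by norm_num) hy] at h
  simp only [Real.norm_eq_abs] at h
  linarith

/-! ### Cutoff and damping factors -/

/-- The cutoff `(1 - ⟨p⟩ / N)₊`. -/
def cut (N : ℝ) (p : ℤ × ℝ) : ℝ := max 0 (1 - jb 0 p / N)

lemma cut_nonneg (N : ℝ) (p : ℤ × ℝ) : 0 ≤ cut N p := le_max_left _ _

lemma cut_le_one {N : ℝ} (hN : 0 < N) (p : ℤ × ℝ) : cut N p ≤ 1 :=
  max_le zero_le_one (by have := div_pos (jb_pos 0 p) hN; linarith)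

lemma cut_eq_zero {N : ℝ} (hN : 0 < N) {p : ℤ × ℝ} (h : N ≤ jb 0 p) : cut N p = 0 :=
  max_eq_left (by have := (one_le_div hN).2 h; linarith)

lemma measurable_cut (N : ℝ) : Measurable (cut N) := by unfold cut; fun_prop

lemma abs_cut_sub_le {N : ℝ} (hN : 0 < N) (q r : ℤ × ℝ) :
    |cut N (q + r) - cut N r| ≤ modL 0 q / N := by
  have h := abs_max_sub_max_le_abs (1 - jb 0 (q + r) / N) (1 - jb 0 r / N) 0
  rw [max_comm, max_comm (1 - jb 0 r / N)] at h
  refine h.trans ?_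
  rw [show 1 - jb 0 (q + r) / N - (1 - jb 0 r / N) = -((jb 0 (q + r) - jb 0 r) / N) by ring,
    abs_neg, abs_div, abs_of_pos hN]
  gcongr
  exact abs_jb_sub_le 0 q r

/-- The bound does not depend on N, which is why the cutoff is Lipschitz on scale N. For ⟨r⟩ ≤ 2N
the slope 1/N compensates |r|. For ⟨r⟩ ≥ 2N the cutoff vanishes at r, and if it does not also vanish
at q + r then |q| ≥ ⟨r⟩/2. -/
lemma abs_cut_sub_mul_le {N : ℝ} (hN : 0 < N) (q r : ℤ × ℝ) :
    |cut N (q + r) - cut N r| * modL 0 r ≤ 2 * modL 0 q := by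
  have hq := modL_nonneg 0 q
  have hrj := modL_le_jb 0 r
  rcases le_total (jb 0 r) (2 * N) with h | h
  · have := abs_cut_sub_le hN q r
    calc _ ≤ modL 0 q / N * (2 * N) := by
          gcongr
          · exact modL_nonneg 0 r
          · exact hrj.trans h
      _ = _ := by field_simp
  · have hr : cut N r = 0 := cut_eq_zero hN (by linarith)
    have hd := (abs_le.1 (abs_jb_sub_le 0 q r)).1
    rw [hr, sub_zero, abs_of_nonneg (cut_nonneg _ _)]
    rcases le_total N (jb 0 (q + r)) with h2 | h2
    · rw [cut_eq_zero hN h2, zero_mul]; linarith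
    · calc _ ≤ 1 * jb 0 r := by
            gcongr
            · exact modL_nonneg 0 r
            · exact cut_le_one hN _
        _ ≤ _ := by linarith

/-- The damping `e^{-c ghost / 2}`. -/
def damp (c t : ℝ) (p : ℤ × ℝ) : ℝ := Real.exp (-(c * ghost t p) / 2)

lemma damp_pos (c t : ℝ) (p : ℤ × ℝ) : 0 < damp c t p := Real.exp_pos _

lemma damp_le_one {c t : ℝ} (hc : 0 ≤ c) (ht : 0 ≤ t) (p : ℤ × ℝ) : damp c t p ≤ 1 := by
  unfold damp
  rw [Real.exp_le_one_iff]
  have := mul_nonneg hc (ghost_nonneg ht p)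
  linarith

lemma measurable_ghost (t : ℝ) : Measurable (ghost t) := by
  unfold ghost
  have : Measurable (fun p : ℤ × ℝ => (p.1.sign : ℝ)) :=
    (measurable_from_top (f := fun k : ℤ => (k.sign : ℝ))).comp measurable_fst
  exact this.mul ((measurable_nv 0 0).sub (measurable_nv t 0))

lemma measurable_damp (c t : ℝ) : Measurable (damp c t) := by
  have := measurable_ghost t
  unfold damp; fun_prop

lemma abs_exp_neg_sub_le {x y : ℝ} (hx : 0 ≤ x) (hy : 0 ≤ y) :
    |Real.exp (-x) - Real.exp (-y)| ≤ |x - y| := by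
  have key : ∀ {x y : ℝ}, 0 ≤ x → x ≤ y → |Real.exp (-x) - Real.exp (-y)| ≤ |x - y| := by
    intro x y hx hxy
    have h1 : Real.exp (-y) ≤ Real.exp (-x) := Real.exp_le_exp.2 (by linarith)
    have h2 : Real.exp (-y) = Real.exp (-x) * Real.exp (x - y) := by
      rw [← Real.exp_add]; congr 1; ring
    have h3 := Real.add_one_le_exp (x - y)
    have h4 : Real.exp (-x) ≤ 1 := Real.exp_le_one_iff.2 (by linarith)
    rw [abs_of_nonneg (by linarith), abs_of_nonpos (by linarith), h2]
    nlinarith [Real.exp_pos (-x), Real.exp_pos (x - y)]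
  rcases le_total x y with h | h
  · exact key hx h
  · rw [abs_sub_comm, abs_sub_comm x]; exact key hy h

lemma abs_damp_sub_mul_le {c t : ℝ} (hc : 0 ≤ c) (ht : 0 ≤ t) (q r : ℤ × ℝ) :
    |damp c t (q + r) - damp c t r| * modL t r ≤ 3 * c * ((1 + t) * modL 0 q) := by
  have h := abs_exp_neg_sub_le
    (div_nonneg (mul_nonneg hc (ghost_nonneg ht (q + r))) (by norm_num : (0 : ℝ) ≤ 2))
    (div_nonneg (mul_nonneg hc (ghost_nonneg ht r)) (by norm_num : (0 : ℝ) ≤ 2))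
  rw [← sub_div, ← mul_sub, abs_div, abs_mul, abs_of_nonneg hc,
    abs_of_pos (by norm_num : (0 : ℝ) < 2)] at h
  have h2 := abs_ghost_sub_mul_le ht q r
  have h3 := modL_nonneg t r
  unfold damp
  rw [neg_div, neg_div]
  calc _ ≤ c * |ghost t (q + r) - ghost t r| / 2 * modL t r := by gcongr
    _ = c / 2 * (|ghost t (q + r) - ghost t r| * modL t r) := by ring
    _ ≤ c / 2 * (6 * ((1 + t) * modL 0 q)) := by gcongr
    _ = _ := by ring

/-! ### The energy weight and its commutator -/

/-- The symbol of `⟨∇⟩^s ⟨∇_L⟩^{1/2}`. -/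
def amp (s t : ℝ) (p : ℤ × ℝ) : ℝ := jb 0 p ^ s * √(jb t p)

lemma amp_pos (s t : ℝ) (p : ℤ × ℝ) : 0 < amp s t p :=
  mul_pos (Real.rpow_pos_of_pos (jb_pos 0 p) s) (Real.sqrt_pos.2 (jb_pos t p))

lemma measurable_amp (s t : ℝ) : Measurable (amp s t) := by unfold amp; fun_prop

lemma amp_neg (s t : ℝ) (p : ℤ × ℝ) : amp s t (-p) = amp s t p := by simp only [amp, jb_neg]

/-- The energy weight. -/
def wgt (c s N t : ℝ) (p : ℤ × ℝ) : ℝ := cut N p * damp c t p * amp s t p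

/-- The decaying factor of the trilinear estimates. -/
def dec (l t : ℝ) (q r : ℤ × ℝ) : ℝ :=
  jb 0 q ^ (-l) + jb 0 r ^ (-l) + (jb t q ^ (-l) + jb t r ^ (-l))

lemma dec_nonneg (l t : ℝ) (q r : ℤ × ℝ) : 0 ≤ dec l t q r := by
  have h := fun t p => Real.rpow_nonneg (jb_pos t p).le (-l)
  exact add_nonneg (add_nonneg (h _ _) (h _ _)) (add_nonneg (h _ _) (h _ _))

lemma dec_comm (l t : ℝ) (q r : ℤ × ℝ) : dec l t q r = dec l t r q := by unfold dec; ring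

lemma dec_neg_left (l t : ℝ) (q r : ℤ × ℝ) : dec l t (-q) r = dec l t q r := by
  simp only [dec, jb_neg]

/-- Both exponents are nonpositive, so replacing the larger of x and y by the smaller only increases
the product. -/
lemma rpow_mul_rpow_le {s x y : ℝ} (hs : 1 ≤ s) (hx : 1 ≤ x) (hy : 1 ≤ y) :
    x ^ (1 - s) * y ^ (-(1 / 2) : ℝ) ≤ x ^ (-(s - 1 / 2)) + y ^ (-(s - 1 / 2)) := by
  have hx0 : 0 < x := by linarith
  have hy0 : 0 < y := by linarith
  rcases le_total x y with h | h
  · have h1 : y ^ (-(1 / 2) : ℝ) ≤ x ^ (-(1 / 2) : ℝ) :=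
      Real.rpow_le_rpow_of_nonpos hx0 h (by norm_num)
    calc _ ≤ x ^ (1 - s) * x ^ (-(1 / 2) : ℝ) := by gcongr
      _ = x ^ (-(s - 1 / 2)) := by rw [← Real.rpow_add hx0]; congr 1; ring
      _ ≤ _ := le_add_of_nonneg_right (by positivity)
  · have h1 : x ^ (1 - s) ≤ y ^ (1 - s) :=
      Real.rpow_le_rpow_of_nonpos hy0 h (by linarith)
    calc _ ≤ y ^ (1 - s) * y ^ (-(1 / 2) : ℝ) := by gcongr
      _ = y ^ (-(s - 1 / 2)) := by rw [← Real.rpow_add hy0]; congr 1; ring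
      _ ≤ _ := le_add_of_nonneg_left (by positivity)

/-- Dividing by the two amplitudes leaves ⟨r⟩^{1-s} times ⟨r_t⟩^{-1/2} or ⟨q_t⟩^{-1/2}. By
`rpow_mul_rpow_le` this is at most a sum of single brackets to the power -(s - 1/2). Time-dependent
brackets occur, hence their presence in `dec`. -/
lemma high_low_le {s : ℝ} (hs : 1 ≤ s) (t : ℝ) (q r : ℤ × ℝ) :
    jb 0 q ^ s * jb 0 r * (√(jb t q) + √(jb t r)) ≤
      2 * (amp s t q * amp s t r * dec (s - 1 / 2) t q r) := by
  have hQ := jb_pos 0 q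
  have hR := jb_pos 0 r
  have hQt := jb_pos t q
  have hRt := jb_pos t r
  have e : ∀ x : ℝ, 0 < x → √x * x ^ (-(1 / 2) : ℝ) = 1 := by
    intro x hx
    rw [Real.sqrt_eq_rpow, ← Real.rpow_add hx]; norm_num
  have eR : jb 0 r ^ s * jb 0 r ^ (1 - s) = jb 0 r := by
    rw [← Real.rpow_add hR]; simp
  have h1 := rpow_mul_rpow_le hs (one_le_jb 0 r) (one_le_jb t r)
  have h2 := rpow_mul_rpow_le hs (one_le_jb 0 r) (one_le_jb t q)
  have n1 := Real.rpow_nonneg hQ.le (-(s - 1 / 2))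
  have n2 := Real.rpow_nonneg hR.le (-(s - 1 / 2))
  have n3 := Real.rpow_nonneg hQt.le (-(s - 1 / 2))
  have n4 := Real.rpow_nonneg hRt.le (-(s - 1 / 2))
  have hA : 0 ≤ amp s t q * amp s t r := (mul_pos (amp_pos s t q) (amp_pos s t r)).le
  have e1 : jb 0 q ^ s * jb 0 r * √(jb t q) =
      amp s t q * amp s t r * (jb 0 r ^ (1 - s) * jb t r ^ (-(1 / 2) : ℝ)) := by
    unfold amp
    linear_combination (-(jb 0 q ^ s * √(jb t q) * jb 0 r ^ s * jb 0 r ^ (1 - s))) * e _ hRt -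
      (jb 0 q ^ s * √(jb t q)) * eR
  have e2 : jb 0 q ^ s * jb 0 r * √(jb t r) =
      amp s t q * amp s t r * (jb 0 r ^ (1 - s) * jb t q ^ (-(1 / 2) : ℝ)) := by
    unfold amp
    linear_combination (-(jb 0 q ^ s * √(jb t r) * jb 0 r ^ s * jb 0 r ^ (1 - s))) * e _ hQt -
      (jb 0 q ^ s * √(jb t r)) * eR
  rw [mul_add, e1, e2]
  have d1 : jb 0 r ^ (1 - s) * jb t r ^ (-(1 / 2) : ℝ) ≤ dec (s - 1 / 2) t q r := by
    unfold dec; linarith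
  have d2 : jb 0 r ^ (1 - s) * jb t q ^ (-(1 / 2) : ℝ) ≤ dec (s - 1 / 2) t q r := by
    unfold dec; linarith
  linarith [mul_le_mul_of_nonneg_left d1 hA, mul_le_mul_of_nonneg_left d2 hA]

lemma sqrt_jb_add_le (t : ℝ) (q r : ℤ × ℝ) : √(jb t (q + r)) ≤ √(jb t q) + √(jb t r) := by
  rw [Real.sqrt_le_left (by positivity), add_sq, Real.sq_sqrt (jb_pos t q).le,
    Real.sq_sqrt (jb_pos t r).le]
  have h1 := jb_add_le t r q
  rw [add_comm r q] at h1
  have := modL_le_jb t q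
  have : 0 ≤ 2 * √(jb t q) * √(jb t r) := by positivity
  linarith

lemma amp_add_le {s : ℝ} (hs : 0 ≤ s) (t : ℝ) {q r : ℤ × ℝ} (h : jb 0 r ≤ jb 0 q) :
    amp s t (q + r) ≤ 2 ^ s * jb 0 q ^ s * (√(jb t q) + √(jb t r)) := by
  have h1 : jb 0 (q + r) ≤ 2 * jb 0 q := by
    have := jb_add_le 0 q r
    have := modL_le_jb 0 r
    linarith
  have h2 : jb 0 (q + r) ^ s ≤ 2 ^ s * jb 0 q ^ s := by
    rw [← Real.mul_rpow (by norm_num) (jb_pos 0 q).le]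
    exact Real.rpow_le_rpow (jb_pos _ _).le h1 hs
  unfold amp
  exact mul_le_mul h2 (sqrt_jb_add_le t q r) (Real.sqrt_nonneg _)
    ((Real.rpow_nonneg (jb_pos _ _).le s).trans h2)

/-- The product estimate behind the bound of the pressure. -/
lemma amp_mul_min_le {s t : ℝ} (hs : 1 ≤ s) (ht : 0 ≤ t) (q r : ℤ × ℝ) :
    amp s t (q + r) * min (modL t q) (modL t r) ≤
      2 * 2 ^ s * ((1 + t) * (amp s t q * amp s t r * dec (s - 1 / 2) t q r)) := by
  have key : ∀ q r : ℤ × ℝ, jb 0 r ≤ jb 0 q → amp s t (q + r) * min (modL t q) (modL t r) ≤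
      2 * 2 ^ s * ((1 + t) * (amp s t q * amp s t r * dec (s - 1 / 2) t q r)) := by
    intro q r h
    have h1 := amp_add_le (by linarith : 0 ≤ s) t h
    have h2 : min (modL t q) (modL t r) ≤ (1 + t) * jb 0 r :=
      (min_le_right _ _).trans ((modL_le_mul ht r).trans
        (mul_le_mul_of_nonneg_left (modL_le_jb 0 r) (by linarith)))
    have h3 := high_low_le hs t q r
    have h4 : (0 : ℝ) < 2 ^ s := by positivity
    have hQ := Real.rpow_pos_of_pos (jb_pos 0 q) s
    calc _ ≤ 2 ^ s * jb 0 q ^ s * (√(jb t q) + √(jb t r)) * ((1 + t) * jb 0 r) :=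
          mul_le_mul h1 h2 (le_min (modL_nonneg _ _) (modL_nonneg _ _)) (by positivity)
      _ = 2 ^ s * ((1 + t) * (jb 0 q ^ s * jb 0 r * (√(jb t q) + √(jb t r)))) := by ring
      _ ≤ 2 ^ s * ((1 + t) * (2 * (amp s t q * amp s t r * dec (s - 1 / 2) t q r))) := by gcongr
      _ = _ := by ring
  rcases le_total (jb 0 r) (jb 0 q) with h | h
  · exact key q r h
  · have := key r q h
    rwa [add_comm r q, min_comm, dec_comm, mul_comm (amp s t r)] at this

/-- The difference of square roots is the difference of the brackets, at most |q_t|, divided by the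
sum of the roots; then |r_t| ≤ ⟨r_t⟩ is split evenly. -/
lemma abs_sqrt_jb_sub_mul_le (t : ℝ) (q r : ℤ × ℝ) :
    |√(jb t (q + r)) - √(jb t r)| * modL t r ≤ modL t q * √(jb t r) := by
  have hr := Real.sqrt_pos.2 (jb_pos t r)
  have hp := Real.sqrt_pos.2 (jb_pos t (q + r))
  have e : |√(jb t (q + r)) - √(jb t r)| * (√(jb t (q + r)) + √(jb t r)) =
      |jb t (q + r) - jb t r| := by
    have h := abs_mul (√(jb t (q + r)) - √(jb t r)) (√(jb t (q + r)) + √(jb t r))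
    rw [abs_of_pos (add_pos hp hr)] at h
    rw [← h]
    congr 1
    nlinarith [Real.sq_sqrt (jb_pos t (q + r)).le, Real.sq_sqrt (jb_pos t r).le]
  have h1 : |√(jb t (q + r)) - √(jb t r)| * √(jb t r) ≤ modL t q := by
    refine le_trans ?_ (abs_jb_sub_le t q r)
    rw [← e]; gcongr; linarith
  calc _ ≤ |√(jb t (q + r)) - √(jb t r)| * (√(jb t r) * √(jb t r)) := by
        rw [Real.mul_self_sqrt (jb_pos t r).le]; gcongr; exact modL_le_jb t r
    _ = |√(jb t (q + r)) - √(jb t r)| * √(jb t r) * √(jb t r) := by ring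
    _ ≤ _ := by gcongr

/-- The constant of the commutator estimate. -/
def commConst (c s : ℝ) : ℝ := 2 * (s * 2 ^ (s - 1) + 3 + 3 * c + 2 * 2 ^ s)

lemma commConst_pos {c s : ℝ} (hc : 0 ≤ c) (hs : 1 ≤ s) : 0 < commConst c s := by
  unfold commConst; positivity

/-- The commutator of the energy weight with transport costs one factor `1 + t`. -/
lemma abs_wgt_sub_mul_le {c s N t : ℝ} (hc : 0 ≤ c) (hs : 1 ≤ s) (hN : 0 < N) (ht : 0 ≤ t)
    (q r : ℤ × ℝ) :
    |wgt c s N t (q + r) - wgt c s N t r| * modL t r ≤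
      commConst c s * ((1 + t) * (amp s t q * amp s t r * dec (s - 1 / 2) t q r)) := by
  have hQ := jb_pos 0 q
  have hR := jb_pos 0 r
  have hQs := Real.rpow_pos_of_pos hQ s
  have hRs := Real.rpow_pos_of_pos hR s
  have hmr := modL_nonneg t r
  have hmr2 : modL t r ≤ (1 + t) * jb 0 r := (modL_le_mul ht r).trans
    (mul_le_mul_of_nonneg_left (modL_le_jb 0 r) (by linarith))
  have hmq := modL_nonneg 0 q
  have hmq2 := modL_le_jb 0 q
  set X := amp s t q * amp s t r * dec (s - 1 / 2) t q r with hX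
  have hD : ∀ p, 0 ≤ cut N p * damp c t p ∧ cut N p * damp c t p ≤ 1 := fun p =>
    ⟨mul_nonneg (cut_nonneg _ _) (damp_pos _ _ _).le,
      mul_le_one₀ (cut_le_one hN p) (damp_pos _ _ _).le (damp_le_one hc ht p)⟩
  rcases le_total (jb 0 q) (jb 0 r) with h | h
  · -- low-high interactions
    have hX' := high_low_le hs t r q
    rw [mul_comm (amp s t r), dec_comm, ← hX] at hX'
    have hjp : jb 0 (q + r) ≤ 2 * jb 0 r := by
      have := jb_add_le 0 r q
      rw [add_comm r q] at this; linarith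
    have hA := abs_rpow_sub_rpow_le hs (jb_pos 0 (q + r)).le hR.le hjp
    have hB := sqrt_jb_add_le t q r
    have T1 : |jb 0 (q + r) ^ s - jb 0 r ^ s| * √(jb t (q + r)) * modL t r ≤
        s * 2 ^ (s - 1) * ((1 + t) * (jb 0 r ^ s * jb 0 q * (√(jb t r) + √(jb t q)))) := by
      have e : jb 0 r ^ (s - 1) * jb 0 r = jb 0 r ^ s := by
        rw [← Real.rpow_add_one hR.ne']; congr 1; ring
      calc _ ≤ s * 2 ^ (s - 1) * (jb 0 r ^ (s - 1) * jb 0 q) * (√(jb t q) + √(jb t r)) *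
            ((1 + t) * jb 0 r) := by
            refine mul_le_mul (mul_le_mul (hA.trans ?_) hB (Real.sqrt_nonneg _) (by positivity))
              hmr2 hmr (by positivity)
            gcongr
            exact (abs_jb_sub_le 0 q r).trans hmq2
        _ = s * 2 ^ (s - 1) * ((1 + t) * ((jb 0 r ^ (s - 1) * jb 0 r) * jb 0 q *
            (√(jb t r) + √(jb t q)))) := by ring
        _ = _ := by rw [e]
    have T2 : jb 0 r ^ s * (|√(jb t (q + r)) - √(jb t r)| * modL t r) ≤
        (1 + t) * (jb 0 r ^ s * jb 0 q * (√(jb t r) + √(jb t q))) := by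
      calc _ ≤ jb 0 r ^ s * (((1 + t) * jb 0 q) * √(jb t r)) := by
            refine mul_le_mul_of_nonneg_left ((abs_sqrt_jb_sub_mul_le t q r).trans ?_) hRs.le
            gcongr
            exact (modL_le_mul ht q).trans (mul_le_mul_of_nonneg_left hmq2 (by linarith))
        _ = (1 + t) * (jb 0 r ^ s * jb 0 q * √(jb t r)) := by ring
        _ ≤ _ := by gcongr; exact le_add_of_nonneg_right (Real.sqrt_nonneg _)
    have T3 : amp s t r * (|cut N (q + r) * damp c t (q + r) - cut N r * damp c t r| * modL t r) ≤
        (2 + 3 * c) * ((1 + t) * (jb 0 r ^ s * jb 0 q * (√(jb t r) + √(jb t q)))) := by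
      have hd : |cut N (q + r) * damp c t (q + r) - cut N r * damp c t r| * modL t r ≤
          (2 + 3 * c) * ((1 + t) * jb 0 q) := by
        have e : cut N (q + r) * damp c t (q + r) - cut N r * damp c t r =
            (cut N (q + r) - cut N r) * damp c t (q + r) +
            cut N r * (damp c t (q + r) - damp c t r) := by ring
        rw [e]
        have a1 : |(cut N (q + r) - cut N r) * damp c t (q + r)| ≤ |cut N (q + r) - cut N r| := by
          rw [abs_mul, abs_of_pos (damp_pos _ _ _)]
          exact mul_le_of_le_one_right (abs_nonneg _) (damp_le_one hc ht _)
        have a2 : |cut N r * (damp c t (q + r) - damp c t r)| ≤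
            |damp c t (q + r) - damp c t r| := by
          rw [abs_mul, abs_of_nonneg (cut_nonneg _ _)]
          exact mul_le_of_le_one_left (abs_nonneg _) (cut_le_one hN _)
        calc _ ≤ (|cut N (q + r) - cut N r| + |damp c t (q + r) - damp c t r|) * modL t r := by
              gcongr
              exact (abs_add_le _ _).trans (add_le_add a1 a2)
          _ = |cut N (q + r) - cut N r| * modL t r +
              |damp c t (q + r) - damp c t r| * modL t r := by ring
          _ ≤ |cut N (q + r) - cut N r| * ((1 + t) * modL 0 r) +
              3 * c * ((1 + t) * modL 0 q) := by
              refine add_le_add ?_ (abs_damp_sub_mul_le hc ht q r)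
              gcongr
              exact modL_le_mul ht r
          _ = (1 + t) * (|cut N (q + r) - cut N r| * modL 0 r) +
              3 * c * ((1 + t) * modL 0 q) := by ring
          _ ≤ (1 + t) * (2 * modL 0 q) + 3 * c * ((1 + t) * modL 0 q) := by
              have := mul_le_mul_of_nonneg_left (abs_cut_sub_mul_le hN q r)
                (by linarith : 0 ≤ 1 + t)
              linarith
          _ = (2 + 3 * c) * ((1 + t) * modL 0 q) := by ring
          _ ≤ _ := by gcongr
      calc _ ≤ amp s t r * ((2 + 3 * c) * ((1 + t) * jb 0 q)) := by
            gcongr; exact (amp_pos _ _ _).le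
        _ = (2 + 3 * c) * ((1 + t) * (jb 0 r ^ s * jb 0 q * √(jb t r))) := by unfold amp; ring
        _ ≤ _ := by gcongr; exact le_add_of_nonneg_right (Real.sqrt_nonneg _)
    -- The weight is changed one factor at a time: first ⟨·⟩^s, then the square root, then cutoff
    -- times damping. The three terms are those bounded in `T1`, `T2` and `T3`.
    have e : wgt c s N t (q + r) - wgt c s N t r =
        cut N (q + r) * damp c t (q + r) * ((jb 0 (q + r) ^ s - jb 0 r ^ s) * √(jb t (q + r))) +
        cut N (q + r) * damp c t (q + r) * (jb 0 r ^ s * (√(jb t (q + r)) - √(jb t r))) +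
        amp s t r * (cut N (q + r) * damp c t (q + r) - cut N r * damp c t r) := by
      unfold wgt amp; ring
    obtain ⟨D0, D1⟩ := hD (q + r)
    have hle : |wgt c s N t (q + r) - wgt c s N t r| * modL t r ≤
        |jb 0 (q + r) ^ s - jb 0 r ^ s| * √(jb t (q + r)) * modL t r +
        jb 0 r ^ s * (|√(jb t (q + r)) - √(jb t r)| * modL t r) +
        amp s t r * (|cut N (q + r) * damp c t (q + r) - cut N r * damp c t r| * modL t r) := by
      rw [e, ← mul_assoc (jb 0 r ^ s), ← mul_assoc (amp s t r), ← add_mul, ← add_mul]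
      gcongr
      refine (abs_add_three _ _ _).trans ?_
      gcongr
      · rw [abs_mul, abs_of_nonneg D0, abs_mul, abs_of_nonneg (Real.sqrt_nonneg _)]
        exact mul_le_of_le_one_left (by positivity) D1
      · rw [abs_mul, abs_of_nonneg D0, abs_mul, abs_of_pos hRs]
        exact mul_le_of_le_one_left (by positivity) D1
      · rw [abs_mul, abs_of_pos (amp_pos _ _ _)]
    have hX0 : 0 ≤ (1 + t) * (jb 0 r ^ s * jb 0 q * (√(jb t r) + √(jb t q))) := by positivity
    have hX1 : (1 + t) * (jb 0 r ^ s * jb 0 q * (√(jb t r) + √(jb t q))) ≤ (1 + t) * (2 * X) := by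
      gcongr
    have h2s : (0 : ℝ) < 2 ^ s := by positivity
    have h2s' : (0 : ℝ) ≤ s * 2 ^ (s - 1) := by positivity
    calc _ ≤ (s * 2 ^ (s - 1) + 3 + 3 * c) *
          ((1 + t) * (jb 0 r ^ s * jb 0 q * (√(jb t r) + √(jb t q)))) := by linarith
      _ ≤ (s * 2 ^ (s - 1) + 3 + 3 * c + 2 * 2 ^ s) * ((1 + t) * (2 * X)) :=
          mul_le_mul (by linarith) hX1 hX0 (by positivity)
      _ = _ := by unfold commConst; ring
  · -- high-low interactions
    have hX' := high_low_le hs t q r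
    rw [← hX] at hX'
    have h1 := amp_add_le (by linarith : 0 ≤ s) t h
    have h2 : amp s t r ≤ 2 ^ s * jb 0 q ^ s * (√(jb t q) + √(jb t r)) := by
      have : (1 : ℝ) ≤ 2 ^ s := Real.one_le_rpow (by norm_num) (by linarith)
      calc amp s t r ≤ jb 0 q ^ s * (√(jb t q) + √(jb t r)) := by
            unfold amp
            gcongr
            exact le_add_of_nonneg_left (Real.sqrt_nonneg _)
        _ ≤ _ := by
            rw [mul_assoc]
            exact le_mul_of_one_le_left (by positivity) this
    have hw : ∀ p, 0 ≤ wgt c s N t p ∧ wgt c s N t p ≤ amp s t p := fun p =>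
      ⟨mul_nonneg (hD p).1 (amp_pos _ _ _).le,
        mul_le_of_le_one_left (amp_pos _ _ _).le (hD p).2⟩
    -- No cancellation is needed here, since the factor |r_t| falls on the lower frequency.
    have h3 : |wgt c s N t (q + r) - wgt c s N t r| ≤
        2 * (2 ^ s * jb 0 q ^ s * (√(jb t q) + √(jb t r))) := by
      have := hw (q + r)
      have := hw r
      rw [abs_le]; constructor <;> linarith
    have h2s : (0 : ℝ) < 2 ^ s := by positivity
    have h2s' : (0 : ℝ) ≤ s * 2 ^ (s - 1) := by positivity
    have hX0 : 0 ≤ X :=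
      mul_nonneg (mul_pos (amp_pos _ _ _) (amp_pos _ _ _)).le (dec_nonneg _ _ _ _)
    calc _ ≤ 2 * (2 ^ s * jb 0 q ^ s * (√(jb t q) + √(jb t r))) * ((1 + t) * jb 0 r) :=
          mul_le_mul h3 hmr2 hmr (by positivity)
      _ = 2 * 2 ^ s * ((1 + t) * (jb 0 q ^ s * jb 0 r * (√(jb t q) + √(jb t r)))) := by ring
      _ ≤ 2 * 2 ^ s * ((1 + t) * (2 * X)) := by gcongr
      _ = 2 * (2 * 2 ^ s) * ((1 + t) * X) := by ring
      _ ≤ _ := by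
          unfold commConst
          refine mul_le_mul_of_nonneg_right (by linarith) (by positivity)

/-! ### Trilinear integrals -/

/-- The `L²` norm of a nonnegative function. -/
def ltwo (F : ℤ × ℝ → ℝ≥0∞) : ℝ≥0∞ := (∫⁻ p, F p ^ 2 ∂freqMeasure) ^ (1 / 2 : ℝ)

lemma lintegral_mul_le_ltwo {F G : ℤ × ℝ → ℝ≥0∞} (hF : AEMeasurable F freqMeasure)
    (hG : AEMeasurable G freqMeasure) : ∫⁻ p, F p * G p ∂freqMeasure ≤ ltwo F * ltwo G := by
  have := ENNReal.lintegral_mul_le_Lp_mul_Lq freqMeasure Real.HolderConjugate.two_two hF hG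
  unfold ltwo
  simpa only [Pi.mul_apply, ENNReal.rpow_two] using this

lemma ltwo_comp_sub_left (G : ℤ × ℝ → ℝ≥0∞) (p : ℤ × ℝ) :
    ltwo (fun q => G (p - q)) = ltwo G := by
  unfold ltwo
  rw [lintegral_sub_left_eq_self (fun q => G q ^ 2)]

lemma ltwo_comp_sub_right (G : ℤ × ℝ → ℝ≥0∞) (q : ℤ × ℝ) :
    ltwo (fun p => G (p - q)) = ltwo G := by
  unfold ltwo
  rw [lintegral_sub_right_eq_self (fun q => G q ^ 2)]

/-- The trilinear form `∫∫ F(q) G(p - q) H(p)`. -/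
def tri (F G H : ℤ × ℝ → ℝ≥0∞) : ℝ≥0∞ :=
  ∫⁻ p, ∫⁻ q, F q * G (p - q) * H p ∂freqMeasure ∂freqMeasure

lemma aemeasurable_comp_sub {G : ℤ × ℝ → ℝ≥0∞} (hG : AEMeasurable G freqMeasure) :
    AEMeasurable (fun x : (ℤ × ℝ) × (ℤ × ℝ) => G (x.1 - x.2)) (freqMeasure.prod freqMeasure) :=
  hG.comp_quasiMeasurePreserving (quasiMeasurePreserving_sub freqMeasure freqMeasure)

lemma aemeasurable_comp_sub_left {G : ℤ × ℝ → ℝ≥0∞} (hG : AEMeasurable G freqMeasure) (p : ℤ × ℝ) :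
    AEMeasurable (fun q => G (p - q)) freqMeasure :=
  hG.comp_quasiMeasurePreserving
    (Measure.measurePreserving_sub_left freqMeasure p).quasiMeasurePreserving

lemma aemeasurable_comp_sub_right {G : ℤ × ℝ → ℝ≥0∞} (hG : AEMeasurable G freqMeasure)
    (q : ℤ × ℝ) : AEMeasurable (fun p => G (p - q)) freqMeasure :=
  hG.comp_quasiMeasurePreserving (measurePreserving_sub_right freqMeasure q).quasiMeasurePreserving

lemma aemeasurable_tri {F G H : ℤ × ℝ → ℝ≥0∞} (hF : AEMeasurable F freqMeasure)
    (hG : AEMeasurable G freqMeasure) (hH : AEMeasurable H freqMeasure) :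
    AEMeasurable (fun x : (ℤ × ℝ) × (ℤ × ℝ) => F x.2 * G (x.1 - x.2) * H x.1)
      (freqMeasure.prod freqMeasure) :=
  (hF.comp_snd.mul (aemeasurable_comp_sub hG)).mul hH.comp_fst

lemma tri_eq_lintegral_prod {F G H : ℤ × ℝ → ℝ≥0∞} (hF : AEMeasurable F freqMeasure)
    (hG : AEMeasurable G freqMeasure) (hH : AEMeasurable H freqMeasure) :
    tri F G H = ∫⁻ x, F x.2 * G (x.1 - x.2) * H x.1 ∂(freqMeasure.prod freqMeasure) :=
  (lintegral_prod _ (aemeasurable_tri hF hG hH)).symm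

lemma tri_le_three {F G H : ℤ × ℝ → ℝ≥0∞} (hF : AEMeasurable F freqMeasure)
    (hG : AEMeasurable G freqMeasure) (hH : AEMeasurable H freqMeasure) :
    tri F G H ≤ ltwo F * ltwo G * ∫⁻ p, H p ∂freqMeasure := by
  unfold tri
  rw [← lintegral_const_mul'' _ hH]
  refine lintegral_mono fun p => ?_
  have hGp := aemeasurable_comp_sub_left hG p
  have hFG : AEMeasurable (fun q => F q * G (p - q)) freqMeasure := hF.mul hGp
  rw [lintegral_mul_const'' _ hFG]
  gcongr
  exact (lintegral_mul_le_ltwo hF hGp).trans_eq (by rw [ltwo_comp_sub_left])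

lemma tri_le_one {F G H : ℤ × ℝ → ℝ≥0∞} (hF : AEMeasurable F freqMeasure)
    (hG : AEMeasurable G freqMeasure) (hH : AEMeasurable H freqMeasure) :
    tri F G H ≤ (∫⁻ p, F p ∂freqMeasure) * (ltwo G * ltwo H) := by
  unfold tri
  rw [lintegral_lintegral_swap (aemeasurable_tri hF hG hH), ← lintegral_mul_const'' _ hF]
  refine lintegral_mono fun q => ?_
  have hGq := aemeasurable_comp_sub_right hG q
  have hGH : AEMeasurable (fun p => G (p - q) * H p) freqMeasure := hGq.mul hH
  simp only [mul_assoc]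
  rw [lintegral_const_mul'' _ hGH]
  gcongr
  exact (lintegral_mul_le_ltwo hGq hH).trans_eq (by rw [ltwo_comp_sub_right])

lemma tri_comm (F G H : ℤ × ℝ → ℝ≥0∞) : tri F G H = tri G F H := by
  unfold tri
  congr 1; ext p
  rw [← lintegral_sub_left_eq_self _ p]
  congr 1; ext q
  rw [sub_sub_cancel, mul_comm (F _)]

lemma tri_le_two {F G H : ℤ × ℝ → ℝ≥0∞} (hF : AEMeasurable F freqMeasure)
    (hG : AEMeasurable G freqMeasure) (hH : AEMeasurable H freqMeasure) :
    tri F G H ≤ (∫⁻ p, G p ∂freqMeasure) * (ltwo F * ltwo H) := by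
  rw [tri_comm]; exact tri_le_one hG hF hH

/-- The sum of the decaying factors `⟨p⟩^{-l}` and `⟨p_t⟩^{-l}`. -/
def dec1 (l t : ℝ) (p : ℤ × ℝ) : ℝ≥0∞ := ENNReal.ofReal (jb 0 p ^ (-l) + jb t p ^ (-l))

lemma measurable_dec1 (l t : ℝ) : Measurable (dec1 l t) := by
  unfold dec1
  exact (by fun_prop : Measurable fun p => jb 0 p ^ (-l) + jb t p ^ (-l)).ennreal_ofReal

lemma ofReal_dec (l t : ℝ) (q r : ℤ × ℝ) :
    ENNReal.ofReal (dec l t q r) = dec1 l t q + dec1 l t r := by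
  have h := fun t p => Real.rpow_nonneg (jb_pos t p).le (-l)
  unfold dec dec1
  rw [← ENNReal.ofReal_add (add_nonneg (h _ _) (h _ _)) (add_nonneg (h _ _) (h _ _))]
  congr 1; ring

lemma wconst_shear (l t : ℝ) :
    eLpNorm (fun p : ℤ × ℝ => ((jb t p ^ (-l) : ℝ) : ℂ)) 2 freqMeasure = wconst l := by
  unfold wconst
  have hm : Measurable fun x : ℝ => ‖((x ^ (-l) : ℝ) : ℂ)‖ₑ ^ 2 := by fun_prop
  rw [eLpNorm_two_eq, eLpNorm_two_eq, lintegral_jb_shear t _ hm]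

lemma ltwo_dec1_le (l t : ℝ) : ltwo (dec1 l t) ≤ 2 * wconst l := by
  have h := fun t p => Real.rpow_nonneg (jb_pos t p).le (-l)
  have e : ltwo (dec1 l t) = eLpNorm (fun p : ℤ × ℝ =>
      ((jb 0 p ^ (-l) : ℝ) : ℂ) + ((jb t p ^ (-l) : ℝ) : ℂ)) 2 freqMeasure := by
    rw [eLpNorm_two_eq, ltwo]
    congr 2; ext p
    rw [← Complex.ofReal_add, dec1, ← ofReal_norm, Complex.norm_real,
      Real.norm_of_nonneg (add_nonneg (h _ _) (h _ _))]
  have hm : ∀ t, Measurable fun p => ((jb t p ^ (-l) : ℝ) : ℂ) := fun t => by fun_prop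
  rw [e]
  refine (eLpNorm_add_le (hm 0).aestronglyMeasurable (hm t).aestronglyMeasurable
    (by norm_num)).trans ?_
  rw [wconst_shear, wconst_shear, two_mul]

lemma lintegral_dec1_mul_le (l t : ℝ) {F : ℤ × ℝ → ℝ≥0∞} (hF : AEMeasurable F freqMeasure) :
    ∫⁻ p, dec1 l t p * F p ∂freqMeasure ≤ 2 * wconst l * ltwo F :=
  (lintegral_mul_le_ltwo (measurable_dec1 l t).aemeasurable hF).trans
    (mul_le_mul_left (ltwo_dec1_le l t) _)

/-- The trilinear estimate: one decaying factor on any of the three frequencies suffices. -/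
lemma lintegral_tri_dec_le (l t : ℝ) {F G H : ℤ × ℝ → ℝ≥0∞} (hF : AEMeasurable F freqMeasure)
    (hG : AEMeasurable G freqMeasure) (hH : AEMeasurable H freqMeasure) :
    ∫⁻ x : (ℤ × ℝ) × (ℤ × ℝ), F x.2 * G (x.1 - x.2) * H x.1 *
      (ENNReal.ofReal (dec l t x.2 (x.1 - x.2)) + ENNReal.ofReal (dec l t x.2 x.1))
      ∂(freqMeasure.prod freqMeasure) ≤ 8 * wconst l * (ltwo F * ltwo G * ltwo H) := by
  have hd := (measurable_dec1 l t).aemeasurable (μ := freqMeasure)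
  have hF' := hd.mul hF
  have hG' := hd.mul hG
  have hH' := hd.mul hH
  -- The two values of `dec` split into four terms, with the frequency q counted twice. Each puts
  -- the decay on one function, which Cauchy-Schwarz then places in L¹ with constant 2 `wconst`;
  -- four such terms give the 8.
  have e : ∀ x : (ℤ × ℝ) × (ℤ × ℝ), F x.2 * G (x.1 - x.2) * H x.1 *
      (ENNReal.ofReal (dec l t x.2 (x.1 - x.2)) + ENNReal.ofReal (dec l t x.2 x.1)) =
      (dec1 l t * F) x.2 * G (x.1 - x.2) * H x.1 + (dec1 l t * F) x.2 * G (x.1 - x.2) * H x.1 +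
      F x.2 * (dec1 l t * G) (x.1 - x.2) * H x.1 + F x.2 * G (x.1 - x.2) * (dec1 l t * H) x.1 := by
    intro x
    rw [ofReal_dec, ofReal_dec]
    simp only [Pi.mul_apply]
    ring
  simp_rw [e]
  have m1 := aemeasurable_tri hF' hG hH
  have m2 := aemeasurable_tri hF hG' hH
  have m3 := aemeasurable_tri hF hG hH'
  rw [lintegral_add_right' _ m3, lintegral_add_right' _ m2, lintegral_add_right' _ m1,
    ← tri_eq_lintegral_prod hF' hG hH, ← tri_eq_lintegral_prod hF hG' hH,
    ← tri_eq_lintegral_prod hF hG hH']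
  have t1 := (tri_le_one hF' hG hH).trans (mul_le_mul_left (lintegral_dec1_mul_le l t hF) _)
  have t2 := (tri_le_two hF hG' hH).trans (mul_le_mul_left (lintegral_dec1_mul_le l t hG) _)
  have t3 := (tri_le_three hF hG hH').trans (mul_le_mul_right (lintegral_dec1_mul_le l t hH) _)
  refine (add_le_add (add_le_add (add_le_add t1 t1) t2) t3).trans_eq ?_
  ring

lemma tri_lt_top {F G H : ℤ × ℝ → ℝ≥0∞} (hF : AEMeasurable F freqMeasure)
    (hG : AEMeasurable G freqMeasure) (hH : AEMeasurable H freqMeasure)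
    (h1 : ∫⁻ p, F p ∂freqMeasure < ⊤) (h2 : ltwo G < ⊤) (h3 : ltwo H < ⊤) :
    ∫⁻ x, F x.2 * G (x.1 - x.2) * H x.1 ∂(freqMeasure.prod freqMeasure) < ⊤ := by
  rw [← tri_eq_lintegral_prod hF hG hH]
  exact (tri_le_one hF hG hH).trans_lt (ENNReal.mul_lt_top h1 (ENNReal.mul_lt_top h2 h3))


/-! ### Skew-symmetry of transport -/

/-- The symbol `p_t · nv(q)` of transport. -/
def tsym (t : ℝ) (p q : ℤ × ℝ) : ℝ := sym t p 0 * nv t q 0 + sym t p 1 * nv t q 1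

/-- Since q_t ⊥ nv(q), the derivative may be placed on the product or on the advected function
alike. This is incompressibility. -/
lemma tsym_sub (t : ℝ) (p q : ℤ × ℝ) : tsym t (p - q) q = tsym t p q := by
  have h := sym_mul_nv t q
  simp only [tsym, sym_zero, sym_one, Prod.fst_sub, Prod.snd_sub] at h ⊢
  push_cast
  linear_combination -h

lemma tsym_neg_right (t : ℝ) (p q : ℤ × ℝ) : tsym t p (-q) = -tsym t p q := by
  simp only [tsym, nv_neg]; ring

lemma abs_tsym_le (t : ℝ) (p q : ℤ × ℝ) : |tsym t p q| ≤ modL t p := by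
  refine abs_le_of_sq_le_sq ?_ (modL_nonneg t p)
  have h := nv_sq_add_le t q
  have e : modL t p ^ 2 = sym t p 0 ^ 2 + sym t p 1 ^ 2 := by rw [modL_sq]; rfl
  unfold tsym
  nlinarith [sq_nonneg (sym t p 0 * nv t q 1 - sym t p 1 * nv t q 0),
    mul_le_mul_of_nonneg_left h (add_nonneg (sq_nonneg (sym t p 0)) (sq_nonneg (sym t p 1)))]

lemma abs_tsym_le_sub (t : ℝ) (p q : ℤ × ℝ) : |tsym t p q| ≤ modL t (p - q) := by
  rw [← tsym_sub]; exact abs_tsym_le t _ q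

lemma measurable_tsym (t : ℝ) : Measurable (fun x : (ℤ × ℝ) × (ℤ × ℝ) => tsym t x.1 x.2) := by
  have h1 := fun j => (measurable_sym t j).comp
    (measurable_fst : Measurable (Prod.fst : (ℤ × ℝ) × (ℤ × ℝ) → ℤ × ℝ))
  have h2 := fun j => (measurable_nv t j).comp
    (measurable_snd : Measurable (Prod.snd : (ℤ × ℝ) × (ℤ × ℝ) → ℤ × ℝ))
  exact ((h1 0).mul (h2 0)).add ((h1 1).mul (h2 1))

lemma wgt_nonneg (c s N t : ℝ) (p : ℤ × ℝ) : 0 ≤ wgt c s N t p :=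
  mul_nonneg (mul_nonneg (cut_nonneg _ _) (damp_pos _ _ _).le) (amp_pos _ _ _).le

lemma wgt_le_amp {c N t : ℝ} (hc : 0 ≤ c) (hN : 0 < N) (ht : 0 ≤ t) (s : ℝ) (p : ℤ × ℝ) :
    wgt c s N t p ≤ amp s t p :=
  mul_le_of_le_one_left (amp_pos _ _ _).le
    (mul_le_one₀ (cut_le_one hN p) (damp_pos _ _ _).le (damp_le_one hc ht p))

lemma measurable_wgt (c s N t : ℝ) : Measurable (wgt c s N t) :=
  ((measurable_cut N).mul (measurable_damp c t)).mul (measurable_amp s t)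

lemma amp_sq_le {t : ℝ} (ht : 0 ≤ t) (s : ℝ) (p : ℤ × ℝ) :
    amp s t p ^ 2 ≤ (1 + t) * jb 0 p ^ (2 * s + 1) := by
  have h0 := jb_pos 0 p
  unfold amp
  rw [mul_pow, Real.sq_sqrt (jb_pos t p).le, Real.rpow_add_one h0.ne', two_mul s,
    Real.rpow_add h0, sq]
  have := mul_le_mul_of_nonneg_left (jb_le_mul ht p)
    (mul_nonneg (Real.rpow_nonneg h0.le s) (Real.rpow_nonneg h0.le s))
  linarith

/-- The cutoff makes the energy weight bounded with all its moments. -/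
lemma wgt_sq_mul_le {c s N t : ℝ} (hc : 0 ≤ c) (hs : 0 ≤ s) (hN : 0 < N) (ht : 0 ≤ t) (m : ℕ)
    (p : ℤ × ℝ) : wgt c s N t p ^ 2 * jb 0 p ^ m ≤ (1 + t) * N ^ (2 * s + 1) * N ^ m := by
  have h0 := jb_pos 0 p
  rcases le_total N (jb 0 p) with h | h
  · rw [wgt, cut_eq_zero hN h]
    simp only [zero_mul, ne_eq, OfNat.ofNat_ne_zero, not_false_eq_true, zero_pow]
    positivity
  · have h1 : wgt c s N t p ^ 2 ≤ (1 + t) * N ^ (2 * s + 1) :=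
      (pow_le_pow_left₀ (wgt_nonneg _ _ _ _ _) (wgt_le_amp hc hN ht s p) 2).trans
        ((amp_sq_le ht s p).trans (by gcongr))
    exact mul_le_mul h1 (pow_le_pow_left₀ h0.le h m) (by positivity) (by positivity)

/-- The `L²` norm with weight `⟨∇⟩^s ⟨∇_L⟩^{1/2}`. -/
def en (s t : ℝ) (f : ℤ × ℝ → ℂ) : ℝ≥0∞ := ltwo fun p => ‖((amp s t p : ℝ) : ℂ) * f p‖ₑ

lemma ltwo_enorm (f : ℤ × ℝ → ℂ) : ltwo (fun p => ‖f p‖ₑ) = eLpNorm f 2 freqMeasure := by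
  rw [eLpNorm_two_eq]; rfl

lemma aestronglyMeasurable_amp_mul (s t : ℝ) {f : ℤ × ℝ → ℂ}
    (hf : AEStronglyMeasurable f freqMeasure) :
    AEStronglyMeasurable (fun p => ((amp s t p : ℝ) : ℂ) * f p) freqMeasure :=
  (Complex.measurable_ofReal.comp (measurable_amp s t)).aestronglyMeasurable.mul hf

/-- Functions that are integrable and square integrable. -/
structure Both (f : ℤ × ℝ → ℂ) : Prop where
  int : Integrable f freqMeasure
  two : MemLp f 2 freqMeasure

/-- The trilinear integral with kernel `K`. -/
def triC (K : ℤ × ℝ → ℤ × ℝ → ℝ) (w f g : ℤ × ℝ → ℂ) : ℂ :=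
  ∫ x : (ℤ × ℝ) × (ℤ × ℝ), (K x.1 x.2 : ℂ) * (w x.2 * f (x.1 - x.2) * (starRingEnd ℂ) (g x.1))
    ∂(freqMeasure.prod freqMeasure)

lemma integrable_triC {K : ℤ × ℝ → ℤ × ℝ → ℝ} {w f g : ℤ × ℝ → ℂ} {C : ℝ}
    (hK : Measurable (fun x : (ℤ × ℝ) × (ℤ × ℝ) => K x.1 x.2)) (hC : ∀ p q, |K p q| ≤ C)
    (hw : Both w) (hf : Both f) (hg : Both g) :
    Integrable (fun x : (ℤ × ℝ) × (ℤ × ℝ) =>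
      (K x.1 x.2 : ℂ) * (w x.2 * f (x.1 - x.2) * (starRingEnd ℂ) (g x.1)))
      (freqMeasure.prod freqMeasure) := by
  refine Integrable.bdd_mul (c := C) ?_
    (Complex.measurable_ofReal.comp hK).aestronglyMeasurable
    (Eventually.of_forall fun x => ?_)
  · have hfm : AEStronglyMeasurable (fun x : (ℤ × ℝ) × (ℤ × ℝ) => f (x.1 - x.2))
        (freqMeasure.prod freqMeasure) := hf.int.aestronglyMeasurable.comp_quasiMeasurePreserving
      (quasiMeasurePreserving_sub freqMeasure freqMeasure)
    refine ⟨(hw.int.aestronglyMeasurable.comp_snd.mul hfm).mul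
      (Complex.continuous_conj.comp_aestronglyMeasurable hg.int.aestronglyMeasurable.comp_fst), ?_⟩
    have := tri_lt_top hw.int.aestronglyMeasurable.enorm hf.int.aestronglyMeasurable.enorm
      hg.int.aestronglyMeasurable.enorm hw.int.2 (by rw [ltwo_enorm]; exact hf.two.2)
      (by rw [ltwo_enorm]; exact hg.two.2)
    refine lt_of_eq_of_lt (lintegral_congr fun x => ?_) this
    rw [enorm_mul, enorm_mul, RCLike.enorm_conj]
  · rw [Complex.norm_real]; exact hC _ _

/-- Two decaying factors are allowed because the commutator is estimated once with output p and once
with output p - q, which yields decay in (q, p - q) or in (q, p). -/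
lemma enorm_triC_le {K : ℤ × ℝ → ℤ × ℝ → ℝ} {w f g : ℤ × ℝ → ℂ} {C s t : ℝ} (hC0 : 0 ≤ C)
    (hC : ∀ p q, |K p q| ≤ C * (amp s t p * (amp s t q * amp s t (p - q)) *
      (dec (s - 1 / 2) t q (p - q) + dec (s - 1 / 2) t q p)))
    (hw : Both w) (hf : Both f) (hg : Both g) :
    ‖triC K w f g‖ₑ ≤ ENNReal.ofReal C * (8 * wconst (s - 1 / 2) *
      (en s t w * en s t f * en s t g)) := by
  have mw := (aestronglyMeasurable_amp_mul s t hw.int.aestronglyMeasurable).enorm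
  have mf := (aestronglyMeasurable_amp_mul s t hf.int.aestronglyMeasurable).enorm
  have mg := (aestronglyMeasurable_amp_mul s t hg.int.aestronglyMeasurable).enorm
  refine (enorm_integral_le_lintegral_enorm _).trans ?_
  refine le_trans ?_ (mul_le_mul_right (lintegral_tri_dec_le (s - 1 / 2) t mw mf mg) _)
  rw [← lintegral_const_mul' _ _ ENNReal.ofReal_ne_top]
  refine lintegral_mono fun x => ?_
  have hA := fun p => (amp_pos s t p).le
  have e : ∀ p (f : ℤ × ℝ → ℂ), ‖((amp s t p : ℝ) : ℂ) * f p‖ₑ = ENNReal.ofReal (amp s t p) * ‖f p‖ₑ := by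
    intro p f
    rw [enorm_mul]; congr 1
    rw [← ofReal_norm, Complex.norm_real, Real.norm_of_nonneg (hA p)]
  have hKe : ‖(K x.1 x.2 : ℂ)‖ₑ ≤ ENNReal.ofReal C * (ENNReal.ofReal (amp s t x.1) *
      (ENNReal.ofReal (amp s t x.2) * ENNReal.ofReal (amp s t (x.1 - x.2))) *
      (ENNReal.ofReal (dec (s - 1 / 2) t x.2 (x.1 - x.2)) +
        ENNReal.ofReal (dec (s - 1 / 2) t x.2 x.1))) := by
    rw [← ENNReal.ofReal_add (dec_nonneg _ _ _ _) (dec_nonneg _ _ _ _),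
      ← ENNReal.ofReal_mul (hA _), ← ENNReal.ofReal_mul (hA _),
      ← ENNReal.ofReal_mul (mul_nonneg (hA _) (mul_nonneg (hA _) (hA _))),
      ← ENNReal.ofReal_mul hC0, ← ofReal_norm, Complex.norm_real]
    exact ENNReal.ofReal_le_ofReal (hC x.1 x.2)
  rw [enorm_mul, enorm_mul, enorm_mul, RCLike.enorm_conj, e, e, e]
  refine (mul_le_mul_left hKe _).trans_eq ?_
  ring

lemma measurePreserving_flip : MeasurePreserving
    (fun x : (ℤ × ℝ) × (ℤ × ℝ) => (x.1 - x.2, -x.2)) (freqMeasure.prod freqMeasure)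
    (freqMeasure.prod freqMeasure) := by
  have h1 : MeasurePreserving (fun x : (ℤ × ℝ) × (ℤ × ℝ) => (-x.1, x.2 - x.1))
      (freqMeasure.prod freqMeasure) (freqMeasure.prod freqMeasure) :=
    (Measure.measurePreserving_neg freqMeasure).skew_product
      (g := fun (q : ℤ × ℝ) (p : ℤ × ℝ) => p - q) (measurable_snd.sub measurable_fst)
      (Eventually.of_forall fun q => (measurePreserving_sub_right freqMeasure q).map_eq)
  exact (Measure.measurePreserving_swap.comp h1).comp Measure.measurePreserving_swap

/-- The substitution (p, q) ↦ (p - q, -q) exchanges the advected function with the one it is tested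
against. Reality of the velocity converts w(-q) back into the conjugate of w(q). This is integration
by parts in frequency variables. -/
lemma triC_flip {K : ℤ × ℝ → ℤ × ℝ → ℝ} {w f g : ℤ × ℝ → ℂ}
    (hint : Integrable (fun x : (ℤ × ℝ) × (ℤ × ℝ) =>
      (K x.1 x.2 : ℂ) * (w x.2 * g (x.1 - x.2) * (starRingEnd ℂ) (f x.1)))
      (freqMeasure.prod freqMeasure))
    (hw : ∀ᵐ p ∂freqMeasure, w (-p) = -(starRingEnd ℂ) (w p)) :
    (starRingEnd ℂ) (triC K w g f) = -triC (fun p q => K (p - q) (-q)) w f g := by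
  have h := integral_map (μ := freqMeasure.prod freqMeasure)
    measurePreserving_flip.measurable.aemeasurable
    (by rw [measurePreserving_flip.map_eq]; exact hint.aestronglyMeasurable)
  rw [measurePreserving_flip.map_eq] at h
  rw [triC, h, ← integral_conj, triC, ← integral_neg]
  refine integral_congr_ae ?_
  have hw2 : ∀ᵐ x : (ℤ × ℝ) × (ℤ × ℝ) ∂(freqMeasure.prod freqMeasure),
      w (-x.2) = -(starRingEnd ℂ) (w x.2) :=
    Measure.quasiMeasurePreserving_snd.ae hw
  filter_upwards [hw2] with x hx
  simp only [hx, map_mul, map_neg, Complex.conj_conj, Complex.conj_ofReal, sub_neg_eq_add,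
    sub_add_cancel]
  ring


lemma ae_integrable_conv {w f : ℤ × ℝ → ℂ} (hw : Integrable w freqMeasure)
    (hf : Integrable f freqMeasure) :
    ∀ᵐ p ∂freqMeasure, Integrable (fun q => w q * f (p - q)) freqMeasure :=
  (integrable_conv_integrand hw hf).prod_right_ae

lemma measurable_nv_ofReal (t : ℝ) (j : Fin 2) : Measurable fun p => (nv t p j : ℂ) :=
  Complex.measurable_ofReal.comp (measurable_nv t j)

lemma adv_eq (t : ℝ) {w f : ℤ × ℝ → ℂ} (hw : Integrable w freqMeasure)
    (hf : Integrable f freqMeasure) :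
    ∀ᵐ p ∂freqMeasure, adv t w f p = Complex.I * ((2 * Real.pi)⁻¹ : ℝ) *
      ∫ q, (tsym t p q : ℂ) * (w q * f (p - q)) ∂freqMeasure := by
  filter_upwards [ae_integrable_conv hw hf] with p hp
  have hj : ∀ j, Integrable (fun q => (nv t q j : ℂ) * (w q * f (p - q))) freqMeasure := fun j =>
    hp.bdd_mul (c := 1) (measurable_nv_ofReal t j).aestronglyMeasurable
      (Eventually.of_forall (norm_nv_le t j))
  have e : (fun q => (tsym t p q : ℂ) * (w q * f (p - q))) = fun q =>
      (sym t p 0 : ℂ) * ((nv t q 0 : ℂ) * (w q * f (p - q))) +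
      (sym t p 1 : ℂ) * ((nv t q 1 : ℂ) * (w q * f (p - q))) := by
    ext q; simp only [tsym]; push_cast; ring
  rw [e, integral_add ((hj 0).const_mul _) ((hj 1).const_mul _), integral_const_mul,
    integral_const_mul]
  simp only [adv, conv, vel, Fin.sum_univ_two, mul_assoc]
  ring

lemma Both.vel {w : ℤ × ℝ → ℂ} (hw : Both w) (t : ℝ) (i : Fin 2) : Both (vel t w i) :=
  ⟨hw.int.bdd_mul (c := 1) (measurable_nv_ofReal t i).aestronglyMeasurable
    (Eventually.of_forall (norm_nv_le t i)),
    hw.two.of_le (aestronglyMeasurable_nv_mul t i hw.int.aestronglyMeasurable)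
      (Eventually.of_forall fun p => by
        rw [Boussinesq.vel, norm_mul]
        exact mul_le_of_le_one_left (norm_nonneg _) (norm_nv_le t i p))⟩

lemma en_mono {s t : ℝ} {f g : ℤ × ℝ → ℂ} (h : ∀ p, ‖f p‖ ≤ ‖g p‖) : en s t f ≤ en s t g := by
  unfold en
  rw [ltwo_enorm, ltwo_enorm]
  refine eLpNorm_mono fun p => ?_
  rw [norm_mul, norm_mul]
  exact mul_le_mul_of_nonneg_left (h p) (norm_nonneg _)

lemma en_vel_le (s t : ℝ) (w : ℤ × ℝ → ℂ) (i : Fin 2) : en s t (vel t w i) ≤ en s t w :=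
  en_mono fun p => by
    rw [vel, norm_mul]; exact mul_le_of_le_one_left (norm_nonneg _) (norm_nv_le t i p)

/-- Weighted pairing with a trilinear integral. -/
lemma integral_mul_triC {K : ℤ × ℝ → ℤ × ℝ → ℝ} {m : ℤ × ℝ → ℝ} {F w f g : ℤ × ℝ → ℂ} {C : ℝ}
    (hm : Measurable m) (hK : Measurable (fun x : (ℤ × ℝ) × (ℤ × ℝ) => K x.1 x.2))
    (hC : ∀ p q, |m p * K p q| ≤ C) (hw : Both w) (hf : Both f) (hg : Both g)
    (hF : ∀ᵐ p ∂freqMeasure, F p = Complex.I * ((2 * Real.pi)⁻¹ : ℝ) *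
      ∫ q, (K p q : ℂ) * (w q * f (p - q)) ∂freqMeasure) :
    Integrable (fun p => (m p : ℂ) * (F p * (starRingEnd ℂ) (g p))) freqMeasure ∧
    ∫ p, (m p : ℂ) * (F p * (starRingEnd ℂ) (g p)) ∂freqMeasure =
      Complex.I * ((2 * Real.pi)⁻¹ : ℝ) * triC (fun p q => m p * K p q) w f g := by
  have hmK : Measurable (fun x : (ℤ × ℝ) × (ℤ × ℝ) => m x.1 * K x.1 x.2) :=
    (hm.comp measurable_fst).mul hK
  have hint := integrable_triC hmK hC hw hf hg
  have e : ∀ᵐ p ∂freqMeasure, (m p : ℂ) * (F p * (starRingEnd ℂ) (g p)) =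
      Complex.I * ((2 * Real.pi)⁻¹ : ℝ) * ∫ q, ((m p * K p q : ℝ) : ℂ) *
        (w q * f (p - q) * (starRingEnd ℂ) (g p)) ∂freqMeasure := by
    filter_upwards [hF] with p hp
    rw [hp]
    have : (fun q => ((m p * K p q : ℝ) : ℂ) * (w q * f (p - q) * (starRingEnd ℂ) (g p))) =
        fun q => ((m p : ℂ) * (starRingEnd ℂ) (g p)) * ((K p q : ℂ) * (w q * f (p - q))) := by
      ext q; push_cast; ring
    rw [this, integral_const_mul]
    ring
  refine ⟨(hint.integral_prod_left.const_mul _).congr (e.mono fun p hp => hp.symm), ?_⟩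
  rw [integral_congr_ae e, integral_const_mul, triC, integral_prod _ hint]

section Transport

variable {c s N t : ℝ} {v f g : ℤ × ℝ → ℂ}

lemma abs_wgt_sq_mul_le (hc : 0 ≤ c) (hs : 0 ≤ s) (hN : 0 < N) (ht : 0 ≤ t) {p : ℤ × ℝ} {x : ℝ}
    (hx : |x| ≤ modL t p) :
    |wgt c s N t p ^ 2 * x| ≤ (1 + t) * ((1 + t) * N ^ (2 * s + 1) * N ^ 1) := by
  rw [abs_mul, abs_of_nonneg (sq_nonneg _)]
  have h1 := wgt_sq_mul_le hc hs hN ht 1 p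
  have h2 : |x| ≤ (1 + t) * jb 0 p := hx.trans ((modL_le_mul ht p).trans
    (mul_le_mul_of_nonneg_left (modL_le_jb 0 p) (by linarith)))
  calc _ ≤ wgt c s N t p ^ 2 * ((1 + t) * jb 0 p) := by gcongr
    _ = (1 + t) * (wgt c s N t p ^ 2 * jb 0 p ^ 1) := by ring
    _ ≤ _ := by gcongr

lemma integrable_adv_mul (hc : 0 ≤ c) (hs : 0 ≤ s) (hN : 0 < N) (ht : 0 ≤ t)
    (hv : Both v) (hf : Both f) (hg : Both g) :
    Integrable (fun p => ((wgt c s N t p ^ 2 : ℝ) : ℂ) * (adv t v f p * (starRingEnd ℂ) (g p)))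
      freqMeasure ∧
    ∫ p, ((wgt c s N t p ^ 2 : ℝ) : ℂ) * (adv t v f p * (starRingEnd ℂ) (g p)) ∂freqMeasure =
      Complex.I * ((2 * Real.pi)⁻¹ : ℝ) * triC (fun p q => wgt c s N t p ^ 2 * tsym t p q) v f g :=
  integral_mul_triC ((measurable_wgt c s N t).pow_const 2) (measurable_tsym t)
    (fun p q => abs_wgt_sq_mul_le hc hs hN ht (abs_tsym_le t p q)) hv hf hg (adv_eq t hv.int hf.int)

/-- The transport terms cancel up to a commutator. -/
lemma enorm_transport_le (hc : 0 ≤ c) (hs : 1 ≤ s) (hN : 0 < N) (ht : 0 ≤ t)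
    (hv : Both v) (hf : Both f) (hg : Both g)
    (hr : ∀ᵐ p ∂freqMeasure, v (-p) = -(starRingEnd ℂ) (v p)) :
    ‖∫ p, ((wgt c s N t p ^ 2 : ℝ) : ℂ) * (adv t v f p * (starRingEnd ℂ) (g p) +
      f p * (starRingEnd ℂ) (adv t v g p)) ∂freqMeasure‖ₑ ≤
      ENNReal.ofReal (commConst c s * (1 + t)) * (8 * wconst (s - 1 / 2) *
      (en s t v * en s t f * en s t g)) := by
  have hs0 : 0 ≤ s := by linarith
  have hW := (measurable_wgt c s N t).pow_const 2
  have hB := fun p q => abs_wgt_sq_mul_le hc hs0 hN ht (abs_tsym_le t p q)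
  have hKm : Measurable (fun x : (ℤ × ℝ) × (ℤ × ℝ) => wgt c s N t x.1 ^ 2 * tsym t x.1 x.2) :=
    (hW.comp measurable_fst).mul (measurable_tsym t)
  obtain ⟨i1, e1⟩ := integrable_adv_mul hc hs0 hN ht hv hf hg
  obtain ⟨i2, e2⟩ := integrable_adv_mul hc hs0 hN ht hv hg hf
  have hflip := triC_flip (integrable_triC hKm hB hv hg hf) hr
  -- Since `nv` is odd and orthogonal to q_t, the flipped kernel is the original one with opposite
  -- sign and with the weight evaluated at p - q. The two transport integrals therefore add up to
  -- one with the difference of the squared weights.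
  have hK2 : (fun p q : ℤ × ℝ => wgt c s N t (p - q) ^ 2 * tsym t (p - q) (-q)) =
      fun p q => -(wgt c s N t (p - q) ^ 2 * tsym t p q) := by
    ext p q; rw [tsym_neg_right, tsym_sub]; ring
  rw [hK2] at hflip
  have i2' : Integrable (fun p => ((wgt c s N t p ^ 2 : ℝ) : ℂ) *
      (f p * (starRingEnd ℂ) (adv t v g p))) freqMeasure := by
    have := Complex.conjCLE.toContinuousLinearMap.integrable_comp i2
    refine this.congr (Eventually.of_forall fun p => ?_)
    simp [mul_comm]
  have e2' : ∫ p, ((wgt c s N t p ^ 2 : ℝ) : ℂ) * (f p * (starRingEnd ℂ) (adv t v g p))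
      ∂freqMeasure = Complex.I * ((2 * Real.pi)⁻¹ : ℝ) *
      triC (fun p q => -(wgt c s N t (p - q) ^ 2 * tsym t p q)) v f g := by
    have : ∀ p, ((wgt c s N t p ^ 2 : ℝ) : ℂ) * (f p * (starRingEnd ℂ) (adv t v g p)) =
        (starRingEnd ℂ) (((wgt c s N t p ^ 2 : ℝ) : ℂ) *
          (adv t v g p * (starRingEnd ℂ) (f p))) := by
      intro p
      simp only [map_mul, Complex.conj_ofReal, Complex.conj_conj]; ring
    simp_rw [this]
    rw [integral_conj, e2, map_mul, map_mul, hflip, Complex.conj_I, Complex.conj_ofReal]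
    ring
  have hKm2 : Measurable (fun x : (ℤ × ℝ) × (ℤ × ℝ) =>
      -(wgt c s N t (x.1 - x.2) ^ 2 * tsym t x.1 x.2)) :=
    ((hW.comp (measurable_fst.sub measurable_snd)).mul (measurable_tsym t)).neg
  have hB2 : ∀ p q, |-(wgt c s N t (p - q) ^ 2 * tsym t p q)| ≤
      (1 + t) * ((1 + t) * N ^ (2 * s + 1) * N ^ 1) := fun p q => by
    rw [abs_neg]; exact abs_wgt_sq_mul_le hc hs0 hN ht (abs_tsym_le_sub t p q)
  have hsum : triC (fun p q => wgt c s N t p ^ 2 * tsym t p q) v f g +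
      triC (fun p q => -(wgt c s N t (p - q) ^ 2 * tsym t p q)) v f g =
      triC (fun p q => (wgt c s N t p ^ 2 - wgt c s N t (p - q) ^ 2) * tsym t p q) v f g := by
    unfold triC
    rw [← integral_add (integrable_triC hKm hB hv hf hg) (integrable_triC hKm2 hB2 hv hf hg)]
    congr 1; ext x
    push_cast; ring
  simp_rw [fun p => mul_add ((wgt c s N t p ^ 2 : ℝ) : ℂ)]
  rw [integral_add i1 i2', e1, e2', ← mul_add, hsum, enorm_mul]
  have hI : ‖Complex.I * (((2 * Real.pi)⁻¹ : ℝ) : ℂ)‖ₑ ≤ 1 := by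
    rw [← ofReal_norm, norm_mul, Complex.norm_I, one_mul, Complex.norm_real,
      Real.norm_of_nonneg (by positivity), ENNReal.ofReal_le_one]
    exact inv_le_one_of_one_le₀ (by linarith [Real.pi_gt_three])
  refine (mul_le_mul_left hI _).trans ?_
  rw [one_mul]
  refine enorm_triC_le (mul_nonneg (commConst_pos hc hs).le (by linarith)) (fun p q => ?_) hv hf hg
  -- W(p)² - W(p-q)² is the weight difference times W(p) + W(p-q). With W(p) the symbol is bounded
  -- by |(p-q)_t| and the commutator estimate is used with increment q; with W(p-q) it is bounded by
  -- |p_t| and the estimate is used in reverse, with increment -q.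
  have h1 := abs_wgt_sub_mul_le hc hs hN ht q (p - q)
  have h2 := abs_wgt_sub_mul_le hc hs hN ht (-q) p
  rw [add_sub_cancel] at h1
  rw [amp_neg, dec_neg_left, neg_add_eq_sub, abs_sub_comm] at h2
  have hap := (amp_pos s t p).le
  have har := (amp_pos s t (p - q)).le
  have e : (wgt c s N t p ^ 2 - wgt c s N t (p - q) ^ 2) * tsym t p q =
      wgt c s N t p * ((wgt c s N t p - wgt c s N t (p - q)) * tsym t p q) +
      wgt c s N t (p - q) * ((wgt c s N t p - wgt c s N t (p - q)) * tsym t p q) := by ring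
  have hd1 : |(wgt c s N t p - wgt c s N t (p - q)) * tsym t p q| ≤
      |wgt c s N t p - wgt c s N t (p - q)| * modL t (p - q) := by
    rw [abs_mul]; exact mul_le_mul_of_nonneg_left (abs_tsym_le_sub t p q) (abs_nonneg _)
  have hd2 : |(wgt c s N t p - wgt c s N t (p - q)) * tsym t p q| ≤
      |wgt c s N t p - wgt c s N t (p - q)| * modL t p := by
    rw [abs_mul]; exact mul_le_mul_of_nonneg_left (abs_tsym_le t p q) (abs_nonneg _)
  rw [e]
  refine (abs_add_le _ _).trans ?_
  rw [abs_mul, abs_mul (wgt c s N t (p - q)), abs_of_nonneg (wgt_nonneg c s N t p),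
    abs_of_nonneg (wgt_nonneg c s N t (p - q))]
  refine (add_le_add
    (mul_le_mul (wgt_le_amp hc hN ht s p) (hd1.trans h1) (abs_nonneg _) hap)
    (mul_le_mul (wgt_le_amp hc hN ht s (p - q)) (hd2.trans h2) (abs_nonneg _) har)).trans_eq ?_
  ring

/-! ### The pressure term -/

/-- The kernel `nv(p) × nv(r)`. -/
def crossN (t : ℝ) (p r : ℤ × ℝ) : ℝ := nv t p 1 * nv t r 0 - nv t p 0 * nv t r 1

lemma abs_crossN_le (t : ℝ) (p r : ℤ × ℝ) : |crossN t p r| ≤ 1 := by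
  refine abs_le_of_sq_le_sq ?_ zero_le_one
  have h1 := nv_sq_add_le t p
  have h2 := nv_sq_add_le t r
  have h3 : (nv t p 0 ^ 2 + nv t p 1 ^ 2) * (nv t r 0 ^ 2 + nv t r 1 ^ 2) ≤ 1 :=
    mul_le_one₀ h1 (by positivity) h2
  unfold crossN
  nlinarith [sq_nonneg (nv t p 0 * nv t r 0 + nv t p 1 * nv t r 1)]

/-- Put r = p - q. Then |p_t| |nv(p) × nv(r)| = |p_t · nv(r)| = |q_t · nv(r)| because r_t ⊥ nv(r),
which gives the bound |q_t|. The bound |r_t| comes from the symbol alone. The derivative may thus be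
put on the lower of the two frequencies, so no commutator is needed. -/
lemma abs_tsym_mul_crossN_le (t : ℝ) (p q : ℤ × ℝ) :
    |tsym t p q * crossN t p (p - q)| ≤ min (modL t q) (modL t (p - q)) := by
  rw [abs_mul]
  refine le_min ?_ ?_
  · by_cases hp : p = 0
    · subst hp
      have : tsym t 0 q = 0 := by simp [tsym, sym_zero, sym_one]
      rw [this, abs_zero, zero_mul]; exact modL_nonneg t q
    · obtain ⟨e0, e1⟩ := sym_eq hp t
      have e : modL t p * |crossN t p (p - q)| = |tsym t p (p - q)| := by
        have : tsym t p (p - q) = -(modL t p * crossN t p (p - q)) := by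
          rw [tsym, crossN, e0, e1]; ring
        rw [this, abs_neg, abs_mul, abs_of_nonneg (modL_nonneg t p)]
      have h := abs_tsym_le_sub t p (p - q)
      rw [sub_sub_cancel, ← e] at h
      exact (mul_le_mul_of_nonneg_right (abs_tsym_le t p q) (abs_nonneg _)).trans h
  · exact (mul_le_of_le_one_right (abs_nonneg _) (abs_crossN_le _ _ _)).trans
      (abs_tsym_le_sub t p q)

/-- The pressure term. -/
lemma enorm_pressure_le (hc : 0 ≤ c) (hs : 1 ≤ s) (hN : 0 < N) (ht : 0 ≤ t)
    (hv : Both v) (hg : Both g) :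
    Integrable (fun p => ((wgt c s N t p ^ 2 * nv t p 1 : ℝ) : ℂ) *
      ((nv t p 1 * adv t v (vel t v 0) p - nv t p 0 * adv t v (vel t v 1) p) *
        (starRingEnd ℂ) (g p))) freqMeasure ∧
    ‖∫ p, ((wgt c s N t p ^ 2 * nv t p 1 : ℝ) : ℂ) *
      ((nv t p 1 * adv t v (vel t v 0) p - nv t p 0 * adv t v (vel t v 1) p) *
        (starRingEnd ℂ) (g p)) ∂freqMeasure‖ₑ ≤
      ENNReal.ofReal (2 * 2 ^ s * (1 + t)) * (8 * wconst (s - 1 / 2) *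
      (en s t v * en s t v * en s t g)) := by
  have hs0 : 0 ≤ s := by linarith
  have hF : ∀ᵐ p ∂freqMeasure,
      nv t p 1 * adv t v (vel t v 0) p - nv t p 0 * adv t v (vel t v 1) p =
      Complex.I * ((2 * Real.pi)⁻¹ : ℝ) * ∫ q, ((tsym t p q * crossN t p (p - q) : ℝ) : ℂ) *
        (v q * v (p - q)) ∂freqMeasure := by
    filter_upwards [adv_eq t hv.int (hv.vel t 0).int, adv_eq t hv.int (hv.vel t 1).int,
      ae_integrable_conv hv.int (hv.vel t 0).int, ae_integrable_conv hv.int (hv.vel t 1).int]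
      with p h0 h1 i0 i1
    have ht : ∀ f : ℤ × ℝ → ℂ, Integrable (fun q => v q * f (p - q)) freqMeasure →
        Integrable (fun q => (tsym t p q : ℂ) * (v q * f (p - q))) freqMeasure := fun f hf =>
      hf.bdd_mul (c := modL t p) (Complex.measurable_ofReal.comp
        ((measurable_tsym t).comp measurable_prodMk_left)).aestronglyMeasurable
        (Eventually.of_forall fun q => by rw [Complex.norm_real]; exact abs_tsym_le t p q)
    have e : (fun q => ((tsym t p q * crossN t p (p - q) : ℝ) : ℂ) * (v q * v (p - q))) = fun q =>
        (nv t p 1 : ℂ) * ((tsym t p q : ℂ) * (v q * vel t v 0 (p - q))) -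
        (nv t p 0 : ℂ) * ((tsym t p q : ℂ) * (v q * vel t v 1 (p - q))) := by
      ext q; simp only [crossN, vel]; push_cast; ring
    rw [e, integral_sub ((ht _ i0).const_mul _) ((ht _ i1).const_mul _), integral_const_mul,
      integral_const_mul, h0, h1]
    ring
  have hKm : Measurable (fun x : (ℤ × ℝ) × (ℤ × ℝ) => tsym t x.1 x.2 * crossN t x.1 (x.1 - x.2)) := by
    have h1 := fun j => (measurable_nv t j).comp
      (measurable_fst : Measurable (Prod.fst : (ℤ × ℝ) × (ℤ × ℝ) → ℤ × ℝ))
    have h2 := fun j => (measurable_nv t j).comp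
      (measurable_fst.sub measurable_snd : Measurable fun x : (ℤ × ℝ) × (ℤ × ℝ) => x.1 - x.2)
    exact (measurable_tsym t).mul (((h1 1).mul (h2 0)).sub ((h1 0).mul (h2 1)))
  have hB : ∀ p q, |wgt c s N t p ^ 2 * nv t p 1 * (tsym t p q * crossN t p (p - q))| ≤
      (1 + t) * ((1 + t) * N ^ (2 * s + 1) * N ^ 1) := by
    intro p q
    rw [mul_assoc]
    refine abs_wgt_sq_mul_le hc hs0 hN ht ?_
    rw [abs_mul, abs_mul]
    calc _ ≤ 1 * (modL t p * 1) := by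
          gcongr
          exacts [abs_nv_le t p 1, modL_nonneg t p, abs_tsym_le t p q, abs_crossN_le t p _]
      _ = _ := by ring
  obtain ⟨i1, e1⟩ := integral_mul_triC (((measurable_wgt c s N t).pow_const 2).mul
    (measurable_nv t 1)) hKm hB hv hv hg hF
  refine ⟨i1, ?_⟩
  simp only [Pi.mul_apply] at e1
  rw [e1, enorm_mul]
  have hI : ‖Complex.I * (((2 * Real.pi)⁻¹ : ℝ) : ℂ)‖ₑ ≤ 1 := by
    rw [← ofReal_norm, norm_mul, Complex.norm_I, one_mul, Complex.norm_real,
      Real.norm_of_nonneg (by positivity), ENNReal.ofReal_le_one]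
    exact inv_le_one_of_one_le₀ (by linarith [Real.pi_gt_three])
  refine (mul_le_mul_left hI _).trans ?_
  rw [one_mul]
  refine enorm_triC_le (by positivity) (fun p q => ?_) hv hv hg
  have hap := (amp_pos s t p).le
  have h1 := amp_mul_min_le hs ht q (p - q)
  rw [add_sub_cancel] at h1
  have h2 : |wgt c s N t p ^ 2 * nv t p 1| ≤ amp s t p * amp s t p := by
    rw [abs_mul, abs_of_nonneg (sq_nonneg _), ← sq]
    exact (mul_le_of_le_one_right (sq_nonneg _) (abs_nv_le t p 1)).trans
      (pow_le_pow_left₀ (wgt_nonneg _ _ _ _ _) (wgt_le_amp hc hN ht s p) 2)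
  have hD := dec_nonneg (s - 1 / 2) t q p
  rw [abs_mul]
  calc _ ≤ amp s t p * amp s t p * min (modL t q) (modL t (p - q)) :=
        mul_le_mul h2 (abs_tsym_mul_crossN_le t p q) (abs_nonneg _) (by positivity)
    _ = amp s t p * (amp s t p * min (modL t q) (modL t (p - q))) := by ring
    _ ≤ amp s t p * (2 * 2 ^ s * ((1 + t) * (amp s t q * amp s t (p - q) *
        dec (s - 1 / 2) t q (p - q)))) := by gcongr
    _ = 2 * 2 ^ s * (1 + t) * (amp s t p * (amp s t q * amp s t (p - q)) *
        dec (s - 1 / 2) t q (p - q)) := by ring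
    _ ≤ _ := by
        have := (amp_pos s t q).le
        have := (amp_pos s t (p - q)).le
        gcongr
        linarith

end Transport


/-! ### Multipliers, convolutions and continuity in time -/

lemma wnorm_mul_le_of_le {σ a c : ℝ} {m f : ℤ × ℝ → ℂ}
    (hm : ∀ᵐ p ∂freqMeasure, ‖m p‖ ≤ c * jb 0 p ^ a) :
    wnorm (σ - a) (fun p => m p * f p) ≤ ENNReal.ofReal c * wnorm σ f := by
  refine eLpNorm_le_mul_eLpNorm_of_ae_le_mul ?_ 2
  filter_upwards [hm] with p hp
  have h0 := jb_pos 0 p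
  have h1 := Real.rpow_nonneg h0.le
  rw [norm_mul, norm_mul, norm_mul, Complex.norm_real, Complex.norm_real,
    Real.norm_of_nonneg (h1 _), Real.norm_of_nonneg (h1 _)]
  calc _ ≤ jb 0 p ^ (σ - a) * (c * jb 0 p ^ a * ‖f p‖) :=
        mul_le_mul_of_nonneg_left (mul_le_mul_of_nonneg_right hp (norm_nonneg _)) (h1 _)
    _ = c * (jb 0 p ^ (σ - a) * jb 0 p ^ a * ‖f p‖) := by ring
    _ = _ := by rw [← Real.rpow_add h0, sub_add_cancel]

lemma wnorm_mono {σ σ' : ℝ} (h : σ' ≤ σ) (f : ℤ × ℝ → ℂ) : wnorm σ' f ≤ wnorm σ f := by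
  refine eLpNorm_mono fun p => ?_
  have h0 := Real.rpow_nonneg (jb_pos 0 p).le
  rw [norm_mul, norm_mul, Complex.norm_real, Complex.norm_real, Real.norm_of_nonneg (h0 _),
    Real.norm_of_nonneg (h0 _)]
  exact mul_le_mul_of_nonneg_right (Real.rpow_le_rpow_of_exponent_le (one_le_jb 0 p) h)
    (norm_nonneg _)

lemma wnorm_neg (σ : ℝ) (f : ℤ × ℝ → ℂ) : wnorm σ (fun p => -f p) = wnorm σ f := by
  unfold wnorm
  rw [← eLpNorm_neg]; congr 1; ext p; simp

/-- A family of real multipliers of order `a` that is Lipschitz in time on `[0, T]`. -/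
structure IsMult (T a : ℝ) (m : ℝ → ℤ × ℝ → ℝ) : Prop where
  meas : ∀ t, Measurable (m t)
  bound : ∃ C, 0 ≤ C ∧ ∀ t ∈ Icc 0 T, ∀ p, p ≠ 0 → |m t p| ≤ C * jb 0 p ^ a
  lip : ∃ C, 0 ≤ C ∧ ∀ t ∈ Icc 0 T, ∀ τ ∈ Icc 0 T, ∀ p, p ≠ 0 →
    |m τ p - m t p| ≤ C * |τ - t| * jb 0 p ^ a

lemma IsMult.const (T c : ℝ) : IsMult T 0 (fun _ _ => c) :=
  ⟨fun _ => measurable_const, ⟨|c|, abs_nonneg _, fun _ _ _ _ => by simp⟩,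
    ⟨0, le_rfl, fun _ _ _ _ _ _ => by simp⟩⟩

lemma IsMult.add {T a : ℝ} {m n : ℝ → ℤ × ℝ → ℝ} (hm : IsMult T a m) (hn : IsMult T a n) :
    IsMult T a (fun t p => m t p + n t p) := by
  obtain ⟨C, hC0, hC⟩ := hm.bound
  obtain ⟨D, hD0, hD⟩ := hn.bound
  obtain ⟨C', hC0', hC'⟩ := hm.lip
  obtain ⟨D', hD0', hD'⟩ := hn.lip
  refine ⟨fun t => (hm.meas t).add (hn.meas t), ⟨C + D, by positivity, fun t ht p hp => ?_⟩,
    ⟨C' + D', by positivity, fun t ht τ hτ p hp => ?_⟩⟩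
  · rw [add_mul]
    exact (abs_add_le _ _).trans (add_le_add (hC t ht p hp) (hD t ht p hp))
  · rw [add_sub_add_comm, add_mul, add_mul]
    exact (abs_add_le _ _).trans (add_le_add (hC' t ht τ hτ p hp) (hD' t ht τ hτ p hp))

lemma IsMult.mul {T a b : ℝ} {m n : ℝ → ℤ × ℝ → ℝ} (hm : IsMult T a m) (hn : IsMult T b n) :
    IsMult T (a + b) (fun t p => m t p * n t p) := by
  obtain ⟨C, hC0, hC⟩ := hm.bound
  obtain ⟨D, hD0, hD⟩ := hn.bound
  obtain ⟨C', hC0', hC'⟩ := hm.lip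
  obtain ⟨D', hD0', hD'⟩ := hn.lip
  have hj := fun (p : ℤ × ℝ) (a : ℝ) => Real.rpow_nonneg (jb_pos 0 p).le a
  refine ⟨fun t => (hm.meas t).mul (hn.meas t), ⟨C * D, by positivity, fun t ht p hp => ?_⟩,
    ⟨C' * D + C * D', by positivity, fun t ht τ hτ p hp => ?_⟩⟩
  · rw [abs_mul, Real.rpow_add (jb_pos 0 p)]
    refine (mul_le_mul (hC t ht p hp) (hD t ht p hp) (abs_nonneg _)
      (mul_nonneg hC0 (hj p a))).trans_eq (by ring)
  · have e : m τ p * n τ p - m t p * n t p =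
        (m τ p - m t p) * n τ p + m t p * (n τ p - n t p) := by ring
    rw [e, Real.rpow_add (jb_pos 0 p)]
    refine (abs_add_le _ _).trans ?_
    rw [abs_mul, abs_mul]
    refine (add_le_add (mul_le_mul (hC' t ht τ hτ p hp) (hD τ hτ p hp) (abs_nonneg _)
      (mul_nonneg (mul_nonneg hC0' (abs_nonneg _)) (hj p a)))
      (mul_le_mul (hC t ht p hp) (hD' t ht τ hτ p hp) (abs_nonneg _)
      (mul_nonneg hC0 (hj p a)))).trans_eq (by ring)

lemma IsMult.mono {T a b : ℝ} {m : ℝ → ℤ × ℝ → ℝ} (hm : IsMult T a m) (h : a ≤ b) :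
    IsMult T b m := by
  obtain ⟨C, hC0, hC⟩ := hm.bound
  obtain ⟨C', hC0', hC'⟩ := hm.lip
  have hj := fun (p : ℤ × ℝ) => Real.rpow_le_rpow_of_exponent_le (one_le_jb 0 p) h
  exact ⟨hm.meas, ⟨C, hC0, fun t ht p hp => (hC t ht p hp).trans
      (mul_le_mul_of_nonneg_left (hj p) hC0)⟩,
    ⟨C', hC0', fun t ht τ hτ p hp => (hC' t ht τ hτ p hp).trans
      (mul_le_mul_of_nonneg_left (hj p) (mul_nonneg hC0' (abs_nonneg _)))⟩⟩

lemma isMult_nv (T : ℝ) (j : Fin 2) : IsMult T 0 (fun t p => nv t p j) :=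
  ⟨fun t => measurable_nv t j, ⟨1, zero_le_one, fun t _ p _ => by simpa using abs_nv_le t p j⟩,
    ⟨1, zero_le_one, fun t _ τ _ p hp => by simpa using abs_nv_sub_le hp t τ j⟩⟩

lemma isMult_sym {T : ℝ} (hT : 0 ≤ T) (j : Fin 2) : IsMult T 1 (fun t p => sym t p j) := by
  have hk : ∀ p : ℤ × ℝ, |(p.1 : ℝ)| ≤ jb 0 p := fun p =>
    (abs_sym_le 0 p 0).trans (modL_le_jb 0 p)
  refine ⟨fun t => measurable_sym t j, ⟨1 + T, by positivity, fun t ht p _ => ?_⟩,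
    ⟨1, zero_le_one, fun t _ τ _ p _ => ?_⟩⟩
  · rw [Real.rpow_one]
    refine (abs_sym_le t p j).trans ((modL_le_mul ht.1 p).trans ?_)
    exact mul_le_mul (by linarith [ht.2]) (modL_le_jb 0 p) (modL_nonneg _ _) (by linarith)
  · rw [Real.rpow_one, one_mul]
    fin_cases j
    · simp only [Fin.zero_eta, sym_zero, sub_self, abs_zero]
      exact mul_nonneg (abs_nonneg _) (jb_pos _ _).le
    · simp only [Fin.mk_one, sym_one]
      have : p.2 - p.1 * τ - (p.2 - p.1 * t) = -((τ - t) * p.1) := by ring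
      rw [this, abs_neg, abs_mul]
      exact mul_le_mul_of_nonneg_left (hk p) (abs_nonneg _)

lemma isMult_modL_sq {T : ℝ} (hT : 0 ≤ T) : IsMult T 2 (fun t p => modL t p ^ 2) := by
  have h := ((isMult_sym hT 0).mul (isMult_sym hT 0)).add ((isMult_sym hT 1).mul (isMult_sym hT 1))
  have e : (fun t p => modL t p ^ 2) =
      fun t p => sym t p 0 * sym t p 0 + sym t p 1 * sym t p 1 := by
    ext t p; rw [modL_sq, sym_zero, sym_one]; ring
  rw [e]
  norm_num at h
  exact h

/-- A family of functions on `[0, T]` that is continuous in the weighted `L²` norm of order `σ`. -/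
structure ContL (σ T : ℝ) (f : ℝ → ℤ × ℝ → ℂ) : Prop where
  meas : ∀ t ∈ Icc 0 T, AEStronglyMeasurable (f t) freqMeasure
  fin : ∀ t ∈ Icc 0 T, wnorm σ (f t) < ⊤
  tend : ∀ t ∈ Icc 0 T, Tendsto (fun τ => wnorm σ (fun p => f τ p - f t p)) (𝓝[Icc 0 T] t) (𝓝 0)

lemma ContL.mono {σ σ' T : ℝ} {f : ℝ → ℤ × ℝ → ℂ} (hf : ContL σ T f) (h : σ' ≤ σ) :
    ContL σ' T f :=
  ⟨hf.meas, fun t ht => (wnorm_mono h _).trans_lt (hf.fin t ht), fun t ht =>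
    tendsto_of_tendsto_of_tendsto_of_le_of_le tendsto_const_nhds (hf.tend t ht)
      (fun _ => zero_le) fun _ => wnorm_mono h _⟩

lemma ContL.add {σ T : ℝ} {f g : ℝ → ℤ × ℝ → ℂ} (hf : ContL σ T f) (hg : ContL σ T g) :
    ContL σ T (fun t p => f t p + g t p) := by
  refine ⟨fun t ht => (hf.meas t ht).add (hg.meas t ht), fun t ht =>
    (wnorm_add_le (hf.meas t ht) (hg.meas t ht)).trans_lt
      (ENNReal.add_lt_top.2 ⟨hf.fin t ht, hg.fin t ht⟩), fun t ht => ?_⟩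
  have h := (hf.tend t ht).add (hg.tend t ht)
  rw [add_zero] at h
  refine tendsto_of_tendsto_of_tendsto_of_le_of_le' tendsto_const_nhds h
    (Eventually.of_forall fun _ => zero_le) ?_
  filter_upwards [self_mem_nhdsWithin] with τ hτ
  refine le_of_eq_of_le ?_ (wnorm_add_le ((hf.meas τ hτ).fun_sub (hf.meas t ht))
    ((hg.meas τ hτ).fun_sub (hg.meas t ht)))
  congr 1; ext p; ring

lemma ContL.neg {σ T : ℝ} {f : ℝ → ℤ × ℝ → ℂ} (hf : ContL σ T f) :
    ContL σ T (fun t p => -f t p) := by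
  refine ⟨fun t ht => (hf.meas t ht).neg, fun t ht => by
    rw [wnorm_neg]; exact hf.fin t ht, fun t ht => (hf.tend t ht).congr fun τ => ?_⟩
  rw [← wnorm_neg]; congr 1; ext p; ring

lemma ContL.mult {σ a T : ℝ} {f : ℝ → ℤ × ℝ → ℂ} {m : ℝ → ℤ × ℝ → ℝ} (hm : IsMult T a m)
    (hf : ContL σ T f) : ContL (σ - a) T (fun t p => (m t p : ℂ) * f t p) := by
  obtain ⟨C, hC0, hC⟩ := hm.bound
  obtain ⟨D, hD0, hD⟩ := hm.lip
  have hb : ∀ t ∈ Icc 0 T, ∀ᵐ p ∂freqMeasure, ‖(m t p : ℂ)‖ ≤ C * jb 0 p ^ a := fun t ht => by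
    filter_upwards [ae_ne_zero] with p hp
    rw [Complex.norm_real]; exact hC t ht p hp
  have hM : ∀ t, AEStronglyMeasurable (fun p => (m t p : ℂ)) freqMeasure := fun t =>
    (Complex.measurable_ofReal.comp (hm.meas t)).aestronglyMeasurable
  refine ⟨fun t ht => (hM t).mul (hf.meas t ht), fun t ht =>
    (wnorm_mul_le_of_le (hb t ht)).trans_lt (ENNReal.mul_lt_top ENNReal.ofReal_lt_top (hf.fin t ht)),
    fun t ht => ?_⟩
  have h1 : Tendsto (fun τ : ℝ => ENNReal.ofReal (D * |τ - t|)) (𝓝[Icc 0 T] t) (𝓝 0) := by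
    have : Continuous (fun τ : ℝ => ENNReal.ofReal (D * |τ - t|)) :=
      ENNReal.continuous_ofReal.comp (by fun_prop)
    have := this.tendsto t
    simp only [sub_self, abs_zero, mul_zero, ENNReal.ofReal_zero] at this
    exact this.mono_left nhdsWithin_le_nhds
  have h2 := ENNReal.Tendsto.mul_const h1 (Or.inr (hf.fin t ht).ne)
  have h3 := ENNReal.Tendsto.const_mul (hf.tend t ht)
    (Or.inr (ENNReal.ofReal_ne_top : ENNReal.ofReal C ≠ ⊤))
  have h := h3.add h2
  rw [mul_zero, zero_mul, add_zero] at h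
  refine tendsto_of_tendsto_of_tendsto_of_le_of_le' tendsto_const_nhds h
    (Eventually.of_forall fun _ => zero_le) ?_
  filter_upwards [self_mem_nhdsWithin] with τ hτ
  have hd : ∀ᵐ p ∂freqMeasure, ‖(m τ p - m t p : ℂ)‖ ≤ D * |τ - t| * jb 0 p ^ a := by
    filter_upwards [ae_ne_zero] with p hp
    rw [← Complex.ofReal_sub, Complex.norm_real]; exact hD t ht τ hτ p hp
  refine le_trans ?_ (add_le_add
    (wnorm_mul_le_of_le (σ := σ) (f := fun p => f τ p - f t p) (hb τ hτ))
    (wnorm_mul_le_of_le (σ := σ) (f := f t) hd))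
  refine le_of_eq_of_le ?_ (wnorm_add_le ((hM τ).mul ((hf.meas τ hτ).fun_sub (hf.meas t ht)))
    (((hM τ).fun_sub (hM t)).mul (hf.meas t ht)))
  congr 1; ext p; ring

/-- Young's inequality for L¹ and L²: Cauchy-Schwarz in q with respect to the measure with density
F, followed by Fubini and translation invariance. -/
lemma lintegral_conv_sq_le {F G : ℤ × ℝ → ℝ≥0∞} (hF : AEMeasurable F freqMeasure)
    (hG : AEMeasurable G freqMeasure) :
    ltwo (fun p => ∫⁻ q, F q * G (p - q) ∂freqMeasure) ≤ (∫⁻ q, F q ∂freqMeasure) * ltwo G := by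
  have hFG : AEMeasurable (fun x : (ℤ × ℝ) × (ℤ × ℝ) => F x.2 * G (x.1 - x.2) ^ 2)
      (freqMeasure.prod freqMeasure) := hF.comp_snd.mul ((aemeasurable_comp_sub hG).pow_const 2)
  have hr : ∀ x : ℝ≥0∞, x ^ (1 / 2 : ℝ) * x ^ (1 / 2 : ℝ) = x := fun x => by
    rw [← ENNReal.rpow_add_of_nonneg _ _ (by norm_num) (by norm_num)]; norm_num
  have hsq : ∀ x : ℝ≥0∞, (x ^ (1 / 2 : ℝ)) ^ 2 = x := fun x => by rw [sq, hr]
  have key : ∀ p, (∫⁻ q, F q * G (p - q) ∂freqMeasure) ^ 2 ≤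
      (∫⁻ q, F q ∂freqMeasure) * ∫⁻ q, F q * G (p - q) ^ 2 ∂freqMeasure := by
    intro p
    have hGp := aemeasurable_comp_sub_left hG p
    have hF2 : AEMeasurable (fun q => F q ^ (1 / 2 : ℝ)) freqMeasure := hF.pow_const _
    have hFG2 : AEMeasurable (fun q => F q ^ (1 / 2 : ℝ) * G (p - q)) freqMeasure := hF2.mul hGp
    have h := lintegral_mul_le_ltwo hF2 hFG2
    simp only [← mul_assoc, hr] at h
    refine (pow_le_pow_left₀ zero_le h 2).trans_eq ?_
    rw [mul_pow, ltwo, ltwo, hsq, hsq]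
    simp only [mul_pow, hsq]
  have hint : ∫⁻ p, (∫⁻ q, F q * G (p - q) ∂freqMeasure) ^ 2 ∂freqMeasure ≤
      (∫⁻ q, F q ∂freqMeasure) * ((∫⁻ q, F q ∂freqMeasure) * ∫⁻ q, G q ^ 2 ∂freqMeasure) := by
    refine (lintegral_mono key).trans_eq ?_
    rw [lintegral_const_mul'' _ hFG.lintegral_prod_right', lintegral_lintegral_swap hFG]
    congr 1
    rw [← lintegral_mul_const'' _ hF]
    refine lintegral_congr fun q => ?_
    dsimp only
    rw [lintegral_const_mul'' _ ((aemeasurable_comp_sub_right hG q).pow_const 2),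
      lintegral_sub_right_eq_self (fun q => G q ^ 2)]
  rw [ltwo]
  refine (ENNReal.rpow_le_rpow hint (by norm_num)).trans_eq ?_
  rw [ENNReal.mul_rpow_of_nonneg _ _ (by norm_num), ENNReal.mul_rpow_of_nonneg _ _ (by norm_num),
    ← mul_assoc, hr, ltwo]

lemma wnorm_zero_eq (f : ℤ × ℝ → ℂ) : wnorm 0 f = eLpNorm f 2 freqMeasure := by
  unfold wnorm; simp

lemma wnorm_conv_le {σ : ℝ} (hσ : 0 ≤ σ) {f g : ℤ × ℝ → ℂ}
    (hf : AEStronglyMeasurable f freqMeasure) (hg : AEStronglyMeasurable g freqMeasure) :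
    wnorm 0 (conv f g) ≤ wconst σ * wnorm σ f * wnorm σ g := by
  have h := lintegral_conv_sq_le hf.enorm hg.enorm
  rw [ltwo_enorm, ← eLpNorm_one_eq_lintegral_enorm] at h
  refine le_trans ?_ (h.trans (mul_le_mul' (eLpNorm_one_le_wnorm σ hf) (eLpNorm_two_le_wnorm hσ g)))
  rw [wnorm_zero_eq, eLpNorm_two_eq, ltwo]
  gcongr with p
  rw [conv, enorm_mul]
  have hI : ‖(((2 * Real.pi)⁻¹ : ℝ) : ℂ)‖ₑ ≤ 1 := by
    rw [← ofReal_norm, Complex.norm_real, Real.norm_of_nonneg (by positivity),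
      ENNReal.ofReal_le_one]
    exact inv_le_one_of_one_le₀ (by linarith [Real.pi_gt_three])
  calc _ ≤ 1 * ‖∫ q, f q * g (p - q) ∂freqMeasure‖ₑ := by gcongr
    _ ≤ _ := by
        rw [one_mul]
        refine (enorm_integral_le_lintegral_enorm _).trans_eq ?_
        simp only [enorm_mul]

lemma conv_sub_conv {f f' g g' : ℤ × ℝ → ℂ} (hf : Integrable f freqMeasure)
    (hg : Integrable g freqMeasure) (hf' : Integrable f' freqMeasure)
    (hg' : Integrable g' freqMeasure) :
    ∀ᵐ p ∂freqMeasure, conv f g p - conv f' g' p =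
      conv (fun q => f q - f' q) g p + conv f' (fun q => g q - g' q) p := by
  filter_upwards [ae_integrable_conv hf hg, ae_integrable_conv hf' hg',
    ae_integrable_conv hf' hg] with p h1 h2 h3
  simp only [conv, sub_mul, mul_sub]
  rw [integral_sub h1 h3, integral_sub h3 h2]; ring

/-- Order σ > 1 embeds in both L¹ and L², so convolution is a continuous bilinear map into L²; the
increment in time is split bilinearly. -/
lemma ContL.conv {σ T : ℝ} (hσ : 1 < σ) {f g : ℝ → ℤ × ℝ → ℂ} (hf : ContL σ T f)
    (hg : ContL σ T g) : ContL 0 T (fun t => conv (f t) (g t)) := by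
  have hσ0 : 0 ≤ σ := by linarith
  have fi := fun t ht => integrable_of_wnorm hσ (hf.meas t ht) (hf.fin t ht)
  have gi := fun t ht => integrable_of_wnorm hσ (hg.meas t ht) (hg.fin t ht)
  have hw := wconst_lt_top hσ
  refine ⟨fun t ht => (integrable_conv (fi t ht) (gi t ht)).aestronglyMeasurable, fun t ht =>
    (wnorm_conv_le hσ0 (hf.meas t ht) (hg.meas t ht)).trans_lt
      (ENNReal.mul_lt_top (ENNReal.mul_lt_top hw (hf.fin t ht)) (hg.fin t ht)), fun t ht => ?_⟩
  have h1 := ENNReal.Tendsto.const_mul (hf.tend t ht) (Or.inr hw.ne)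
  have h2 := (hg.tend t ht).add_const (wnorm σ (g t))
  have h3 := ENNReal.Tendsto.mul h1 (Or.inr (by simpa using (hg.fin t ht).ne)) h2
    (Or.inr (by simp))
  have h4 := ENNReal.Tendsto.const_mul (hg.tend t ht)
    (Or.inr (ENNReal.mul_lt_top hw (hf.fin t ht)).ne)
  have h := h3.add h4
  simp only [mul_zero, zero_mul, add_zero] at h
  refine tendsto_of_tendsto_of_tendsto_of_le_of_le' tendsto_const_nhds h
    (Eventually.of_forall fun _ => zero_le) ?_
  filter_upwards [self_mem_nhdsWithin] with τ hτ
  have hfs := (hf.meas τ hτ).fun_sub (hf.meas t ht)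
  have hgs := (hg.meas τ hτ).fun_sub (hg.meas t ht)
  rw [wnorm_congr (conv_sub_conv (fi τ hτ) (gi τ hτ) (fi t ht) (gi t ht))]
  have a1 : Integrable (fun q => f τ q - f t q) freqMeasure := (fi τ hτ).sub (fi t ht)
  have a2 : Integrable (fun q => g τ q - g t q) freqMeasure := (gi τ hτ).sub (gi t ht)
  refine (wnorm_add_le (integrable_conv a1 (gi τ hτ)).aestronglyMeasurable
    (integrable_conv (fi t ht) a2).aestronglyMeasurable).trans ?_
  refine add_le_add ((wnorm_conv_le hσ0 hfs (hg.meas τ hτ)).trans ?_)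
    (wnorm_conv_le hσ0 (hf.meas t ht) hgs)
  refine mul_le_mul_right ?_ _
  refine le_of_eq_of_le ?_ (wnorm_add_le hgs (hg.meas t ht))
  congr 1; ext p; ring


/-! ### From weak to strong time derivatives -/

open Classical in
/-- The element of `L²` given by `⟨p⟩^σ f`. -/
def lp (σ : ℝ) (f : ℤ × ℝ → ℂ) : Lp ℂ 2 freqMeasure :=
  if h : MemLp (fun p => ((jb 0 p ^ σ : ℝ) : ℂ) * f p) 2 freqMeasure then h.toLp else 0

lemma memLp_of_wnorm {σ : ℝ} {f : ℤ × ℝ → ℂ} (hf : AEStronglyMeasurable f freqMeasure)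
    (h : wnorm σ f < ⊤) : MemLp (fun p => ((jb 0 p ^ σ : ℝ) : ℂ) * f p) 2 freqMeasure :=
  ⟨aestronglyMeasurable_jb_mul hf σ 0, h⟩

lemma coeFn_lp {σ : ℝ} {f : ℤ × ℝ → ℂ} (hf : AEStronglyMeasurable f freqMeasure)
    (h : wnorm σ f < ⊤) : lp σ f =ᵐ[freqMeasure] fun p => ((jb 0 p ^ σ : ℝ) : ℂ) * f p := by
  rw [lp, dif_pos (memLp_of_wnorm hf h)]
  exact (memLp_of_wnorm hf h).coeFn_toLp

lemma ContL.continuousOn_lp {σ T : ℝ} {f : ℝ → ℤ × ℝ → ℂ} (hf : ContL σ T f) :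
    ContinuousOn (fun t => lp σ (f t)) (Icc 0 T) := by
  intro t ht
  rw [ContinuousWithinAt, tendsto_iff_edist_tendsto_0]
  refine (hf.tend t ht).congr' ?_
  filter_upwards [self_mem_nhdsWithin] with τ hτ
  have h1 := memLp_of_wnorm (hf.meas τ hτ) (hf.fin τ hτ)
  have h2 := memLp_of_wnorm (hf.meas t ht) (hf.fin t ht)
  rw [lp, lp, dif_pos h1, dif_pos h2, Lp.edist_toLp_toLp, wnorm]
  congr 1; ext p; simp only [Pi.sub_apply]; ring

lemma IsBump.memLp_single {h : ℝ → ℂ} (hh : IsBump h) (k : ℤ) :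
    MemLp (single k h) 2 freqMeasure := by
  refine ⟨(hh.measurable_single k).aestronglyMeasurable, ?_⟩
  have hi : MemLp h 2 volume := hh.smooth.continuous.memLp_of_hasCompactSupport hh.compact
  rw [eLpNorm_two_eq]
  refine ENNReal.rpow_lt_top_of_nonneg (by norm_num) ?_
  have e : ∀ p : ℤ × ℝ, ‖single k h p‖ₑ ^ 2 = (({k} : Set ℤ).indicator 1 p.1) * ‖h p.2‖ₑ ^ 2 := by
    intro p
    by_cases hp : p.1 = k <;> simp [single, hp]
  simp_rw [e]
  have hm : Measurable fun ξ => ‖h ξ‖ₑ ^ 2 := by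
    have := hh.smooth.continuous.measurable; fun_prop
  unfold freqMeasure
  rw [lintegral_prod_mul (f := ({k} : Set ℤ).indicator (1 : ℤ → ℝ≥0∞))
    (measurable_one.indicator (measurableSet_singleton k)).aemeasurable hm.aemeasurable,
    lintegral_indicator_one (measurableSet_singleton k), Measure.count_singleton, one_mul]
  have := hi.2
  rw [eLpNorm_lt_top_iff_lintegral_rpow_enorm_lt_top (by norm_num) (by norm_num)] at this
  simpa using this.ne

/-- Pairing with `single k h` as a functional on `L²`. -/
def pairL {h : ℝ → ℂ} (hh : IsBump h) (k : ℤ) : Lp ℂ 2 freqMeasure →L[ℂ] ℂ :=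
  innerSL ℂ ((hh.memLp_single k).star.toLp)

lemma pairL_apply {h : ℝ → ℂ} (hh : IsBump h) (k : ℤ) (Y : Lp ℂ 2 freqMeasure) :
    pairL hh k Y = ∫ p, Y p * single k h p ∂freqMeasure := by
  rw [pairL, innerSL_apply_apply, L2.inner_def]
  refine integral_congr_ae ?_
  filter_upwards [(hh.memLp_single k).star.coeFn_toLp] with p hp
  rw [hp]
  simp

lemma integrable_lp_mul_single (Y : Lp ℂ 2 freqMeasure) {h : ℝ → ℂ} (hh : IsBump h) (k : ℤ) :
    Integrable (fun p => Y p * single k h p) freqMeasure :=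
  MemLp.integrable_mul (Lp.memLp Y) (hh.memLp_single k)

/-- Bumps detect functions that are locally integrable on almost no assumption; here integrability
on each line is obtained by multiplying with the square integrable ⟨p⟩^{-2} and then undoing this
continuous factor. -/
lemma lp_eq_zero_of_pairL (Y : Lp ℂ 2 freqMeasure)
    (hY : ∀ k h (hh : IsBumpAt k h), pairL hh.toIsBump k Y = 0) : Y = 0 := by
  rw [Lp.eq_zero_iff_ae_eq_zero]
  refine ae_eq_zero_of_integral_bump (fun k => ?_) fun k h hh => ?_
  · have hm : Measurable fun p : ℤ × ℝ => ((jb 0 p ^ (-2 : ℝ) : ℝ) : ℂ) := by fun_prop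
    have h2 : MemLp (fun p : ℤ × ℝ => ((jb 0 p ^ (-2 : ℝ) : ℝ) : ℂ)) 2 freqMeasure :=
      ⟨hm.aestronglyMeasurable, eLpNorm_jb_rpow_lt_top (by norm_num) 0⟩
    have hi := (integrable_slice (MemLp.integrable_mul (Lp.memLp Y) h2) k).locallyIntegrable
    have hc : Continuous fun ξ : ℝ => ((1 + (k : ℝ) ^ 2 + ξ ^ 2 : ℝ) : ℂ) :=
      Complex.continuous_ofReal.comp (by fun_prop)
    have := (hi.locallyIntegrableOn univ).continuousOn_mul hc.continuousOn
      isOpen_univ.isLocallyClosed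
    rw [locallyIntegrableOn_univ] at this
    refine this.congr (Eventually.of_forall fun ξ => ?_)
    have e : (1 + (k : ℝ) ^ 2 + ξ ^ 2) * jb 0 (k, ξ) ^ (-2 : ℝ) = 1 := by
      have := jb_sq 0 (k, ξ)
      simp only [mul_zero, sub_zero] at this
      rw [← this, Real.rpow_neg (jb_pos _ _).le, Real.rpow_two]
      exact mul_inv_cancel₀ (pow_pos (jb_pos _ _) 2).ne'
    simp only [Pi.mul_apply]
    rw [mul_left_comm, ← Complex.ofReal_mul, e]; simp
  · have := hY k h hh
    rw [pairL_apply] at this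
    rwa [← integral_mul_single _ _ _ (integrable_lp_mul_single Y hh.toIsBump k)]

/-- A weak time derivative that is continuous in `L²` is a strong one. -/
lemma hasDerivWithinAt_of_pairL {T : ℝ} (hT : 0 ≤ T) {Y R : ℝ → Lp ℂ 2 freqMeasure}
    (hR : ContinuousOn R (Icc 0 T))
    (hw : ∀ t ∈ Icc 0 T, ∀ k h (hh : IsBumpAt k h), HasDerivWithinAt
      (fun τ => pairL hh.toIsBump k (Y τ)) (pairL hh.toIsBump k (R t)) (Icc 0 T) t) :
    ∀ t ∈ Icc 0 T, HasDerivWithinAt Y (R t) (Icc 0 T) t := by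
  set R' := IccExtend hT ((Icc 0 T).domRestrict R) with hR'
  have hRc : Continuous R' := (continuousOn_iff_continuous_domRestrict.1 hR).Icc_extend'
  have hRe : ∀ t ∈ Icc 0 T, R' t = R t := fun t ht => IccExtend_of_mem hT _ ht
  -- The candidate is the primitive of the continuous right-hand side. Its pairings with bumps have
  -- the same derivatives and the same initial values as those of Y, so the two curves coincide and
  -- Y inherits the strong derivative.
  set Z := fun t => Y 0 + ∫ τ in (0 : ℝ)..t, R' τ with hZ
  have hZd : ∀ t, HasDerivAt Z (R' t) t := fun t =>
    (hRc.integral_hasStrictDerivAt 0 t).hasDerivAt.const_add (Y 0)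
  have hYZ : ∀ t ∈ Icc 0 T, Y t = Z t := by
    intro t ht
    rw [← sub_eq_zero]
    refine lp_eq_zero_of_pairL _ fun k h hh => ?_
    have hd : ∀ t ∈ Icc 0 T, HasDerivWithinAt (fun τ => pairL hh.toIsBump k (Y τ - Z τ)) 0
        (Icc 0 T) t := by
      intro t ht
      have h2 := ((pairL hh.toIsBump k).restrictScalars ℝ).hasFDerivAt.comp_hasDerivAt t (hZd t)
      have h3 := (hw t ht k h hh).sub h2.hasDerivWithinAt
      rw [hRe t ht] at h3
      refine (h3.congr_deriv (sub_self _)).congr (fun τ _ => ?_) ?_ <;>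
      · rw [map_sub]; rfl
    have hc := constant_of_has_deriv_right_zero (f := fun τ => pairL hh.toIsBump k (Y τ - Z τ))
      (fun t ht => (hd t ht).continuousWithinAt)
      (fun t ht => (hd t (Ico_subset_Icc_self ht)).mono_of_mem_nhdsWithin
        (Icc_mem_nhdsGE_of_mem ht)) t ht
    rw [hc, hZ]
    simp
  intro t ht
  have := (hZd t).hasDerivWithinAt (s := Icc 0 T)
  rw [hRe t ht] at this
  exact this.congr hYZ (hYZ t ht)

lemma IsBumpAt.div_jb {k : ℤ} {h : ℝ → ℂ} (hh : IsBumpAt k h) :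
    IsBumpAt k (fun ξ => ((jb 0 (k, ξ) ^ (-2 : ℝ) : ℝ) : ℂ) * h ξ) := by
  have e : (fun ξ : ℝ => jb 0 (k, ξ) ^ (-2 : ℝ)) = fun ξ => (1 + (k : ℝ) ^ 2 + ξ ^ 2)⁻¹ := by
    ext ξ
    have := jb_sq 0 (k, ξ)
    simp only [mul_zero, sub_zero] at this
    rw [← this, Real.rpow_neg (jb_pos _ _).le, Real.rpow_two]
  have hc : ContDiff ℝ ∞ (fun ξ : ℝ => ((jb 0 (k, ξ) ^ (-2 : ℝ) : ℝ) : ℂ)) := by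
    have : ContDiff ℝ ∞ (fun ξ : ℝ => jb 0 (k, ξ) ^ (-2 : ℝ)) := by
      rw [e]
      exact ContDiff.inv (by fun_prop) fun ξ => by positivity
    exact Complex.ofRealCLM.contDiff.comp this
  exact ⟨hh.toIsBump.mul_left hc, fun hk h0 => hh.off_zero hk (tsupport_mul_subset_right h0)⟩

/-- The viscous terms cost two orders and transport one, so -2 is a common order at which the
right-hand sides are continuous in time. The weight is moved onto the bump, which remains a bump. -/
lemma ContL.hasDerivWithinAt_lp {T : ℝ} (hT : 0 ≤ T) {f R : ℝ → ℤ × ℝ → ℂ} (hf : ContL (-2) T f)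
    (hR : ContL (-2) T R) (hw : ∀ t ∈ Icc 0 T, ∀ k h, IsBumpAt k h →
      HasDerivWithinAt (fun τ => ∫ p, f τ p * single k h p ∂freqMeasure)
        (∫ p, R t p * single k h p ∂freqMeasure) (Icc 0 T) t) :
    ∀ t ∈ Icc 0 T, HasDerivWithinAt (fun τ => lp (-2) (f τ)) (lp (-2) (R t)) (Icc 0 T) t := by
  refine hasDerivWithinAt_of_pairL hT hR.continuousOn_lp fun t ht k h hh => ?_
  have e : ∀ {g : ℤ × ℝ → ℂ}, AEStronglyMeasurable g freqMeasure → wnorm (-2) g < ⊤ →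
      pairL hh.toIsBump k (lp (-2) g) = ∫ p, g p *
        single k (fun ξ => ((jb 0 (k, ξ) ^ (-2 : ℝ) : ℝ) : ℂ) * h ξ) p ∂freqMeasure := by
    intro g h1 h2
    rw [pairL_apply]
    refine integral_congr_ae ?_
    filter_upwards [coeFn_lp h1 h2] with p hp
    rw [hp, single_mul k (fun p => ((jb 0 p ^ (-2 : ℝ) : ℝ) : ℂ))]; ring
  rw [e (hR.meas t ht) (hR.fin t ht)]
  exact (hw t ht k _ hh.div_jb).congr (fun τ hτ => e (hf.meas τ hτ) (hf.fin τ hτ))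
    (e (hf.meas t ht) (hf.fin t ht))


/-! ### Differentiation of weighted quadratic forms -/

/-- The sesquilinear form on `L²` with weight `m`. -/
def form (m : ℤ × ℝ → ℝ) (a b : Lp ℂ 2 freqMeasure) : ℂ :=
  ∫ p, (m p : ℂ) * (a p * (starRingEnd ℂ) (b p)) ∂freqMeasure

/-- Weights that are measurable and bounded. -/
def IsWeight (C : ℝ) (m : ℤ × ℝ → ℝ) : Prop :=
  Measurable m ∧ ∀ p, p ≠ 0 → |m p| ≤ C

lemma integrable_form {C : ℝ} {m : ℤ × ℝ → ℝ} (hm : IsWeight C m) (a b : Lp ℂ 2 freqMeasure) :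
    Integrable (fun p => (m p : ℂ) * (a p * (starRingEnd ℂ) (b p))) freqMeasure := by
  have h : Integrable (fun p => a p * (starRingEnd ℂ) (b p)) freqMeasure :=
    MemLp.integrable_mul (Lp.memLp a) (Lp.memLp b).star
  refine h.bdd_mul (c := C) (Complex.measurable_ofReal.comp hm.1).aestronglyMeasurable ?_
  filter_upwards [ae_ne_zero] with p hp
  rw [Complex.norm_real]; exact hm.2 p hp

lemma norm_form_le {C : ℝ} {m : ℤ × ℝ → ℝ} (hC : 0 ≤ C) (hm : IsWeight C m)
    (a b : Lp ℂ 2 freqMeasure) : ‖form m a b‖ ≤ C * (‖a‖ * ‖b‖) := by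
  have h : ‖form m a b‖ₑ ≤ ENNReal.ofReal C * (‖a‖ₑ * ‖b‖ₑ) := by
    refine (enorm_integral_le_lintegral_enorm _).trans ?_
    have h1 := lintegral_mul_le_ltwo (Lp.aestronglyMeasurable a).enorm
      (Lp.aestronglyMeasurable b).enorm
    rw [ltwo_enorm, ltwo_enorm, ← Lp.enorm_def, ← Lp.enorm_def] at h1
    refine le_trans ?_ (mul_le_mul_right h1 _)
    rw [← lintegral_const_mul' _ _ ENNReal.ofReal_ne_top]
    refine lintegral_mono_ae ?_
    filter_upwards [ae_ne_zero] with p hp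
    rw [enorm_mul, enorm_mul, RCLike.enorm_conj]
    refine mul_le_mul_left ?_ _
    rw [← ofReal_norm, Complex.norm_real]
    exact ENNReal.ofReal_le_ofReal (hm.2 p hp)
  rw [← ofReal_norm, ← ofReal_norm, ← ofReal_norm, ← ENNReal.ofReal_mul (norm_nonneg _),
    ← ENNReal.ofReal_mul hC] at h
  exact (ENNReal.ofReal_le_ofReal_iff (by positivity)).1 h

lemma form_sub_left {C : ℝ} {m : ℤ × ℝ → ℝ} (hm : IsWeight C m) (a a' b : Lp ℂ 2 freqMeasure) :
    form m (a - a') b = form m a b - form m a' b := by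
  unfold form
  rw [← integral_sub (integrable_form hm a b) (integrable_form hm a' b)]
  refine integral_congr_ae ?_
  filter_upwards [Lp.coeFn_sub a a'] with p hp
  rw [hp, Pi.sub_apply]; ring

lemma form_sub_right {C : ℝ} {m : ℤ × ℝ → ℝ} (hm : IsWeight C m) (a b b' : Lp ℂ 2 freqMeasure) :
    form m a (b - b') = form m a b - form m a b' := by
  unfold form
  rw [← integral_sub (integrable_form hm a b) (integrable_form hm a b')]
  refine integral_congr_ae ?_
  filter_upwards [Lp.coeFn_sub b b'] with p hp
  rw [hp, Pi.sub_apply, map_sub]; ring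

lemma form_smul_left (m : ℤ × ℝ → ℝ) (x : ℝ) (a b : Lp ℂ 2 freqMeasure) :
    form m (x • a) b = x * form m a b := by
  unfold form
  rw [← integral_const_mul]
  refine integral_congr_ae ?_
  filter_upwards [Lp.coeFn_smul x a] with p hp
  rw [hp, Pi.smul_apply, Complex.real_smul]; ring

lemma form_smul_right (m : ℤ × ℝ → ℝ) (x : ℝ) (a b : Lp ℂ 2 freqMeasure) :
    form m a (x • b) = x * form m a b := by
  unfold form
  rw [← integral_const_mul]
  refine integral_congr_ae ?_
  filter_upwards [Lp.coeFn_smul x b] with p hp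
  rw [hp, Pi.smul_apply, Complex.real_smul, map_mul, Complex.conj_ofReal]; ring

/-- The weights converge only pointwise, which suffices by dominated convergence when both arguments
are frozen; the uniform bound on the weights handles the variation of the arguments. -/
lemma tendsto_form {l : Filter ℝ} [l.IsCountablyGenerated] {C : ℝ} (hC : 0 ≤ C)
    {m : ℝ → ℤ × ℝ → ℝ} {m₀ : ℤ × ℝ → ℝ} {a b : ℝ → Lp ℂ 2 freqMeasure}
    {a₀ b₀ : Lp ℂ 2 freqMeasure} (hm : ∀ᶠ τ in l, IsWeight C (m τ))
    (hm0 : ∀ p, p ≠ 0 → Tendsto (fun τ => m τ p) l (𝓝 (m₀ p)))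
    (ha : Tendsto a l (𝓝 a₀)) (hb : Tendsto b l (𝓝 b₀)) :
    Tendsto (fun τ => form (m τ) (a τ) (b τ)) l (𝓝 (form m₀ a₀ b₀)) := by
  have h1 : Tendsto (fun τ => form (m τ) a₀ b₀) l (𝓝 (form m₀ a₀ b₀)) := by
    refine tendsto_integral_filter_of_dominated_convergence
      (fun p => C * (‖a₀ p‖ * ‖b₀ p‖)) ?_ ?_ ?_ ?_
    · filter_upwards [hm] with τ h
      exact (integrable_form h a₀ b₀).aestronglyMeasurable
    · filter_upwards [hm] with τ h
      filter_upwards [ae_ne_zero] with p hp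
      rw [norm_mul, norm_mul, RCLike.norm_conj, Complex.norm_real]
      exact mul_le_mul_of_nonneg_right (h.2 p hp) (by positivity)
    · exact (MemLp.integrable_mul (Lp.memLp a₀).norm (Lp.memLp b₀).norm).const_mul C
    · filter_upwards [ae_ne_zero] with p hp
      exact ((Complex.continuous_ofReal.tendsto _).comp (hm0 p hp)).mul_const _
  have h2 : Tendsto (fun τ => form (m τ) (a τ) (b τ) - form (m τ) a₀ b₀) l (𝓝 0) := by
    have hz : Tendsto (fun τ => C * (‖a τ - a₀‖ * ‖b τ‖) + C * (‖a₀‖ * ‖b τ - b₀‖)) l (𝓝 0) := by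
      have e1 : Tendsto (fun τ => ‖a τ - a₀‖) l (𝓝 0) := by
        simpa using (ha.sub_const a₀).norm
      have e2 : Tendsto (fun τ => ‖b τ - b₀‖) l (𝓝 0) := by
        simpa using (hb.sub_const b₀).norm
      simpa using ((e1.mul hb.norm).const_mul C).add ((e2.const_mul ‖a₀‖).const_mul C)
    refine squeeze_zero_norm' ?_ hz
    filter_upwards [hm] with τ h
    have e : form (m τ) (a τ) (b τ) - form (m τ) a₀ b₀ =
        form (m τ) (a τ - a₀) (b τ) + form (m τ) a₀ (b τ - b₀) := by
      rw [form_sub_left h, form_sub_right h]; ring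
    rw [e]
    exact (norm_add_le _ _).trans (add_le_add (norm_form_le hC h _ _) (norm_form_le hC h _ _))
  simpa using h2.add h1

/-- The product rule for weighted forms with a time-dependent weight. -/
lemma hasDerivWithinAt_form {T t C : ℝ} (hC : 0 ≤ C) {m m' : ℝ → ℤ × ℝ → ℝ}
    {a b : ℝ → Lp ℂ 2 freqMeasure} {a' b' : Lp ℂ 2 freqMeasure}
    (hm : ∀ t ∈ Icc 0 T, IsWeight C (m t))
    (hd : ∀ t ∈ Icc 0 T, ∀ p, p ≠ 0 → HasDerivAt (fun τ => m τ p) (m' t p) t)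
    (hb' : ∀ t ∈ Icc 0 T, ∀ p, p ≠ 0 → |m' t p| ≤ C) (ht : t ∈ Icc 0 T)
    (ha : HasDerivWithinAt a a' (Icc 0 T) t) (hb : HasDerivWithinAt b b' (Icc 0 T) t) :
    HasDerivWithinAt (fun τ => form (m τ) (a τ) (b τ))
      (form (m' t) (a t) (b t) + form (m t) a' (b t) + form (m t) (a t) b') (Icc 0 T) t := by
  have hle : 𝓝[Icc 0 T \ {t}] t ≤ 𝓝[Icc 0 T] t := nhdsWithin_mono _ sdiff_subset
  have hmem : ∀ᶠ τ in 𝓝[Icc 0 T \ {t}] t, τ ∈ Icc 0 T \ {t} := self_mem_nhdsWithin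
  have hmw : ∀ᶠ τ in 𝓝[Icc 0 T \ {t}] t, IsWeight C (m τ) := hmem.mono fun τ hτ => hm τ hτ.1
  have hmt : ∀ p, p ≠ 0 → Tendsto (fun τ => m τ p) (𝓝[Icc 0 T \ {t}] t) (𝓝 (m t p)) :=
    fun p hp => (hd t ht p hp).continuousAt.tendsto.mono_left nhdsWithin_le_nhds
  -- By the mean value inequality the difference quotients of the weight obey the same bound as its
  -- time derivative, so they form an admissible family of weights.
  have hsm : ∀ᶠ τ in 𝓝[Icc 0 T \ {t}] t, IsWeight C (fun p => slope (fun τ => m τ p) t τ) := by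
    filter_upwards [hmem] with τ hτ
    have hne : τ - t ≠ 0 := sub_ne_zero.2 hτ.2
    refine ⟨?_, fun p hp => ?_⟩
    · have := ((hm τ hτ.1).1.sub (hm t ht).1).const_mul (τ - t)⁻¹
      exact this
    · have h := Convex.norm_image_sub_le_of_norm_hasDerivWithin_le (s := Icc 0 T)
        (fun x hx => (hd x hx p hp).hasDerivWithinAt)
        (fun x hx => by rw [Real.norm_eq_abs]; exact hb' x hx p hp) (convex_Icc 0 T) ht hτ.1
      rw [Real.norm_eq_abs, Real.norm_eq_abs] at h
      dsimp only
      rw [slope_def_field, abs_div]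
      exact div_le_of_le_mul₀ (abs_nonneg _) hC h
  rw [hasDerivWithinAt_iff_tendsto_slope] at ha hb ⊢
  -- The difference quotient splits into that of the weight with both arguments frozen, that of a
  -- with the weight and b at the new time, and that of b with a frozen.
  have l1 := tendsto_form hC hsm (fun p hp =>
    (hasDerivWithinAt_iff_tendsto_slope.1 (hd t ht p hp).hasDerivWithinAt))
    (tendsto_const_nhds (x := a t)) (tendsto_const_nhds (x := b t))
  have hbc : Tendsto b (𝓝[Icc 0 T \ {t}] t) (𝓝 (b t)) :=
    ((hasDerivWithinAt_iff_tendsto_slope.2 hb).continuousWithinAt.tendsto).mono_left hle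
  have l2 := tendsto_form hC hmw hmt ha hbc
  have l3 := tendsto_form hC hmw hmt (tendsto_const_nhds (x := a t)) hb
  refine ((l1.add l2).add l3).congr' ?_
  filter_upwards [hmem] with τ hτ
  have hne : (τ - t : ℂ) ≠ 0 := by
    rw [← Complex.ofReal_sub]; exact Complex.ofReal_ne_zero.2 (sub_ne_zero.2 hτ.2)
  have e1 : form (fun p => slope (fun τ => m τ p) t τ) (a t) (b t) =
      (τ - t : ℂ)⁻¹ * (form (m τ) (a t) (b t) - form (m t) (a t) (b t)) := by
    unfold form
    rw [← integral_sub (integrable_form (hm τ hτ.1) _ _) (integrable_form (hm t ht) _ _),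
      ← integral_const_mul]
    congr 1; ext p
    dsimp only
    rw [slope_def_field]; push_cast; ring
  rw [e1]
  simp only [slope, vsub_eq_sub, form_smul_left, form_smul_right]
  rw [form_sub_left (hm τ hτ.1), form_sub_right (hm τ hτ.1), Complex.real_smul]
  push_cast
  ring


/-! ### Continuity of the right-hand sides -/

lemma ContL.const_mul {σ T : ℝ} {f : ℝ → ℤ × ℝ → ℂ} (hf : ContL σ T f) (z : ℂ) :
    ContL σ T (fun t p => z * f t p) := by
  have h : ∀ g : ℤ × ℝ → ℂ, wnorm σ (fun p => z * g p) ≤ ENNReal.ofReal ‖z‖ * wnorm σ g :=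
    fun g => wnorm_mul_le (Eventually.of_forall fun _ => le_rfl)
  refine ⟨fun t ht => (hf.meas t ht).const_mul z, fun t ht =>
    (h _).trans_lt (ENNReal.mul_lt_top ENNReal.ofReal_lt_top (hf.fin t ht)), fun t ht => ?_⟩
  have hl := ENNReal.Tendsto.const_mul (hf.tend t ht)
    (Or.inr (ENNReal.ofReal_ne_top : ENNReal.ofReal ‖z‖ ≠ ⊤))
  rw [mul_zero] at hl
  refine tendsto_of_tendsto_of_tendsto_of_le_of_le tendsto_const_nhds hl
    (fun _ => zero_le) fun τ => le_of_eq_of_le ?_ (h fun p => f τ p - f t p)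
  congr 1; ext p; ring

lemma ContL.vel {σ T : ℝ} {w : ℝ → ℤ × ℝ → ℂ} (hw : ContL σ T w) (j : Fin 2) :
    ContL σ T (fun t => vel t (w t) j) := by
  have := hw.mult (isMult_nv T j)
  rwa [sub_zero] at this

lemma ContL.adv {σ T : ℝ} (hT : 0 ≤ T) (hσ : 1 < σ) {w f : ℝ → ℤ × ℝ → ℂ} (hw : ContL σ T w)
    (hf : ContL σ T f) : ContL (-1) T (fun t => adv t (w t) (f t)) := by
  have h := fun j => (((hw.vel j).conv hσ hf).mult (isMult_sym hT j)).const_mul Complex.I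
  norm_num at h
  have h2 := h.1.add h.2
  unfold Boussinesq.adv
  simp only [Fin.sum_univ_two, mul_assoc]
  exact h2

lemma ContL.rhsV {σ T : ℝ} (ν γ : ℝ) (hT : 0 ≤ T) (hσ : 1 < σ) {w f : ℝ → ℤ × ℝ → ℂ}
    (hw : ContL σ T w) (hf : ContL σ T f) : ContL (-2) T (fun t => rhsV ν γ t (w t) (f t)) := by
  have m1 : IsMult T 2 (fun t p => ν * modL t p ^ 2 + nv t p 0 * nv t p 1) := by
    have h1 := (IsMult.const T ν).mul (isMult_modL_sq hT)
    have h2 := (isMult_nv T 0).mul (isMult_nv T 1)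
    norm_num at h1 h2
    exact h1.add (h2.mono (by norm_num))
  have m2 : IsMult T 0 (fun t p => γ ^ 2 * nv t p 1) := by
    simpa using (IsMult.const T (γ ^ 2)).mul (isMult_nv T 1)
  have c1 := (hw.mult m1).neg.mono (by linarith : (-2 : ℝ) ≤ σ - 2)
  have c2 := (hf.mult m2).neg.mono (by linarith : (-2 : ℝ) ≤ σ - 0)
  have c3 := fun i => ((hw.adv hT hσ (hw.vel i)).mult (isMult_nv T i)).neg.mono
    (by norm_num : (-2 : ℝ) ≤ -1 - 0)
  have := (c1.add c2).add ((c3 0).add (c3 1))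
  refine Eq.mp ?_ this
  congr 1; ext t p
  simp only [Boussinesq.rhsV, Fin.sum_univ_two]
  ring

lemma ContL.rhsT {σ T : ℝ} (μ : ℝ) (hT : 0 ≤ T) (hσ : 1 < σ) {w f : ℝ → ℤ × ℝ → ℂ}
    (hw : ContL σ T w) (hf : ContL σ T f) : ContL (-2) T (fun t => rhsT μ t (w t) (f t)) := by
  have m1 : IsMult T 2 (fun t p => μ * modL t p ^ 2) := by
    have h1 := (IsMult.const T μ).mul (isMult_modL_sq hT)
    norm_num at h1
    exact h1
  have c1 := (hf.mult m1).neg.mono (by linarith : (-2 : ℝ) ≤ σ - 2)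
  have c2 := (hw.mult (isMult_nv T 1)).mono (by linarith : (-2 : ℝ) ≤ σ - 0)
  have c3 := (hw.adv hT hσ hf).neg.mono (by norm_num : (-2 : ℝ) ≤ -1)
  have := (c1.add c2).add c3
  refine Eq.mp ?_ this
  congr 1; ext t p
  simp only [Boussinesq.rhsT]
  ring

/-! ### The linear energy balance -/

/-- The logarithmic derivative in time of the squared energy weight. -/
def rate (c t : ℝ) (p : ℤ × ℝ) : ℝ :=
  nv t p 0 * nv t p 1 * (modL t p ^ 2 / jb t p ^ 2) - c * |nv t p 1| ^ 3

lemma hasDerivAt_jb {p : ℤ × ℝ} (hp : p ≠ 0) (t : ℝ) :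
    HasDerivAt (fun t => jb t p) (jb t p * (nv t p 0 * nv t p 1 * (modL t p ^ 2 / jb t p ^ 2))) t := by
  have h := ((hasDerivAt_modL hp t).pow 2).const_add 1
  have e : (fun t => jb t p) = fun t => √(1 + modL t p ^ 2) := by
    ext t; rw [← jb_sq_eq, Real.sqrt_sq (jb_pos t p).le]
  have hj := jb_pos t p
  have h2 := h.sqrt (by simp only [Pi.pow_apply]; positivity)
  rw [e]
  refine h2.congr_deriv ?_
  simp only [Pi.pow_apply]
  rw [← jb_sq_eq, Real.sqrt_sq hj.le]
  push_cast
  field_simp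

lemma hasDerivAt_wgt_sq (c s N : ℝ) {p : ℤ × ℝ} (hp : p ≠ 0) (t : ℝ) :
    HasDerivAt (fun t => wgt c s N t p ^ 2) (wgt c s N t p ^ 2 * rate c t p) t := by
  have hj := jb_pos t p
  have h1 := (((hasDerivAt_ghost p t).const_mul c).neg.div_const 2).exp
  have e1 : (fun t => damp c t p) = fun x => Real.exp ((-fun y => c * ghost y p) x / 2) := by
    ext t; simp [damp]
  rw [← e1] at h1
  have e : (fun t => wgt c s N t p ^ 2) =
      fun t => (cut N p * jb 0 p ^ s) ^ 2 * (damp c t p ^ 2 * jb t p) := by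
    ext t
    rw [wgt, amp, mul_pow, mul_pow, mul_pow, mul_pow, Real.sq_sqrt (jb_pos t p).le]; ring
  have h2 := ((h1.pow 2).mul (hasDerivAt_jb hp t)).const_mul ((cut N p * jb 0 p ^ s) ^ 2)
  rw [e]
  refine h2.congr_deriv ?_
  have e3 : wgt c s N t p ^ 2 = (cut N p * jb 0 p ^ s) ^ 2 * (damp c t p ^ 2 * jb t p) :=
    congrFun e t
  have e4 : Real.exp ((-fun y => c * ghost y p) t / 2) = damp c t p := (congrFun e1 t).symm
  simp only [Pi.pow_apply]
  rw [e3, e4, rate]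
  ring

lemma abs_rate_le {c : ℝ} (hc : 0 ≤ c) (t : ℝ) (p : ℤ × ℝ) : |rate c t p| ≤ 1 + c := by
  have h0 := abs_nv_le t p 0
  have h1 := abs_nv_le t p 1
  have h2 : modL t p ^ 2 / jb t p ^ 2 ≤ 1 :=
    (div_le_one (pow_pos (jb_pos t p) 2)).2 (by rw [jb_sq_eq]; linarith)
  have h3 : 0 ≤ modL t p ^ 2 / jb t p ^ 2 := by positivity
  have h4 : |nv t p 1| ^ 3 ≤ 1 := pow_le_one₀ (abs_nonneg _) h1
  unfold rate
  refine (abs_sub _ _).trans (add_le_add ?_ ?_)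
  · rw [abs_mul, abs_mul, abs_of_nonneg h3]
    exact mul_le_one₀ (mul_le_one₀ h0 (abs_nonneg _) h1) h3 h2
  · rw [abs_mul, abs_of_nonneg hc, abs_of_nonneg (by positivity)]
    exact mul_le_of_le_one_right hc h4

/-- A nonzero k is an integer, so 1 ≤ k² and 1/⟨p_t⟩² ≤ k²/|p_t|². Thus the defect between ⟨p_t⟩ and
|p_t| in the weight is also controlled by the ghost weight. -/
lemma abs_nv_one_div_le (t : ℝ) {p : ℤ × ℝ} (hp : p ≠ 0) :
    |nv t p 1| * (1 / jb t p ^ 2) ≤ |nv t p 1| ^ 3 := by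
  by_cases hk : p.1 = 0
  · simp [nv_one, hk]
  · have hm := modL_pos hp t
    have hk1 : (1 : ℝ) ≤ (p.1 : ℝ) ^ 2 := by
      have : (1 : ℤ) ≤ p.1 ^ 2 := by
        have := sq_abs p.1
        nlinarith [Int.one_le_abs hk]
      exact_mod_cast this
    have h : 1 / jb t p ^ 2 ≤ |nv t p 1| ^ 2 := by
      rw [sq_abs, nv_one, div_pow, neg_sq]
      refine div_le_div₀ (by positivity) hk1 (by positivity) ?_
      rw [jb_sq_eq]; linarith
    calc _ ≤ |nv t p 1| * |nv t p 1| ^ 2 := by gcongr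
      _ = _ := by ring

/-- The linear part of the energy identity is dissipative. -/
lemma linear_energy_le {c γ ν μ : ℝ} (hγ : 1 / 2 < γ) (hc : 3 ≤ c * (1 - 1 / (2 * γ)))
    (hc0 : 0 ≤ c) (hν : 0 < ν) (hμ : 0 < μ) (hνμ : (ν + μ) ^ 2 ≤ 16 * γ ^ 2 * (ν * μ)) (t : ℝ)
    {p : ℤ × ℝ} (hp : p ≠ 0) {a b X : ℝ} (hX : |X| ≤ a * b) :
    (rate c t p - nv t p 0 * nv t p 1 - 2 * (ν * modL t p ^ 2)) * a ^ 2 +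
      γ ^ 2 * ((rate c t p - nv t p 0 * nv t p 1 - 2 * (μ * modL t p ^ 2)) * b ^ 2) +
      (rate c t p * nv t p 0 + nv t p 1 ^ 3 - nv t p 0 * ((ν + μ) * modL t p ^ 2) -
        nv t p 0 ^ 2 * nv t p 1) * X ≤ 0 := by
  have hγ0 : 0 < γ := by linarith
  have hj := jb_pos t p
  have n0 := abs_nv_le t p 0
  have hn1 := abs_nv_one_div_le t hp
  set n := nv t p 0
  set m := nv t p 1
  set M := modL t p ^ 2 with hM
  have hM0 : 0 ≤ M := sq_nonneg _
  set J := 1 / jb t p ^ 2 with hJ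
  have hJ0 : 0 ≤ J := by positivity
  have hMJ : M / jb t p ^ 2 = 1 - J := by
    rw [hJ, hM, eq_sub_iff_add_eq, ← add_div, div_eq_one_iff_eq (pow_pos hj 2).ne', jb_sq_eq]; ring
  have hr : rate c t p = n * m * (1 - J) - c * |m| ^ 3 := by rw [rate, hMJ]
  set y := |m| ^ 3 with hy
  have hy0 : 0 ≤ y := by positivity
  set Q := a ^ 2 + γ ^ 2 * b ^ 2 with hQ
  have hXQ : |X| ≤ Q / (2 * γ) := by
    refine hX.trans ?_
    rw [le_div_iff₀ (by positivity)]
    nlinarith [sq_nonneg (a - γ * b)]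
  have hQ0 : 0 ≤ Q := by positivity
  have hXQ' : |X| ≤ Q := hXQ.trans (div_le_self hQ0 (by linarith))
  have hnX : |n * X| ≤ Q / (2 * γ) := by
    rw [abs_mul]; exact (mul_le_of_le_one_left (abs_nonneg _) n0).trans hXQ
  -- The form 2νa² - (ν + μ)ab + 2γ²μb² is nonnegative exactly when its discriminant satisfies (ν +
  -- μ)² ≤ 16γ²νμ.
  have hdiss : -(2 * ν * a ^ 2 + 2 * γ ^ 2 * μ * b ^ 2) - n * (ν + μ) * X ≤ 0 := by
    have h1 : |n * X| ≤ a * b := by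
      rw [abs_mul]; exact (mul_le_of_le_one_left (abs_nonneg _) n0).trans hX
    have h2 := (abs_le.1 h1).1
    have h3 : (ν + μ) * (a * b) ≤ 2 * ν * a ^ 2 + 2 * γ ^ 2 * μ * b ^ 2 := by
      refine abs_le_of_sq_le_sq' ?_ (by positivity) |>.2
      have h4 := mul_le_mul_of_nonneg_right hνμ (sq_nonneg (a * b))
      nlinarith [sq_nonneg (2 * ν * a ^ 2 - 2 * γ ^ 2 * μ * b ^ 2)]
    nlinarith [mul_le_mul_of_nonneg_left h2 (by positivity : 0 ≤ ν + μ)]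
  have t1 : -(n * m * J) * Q ≤ y * Q := by
    refine mul_le_mul_of_nonneg_right ((le_abs_self _).trans ?_) hQ0
    rw [abs_neg, mul_assoc, abs_mul, abs_mul, abs_of_nonneg hJ0]
    exact (mul_le_of_le_one_left (by positivity) n0).trans hn1
  have t2 : (m ^ 3 - n ^ 2 * m * J) * X ≤ 2 * y * Q := by
    refine (le_abs_self _).trans ?_
    rw [abs_mul]
    refine mul_le_mul ((abs_sub _ _).trans ?_) hXQ' (abs_nonneg _) (by positivity)
    rw [abs_pow, abs_mul, abs_mul, abs_of_nonneg hJ0, abs_of_nonneg (sq_nonneg n), mul_assoc]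
    have : n ^ 2 * (|m| * J) ≤ 1 * y :=
      mul_le_mul (by rw [← sq_abs]; exact pow_le_one₀ (abs_nonneg _) n0) hn1 (by positivity)
        zero_le_one
    linarith
  -- The errors amount to y Q from the diagonal terms and 2 y Q from the cross term. The ghost
  -- weight produces c y (Q + nX), which is at least c (1 - 1/(2γ)) y Q; hence the 3 in the
  -- condition on c.
  have t3 : 3 * (y * Q) ≤ c * y * (Q + n * X) := by
    have h1 := (abs_le.1 hnX).1
    have h2 : Q * (1 - 1 / (2 * γ)) ≤ Q + n * X := by
      rw [mul_sub, mul_one, mul_one_div]; linarith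
    have h3 := mul_le_mul_of_nonneg_right hc (mul_nonneg hy0 hQ0)
    have h4 := mul_le_mul_of_nonneg_left h2 (mul_nonneg hc0 hy0)
    nlinarith
  have h5 := mul_le_mul_of_nonneg_right hdiss hM0
  -- Here the nm produced by the weight cancels against the nm of the equations, leaving only the
  -- part nmJ with J = 1/⟨p_t⟩².
  have e : (rate c t p - n * m - 2 * (ν * M)) * a ^ 2 +
      γ ^ 2 * ((rate c t p - n * m - 2 * (μ * M)) * b ^ 2) +
      (rate c t p * n + m ^ 3 - n * ((ν + μ) * M) - n ^ 2 * m) * X =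
      -(n * m * J) * Q + (m ^ 3 - n ^ 2 * m * J) * X - c * y * (Q + n * X) +
      (-(2 * ν * a ^ 2 + 2 * γ ^ 2 * μ * b ^ 2) - n * (ν + μ) * X) * M := by
    rw [hr, hQ]; ring
  rw [e]
  linarith


/-! ### The nonlinear contribution -/

section Nonlinear

variable {c s N t γ : ℝ} {v θ f g : ℤ × ℝ → ℂ}

/-- The symmetrized transport density. -/
def trans (c s N t : ℝ) (v f g : ℤ × ℝ → ℂ) (p : ℤ × ℝ) : ℂ :=
  ((wgt c s N t p ^ 2 : ℝ) : ℂ) * (adv t v f p * (starRingEnd ℂ) (g p) +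
    f p * (starRingEnd ℂ) (adv t v g p))

/-- The pressure density. -/
def press (c s N t : ℝ) (v g : ℤ × ℝ → ℂ) (p : ℤ × ℝ) : ℂ :=
  ((wgt c s N t p ^ 2 * nv t p 1 : ℝ) : ℂ) *
    ((nv t p 1 * adv t v (vel t v 0) p - nv t p 0 * adv t v (vel t v 1) p) *
      (starRingEnd ℂ) (g p))

/-- The nonlinear contribution to the time derivative of the energy density. -/
def nonlin (c s N γ t : ℝ) (v θ : ℤ × ℝ → ℂ) (p : ℤ × ℝ) : ℂ :=
  press c s N t v θ p - (trans c s N t v (vel t v 0) (vel t v 0) p +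
    trans c s N t v (vel t v 1) (vel t v 1) p + (γ ^ 2 : ℝ) * trans c s N t v θ θ p +
    trans c s N t v (vel t v 0) θ p)

lemma integrable_trans (hc : 0 ≤ c) (hs : 0 ≤ s) (hN : 0 < N) (ht : 0 ≤ t)
    (hv : Both v) (hf : Both f) (hg : Both g) : Integrable (trans c s N t v f g) freqMeasure := by
  have i1 := (integrable_adv_mul hc hs hN ht hv hf hg).1
  have i2 := Complex.conjCLE.toContinuousLinearMap.integrable_comp
    (integrable_adv_mul hc hs hN ht hv hg hf).1
  refine (i1.add i2).congr (Eventually.of_forall fun p => ?_)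
  simp only [trans, Pi.add_apply, ContinuousLinearEquiv.coe_coe, Complex.conjCLE_apply, map_mul,
    Complex.conj_ofReal, Complex.conj_conj]
  ring

lemma integrable_nonlin (hc : 0 ≤ c) (hs : 1 ≤ s) (hN : 0 < N) (ht : 0 ≤ t)
    (hv : Both v) (hθ : Both θ) : Integrable (nonlin c s N γ t v θ) freqMeasure := by
  have h := fun {f g : ℤ × ℝ → ℂ} (hf : Both f) (hg : Both g) =>
    integrable_trans (N := N) hc (by linarith : 0 ≤ s) hN ht hv hf hg
  exact (enorm_pressure_le hc hs hN ht hv hθ).1.sub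
    ((((h (hv.vel t 0) (hv.vel t 0)).add (h (hv.vel t 1) (hv.vel t 1))).add
      ((h hθ hθ).const_mul _)).add (h (hv.vel t 0) hθ))

/-- The constant of the trilinear energy estimate. -/
def nlConst (c s γ : ℝ) : ℝ :=
  (2 * 2 ^ s + commConst c s * (3 + γ ^ 2)) * (8 * (wconst (s - 1 / 2)).toReal)

lemma nlConst_nonneg (hc : 0 ≤ c) (hs : 1 ≤ s) : 0 ≤ nlConst c s γ := by
  have := commConst_pos hc hs
  unfold nlConst; positivity

/-- The square root of the full energy. -/
def amplitude (s t : ℝ) (v θ : ℤ × ℝ → ℂ) : ℝ :=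
  √((en s t v).toReal ^ 2 + (en s t θ).toReal ^ 2)

lemma norm_le_of_enorm_le {z : ℂ} {k : ℝ} {W x y w : ℝ≥0∞} (hk : 0 ≤ k) (hW : W < ⊤) (hx : x < ⊤)
    (hy : y < ⊤) (hw : w < ⊤) (h : ‖z‖ₑ ≤ ENNReal.ofReal k * (8 * W * (x * y * w))) :
    ‖z‖ ≤ k * (8 * W.toReal * (x.toReal * y.toReal * w.toReal)) := by
  have h1 := ENNReal.toReal_mono (by finiteness) h
  simpa only [toReal_enorm, ENNReal.toReal_mul, ENNReal.toReal_ofReal hk, ENNReal.toReal_ofNat]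
    using h1

lemma norm_integral_nonlin_le (hc : 0 ≤ c) (hs : 3 / 2 < s) (hN : 0 < N) (ht : 0 ≤ t)
    (hv : Both v) (hθ : Both θ) (hr : ∀ᵐ p ∂freqMeasure, v (-p) = -(starRingEnd ℂ) (v p))
    (ev : en s t v < ⊤) (eθ : en s t θ < ⊤) :
    ‖∫ p, nonlin c s N γ t v θ p ∂freqMeasure‖ ≤
      nlConst c s γ * (1 + t) * amplitude s t v θ ^ 3 := by
  have hs1 : 1 ≤ s := by linarith
  have hs0 : 0 ≤ s := by linarith
  have hW := wconst_lt_top (by linarith : 1 < s - 1 / 2)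
  have hC := commConst_pos hc hs1
  have hi := fun {f g : ℤ × ℝ → ℂ} (hf : Both f) (hg : Both g) =>
    integrable_trans (N := N) hc hs0 hN ht hv hf hg
  set A := amplitude s t v θ with hA
  have hA0 : 0 ≤ A := Real.sqrt_nonneg _
  have hvA : (en s t v).toReal ≤ A := Real.le_sqrt_of_sq_le (by nlinarith [sq_nonneg (en s t θ).toReal])
  have hθA : (en s t θ).toReal ≤ A := Real.le_sqrt_of_sq_le (by nlinarith [sq_nonneg (en s t v).toReal])
  have hvel : ∀ i, (en s t (vel t v i)).toReal ≤ A := fun i =>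
    (ENNReal.toReal_mono ev.ne (en_vel_le s t v i)).trans hvA
  have evel : ∀ i, en s t (vel t v i) < ⊤ := fun i => (en_vel_le s t v i).trans_lt ev
  have hprod : ∀ {x y z : ℝ}, 0 ≤ x → 0 ≤ y → 0 ≤ z → x ≤ A → y ≤ A → z ≤ A → x * y * z ≤ A ^ 3 := by
    intro x y z hx hy hz h1 h2 h3
    calc x * y * z ≤ A * A * A := by gcongr
      _ = A ^ 3 := by ring
  have htr : ∀ {f g : ℤ × ℝ → ℂ}, Both f → Both g → en s t f < ⊤ → en s t g < ⊤ →
      (en s t f).toReal ≤ A → (en s t g).toReal ≤ A →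
      ‖∫ p, trans c s N t v f g p ∂freqMeasure‖ ≤
        commConst c s * (1 + t) * (8 * (wconst (s - 1 / 2)).toReal * A ^ 3) := by
    intro f g hf hg ef eg hfA hgA
    refine (norm_le_of_enorm_le (mul_nonneg hC.le (by linarith)) hW ev ef eg
      (enorm_transport_le hc hs1 hN ht hv hf hg hr)).trans ?_
    refine mul_le_mul_of_nonneg_left (mul_le_mul_of_nonneg_left
      (hprod ENNReal.toReal_nonneg ENNReal.toReal_nonneg ENNReal.toReal_nonneg hvA hfA hgA)
      (by positivity)) (by positivity)
  have hpr : ‖∫ p, press c s N t v θ p ∂freqMeasure‖ ≤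
      2 * 2 ^ s * (1 + t) * (8 * (wconst (s - 1 / 2)).toReal * A ^ 3) := by
    refine (norm_le_of_enorm_le (by positivity) hW ev ev eθ
      (enorm_pressure_le hc hs1 hN ht hv hθ).2).trans ?_
    refine mul_le_mul_of_nonneg_left (mul_le_mul_of_nonneg_left
      (hprod ENNReal.toReal_nonneg ENNReal.toReal_nonneg ENNReal.toReal_nonneg hvA hvA hθA)
      (by positivity)) (by positivity)
  have b00 := htr (hv.vel t 0) (hv.vel t 0) (evel 0) (evel 0) (hvel 0) (hvel 0)
  have b11 := htr (hv.vel t 1) (hv.vel t 1) (evel 1) (evel 1) (hvel 1) (hvel 1)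
  have bθθ := htr hθ hθ eθ eθ hθA hθA
  have b0θ := htr (hv.vel t 0) hθ (evel 0) eθ (hvel 0) hθA
  have i00 := hi (hv.vel t 0) (hv.vel t 0)
  have i11 := hi (hv.vel t 1) (hv.vel t 1)
  have iθθ := (hi hθ hθ).const_mul ((γ ^ 2 : ℝ) : ℂ)
  have i0θ := hi (hv.vel t 0) hθ
  have e : ∫ p, nonlin c s N γ t v θ p ∂freqMeasure = ∫ p, press c s N t v θ p ∂freqMeasure -
      (∫ p, trans c s N t v (vel t v 0) (vel t v 0) p ∂freqMeasure +
        ∫ p, trans c s N t v (vel t v 1) (vel t v 1) p ∂freqMeasure +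
        (γ ^ 2 : ℝ) * ∫ p, trans c s N t v θ θ p ∂freqMeasure +
        ∫ p, trans c s N t v (vel t v 0) θ p ∂freqMeasure) := by
    have ip : Integrable (press c s N t v θ) freqMeasure :=
      (enorm_pressure_le hc hs1 hN ht hv hθ).1
    unfold nonlin
    rw [integral_sub ip (((i00.fun_add i11).fun_add iθθ).fun_add i0θ),
      integral_add ((i00.fun_add i11).fun_add iθθ) i0θ, integral_add (i00.fun_add i11) iθθ,
      integral_add i00 i11, integral_const_mul]
  rw [e]
  refine (norm_sub_le _ _).trans ?_
  have h3 := norm_add_le (∫ p, trans c s N t v (vel t v 0) (vel t v 0) p ∂freqMeasure +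
        ∫ p, trans c s N t v (vel t v 1) (vel t v 1) p ∂freqMeasure +
        (γ ^ 2 : ℝ) * ∫ p, trans c s N t v θ θ p ∂freqMeasure)
        (∫ p, trans c s N t v (vel t v 0) θ p ∂freqMeasure)
  have h4 := norm_add₃_le (a := ∫ p, trans c s N t v (vel t v 0) (vel t v 0) p ∂freqMeasure)
        (b := ∫ p, trans c s N t v (vel t v 1) (vel t v 1) p ∂freqMeasure)
        (c := (γ ^ 2 : ℝ) * ∫ p, trans c s N t v θ θ p ∂freqMeasure)
  have h5 : ‖((γ ^ 2 : ℝ) : ℂ) * ∫ p, trans c s N t v θ θ p ∂freqMeasure‖ ≤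
      γ ^ 2 * (commConst c s * (1 + t) * (8 * (wconst (s - 1 / 2)).toReal * A ^ 3)) := by
    rw [norm_mul, Complex.norm_real, Real.norm_of_nonneg (sq_nonneg _)]
    exact mul_le_mul_of_nonneg_left bθθ (sq_nonneg _)
  calc _ ≤ 2 * 2 ^ s * (1 + t) * (8 * (wconst (s - 1 / 2)).toReal * A ^ 3) +
      (3 + γ ^ 2) * (commConst c s * (1 + t) * (8 * (wconst (s - 1 / 2)).toReal * A ^ 3)) := by
        linarith
    _ = _ := by unfold nlConst; ring

end Nonlinear

/-- The energy identity at one frequency. -/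
lemma energy_density_eq {n m W r ν μ γ M : ℝ} (hn : n ^ 2 + m ^ 2 = 1) (V Θ A₀ A₁ AT : ℂ) :
    ((W * r : ℝ) * (V * (starRingEnd ℂ) V) +
      W * ((-((ν * M + n * m : ℝ) : ℂ) * V - (γ ^ 2 * m : ℝ) * Θ - (n * A₀ + m * A₁)) *
        (starRingEnd ℂ) V) +
      W * (V * (starRingEnd ℂ)
        (-((ν * M + n * m : ℝ) : ℂ) * V - (γ ^ 2 * m : ℝ) * Θ - (n * A₀ + m * A₁))) +
      (γ ^ 2 : ℝ) * ((W * r : ℝ) * (Θ * (starRingEnd ℂ) Θ) +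
        W * ((-((μ * M : ℝ) : ℂ) * Θ + m * V - AT) * (starRingEnd ℂ) Θ) +
        W * (Θ * (starRingEnd ℂ) (-((μ * M : ℝ) : ℂ) * Θ + m * V - AT))) +
      ((W * r * n + W * m ^ 3 : ℝ) * (V * (starRingEnd ℂ) Θ) +
        (W * n : ℝ) * ((-((ν * M + n * m : ℝ) : ℂ) * V - (γ ^ 2 * m : ℝ) * Θ -
          (n * A₀ + m * A₁)) * (starRingEnd ℂ) Θ) +
        (W * n : ℝ) * (V * (starRingEnd ℂ) (-((μ * M : ℝ) : ℂ) * Θ + m * V - AT))) : ℂ).re =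
    W * ((r - n * m - 2 * (ν * M)) * ‖V‖ ^ 2 + γ ^ 2 * ((r - n * m - 2 * (μ * M)) * ‖Θ‖ ^ 2) +
      (r * n + m ^ 3 - n * ((ν + μ) * M) - n ^ 2 * m) * (V * (starRingEnd ℂ) Θ).re) +
    ((W * m : ℝ) * ((m * A₀ - n * A₁) * (starRingEnd ℂ) Θ) -
      (W * (A₀ * (starRingEnd ℂ) (n * V) + n * V * (starRingEnd ℂ) A₀) +
        W * (A₁ * (starRingEnd ℂ) (m * V) + m * V * (starRingEnd ℂ) A₁) +
        (γ ^ 2 : ℝ) * (W * (AT * (starRingEnd ℂ) Θ + Θ * (starRingEnd ℂ) AT)) +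
        W * (A₀ * (starRingEnd ℂ) Θ + n * V * (starRingEnd ℂ) AT)) : ℂ).re := by
  rw [Complex.sq_norm, Complex.sq_norm, Complex.normSq_apply, Complex.normSq_apply]
  simp only [Complex.add_re, Complex.sub_re, Complex.mul_re, Complex.ofReal_re, Complex.ofReal_im,
    Complex.add_im, Complex.sub_im, Complex.mul_im, Complex.conj_re, Complex.conj_im, map_add,
    map_sub, map_mul, map_neg, Complex.conj_ofReal, Complex.neg_re, Complex.neg_im]
  -- The identity n² + m² = 1 is used only in the cross term: n(nA₀ + mA₁) = A₀ - m(mA₀ - nA₁). The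
  -- first part pairs with nv * θ transport into a skew-symmetric term for u₁ and θ, the second is
  -- the pressure term.
  linear_combination (-W * (A₀.re * Θ.re + A₀.im * Θ.im)) * hn


/-! ### The energy and its time derivative -/

lemma form_lp {u : ℤ × ℝ → ℝ} {f g : ℤ × ℝ → ℂ}
    (hf : AEStronglyMeasurable f freqMeasure) (hg : AEStronglyMeasurable g freqMeasure)
    (hf2 : wnorm (-2) f < ⊤) (hg2 : wnorm (-2) g < ⊤) :
    (fun p => ((u p * jb 0 p ^ 4 : ℝ) : ℂ) * (lp (-2) f p * (starRingEnd ℂ) (lp (-2) g p)))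
      =ᵐ[freqMeasure] fun p => (u p : ℂ) * (f p * (starRingEnd ℂ) (g p)) := by
  filter_upwards [coeFn_lp hf hf2, coeFn_lp hg hg2] with p h1 h2
  rw [h1, h2, map_mul, Complex.conj_ofReal]
  have e : jb 0 p ^ 4 * (jb 0 p ^ (-2 : ℝ) * jb 0 p ^ (-2 : ℝ)) = 1 := by
    have hj := jb_pos 0 p
    rw [Real.rpow_neg hj.le, Real.rpow_two]
    field_simp
  have e' : ((jb 0 p ^ 4 : ℝ) : ℂ) * ((jb 0 p ^ (-2 : ℝ) : ℝ) * (jb 0 p ^ (-2 : ℝ) : ℝ)) = 1 := by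
    exact_mod_cast e
  rw [Complex.ofReal_mul]
  linear_combination ((u p : ℂ) * (f p * (starRingEnd ℂ) (g p))) * e'

/-- The factor ⟨p⟩⁴ compensates the two factors ⟨p⟩^{-2} in `lp`. A weight that stays bounded after
multiplication by ⟨p⟩⁴ therefore gives a bounded form at order -2. -/
lemma form_lp_eq {C : ℝ} {u : ℤ × ℝ → ℝ} (hu : IsWeight C fun p => u p * jb 0 p ^ 4)
    {f g : ℤ × ℝ → ℂ}
    (hf : AEStronglyMeasurable f freqMeasure) (hg : AEStronglyMeasurable g freqMeasure)
    (hf2 : wnorm (-2) f < ⊤) (hg2 : wnorm (-2) g < ⊤) :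
    Integrable (fun p => (u p : ℂ) * (f p * (starRingEnd ℂ) (g p))) freqMeasure ∧
    form (fun p => u p * jb 0 p ^ 4) (lp (-2) f) (lp (-2) g) =
      ∫ p, (u p : ℂ) * (f p * (starRingEnd ℂ) (g p)) ∂freqMeasure :=
  ⟨(integrable_form hu _ _).congr (form_lp hf hg hf2 hg2),
    integral_congr_ae (form_lp hf hg hf2 hg2)⟩

lemma measurable_rate (c t : ℝ) : Measurable (rate c t) := by
  have h0 := measurable_nv t 0
  have h1 := measurable_nv t 1
  have h2 := measurable_modL t
  have h3 := measurable_jb t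
  have h4 : Measurable fun p => |nv t p 1| := continuous_abs.measurable.comp h1
  unfold rate
  exact ((h0.mul h1).mul ((h2.pow_const 2).div (h3.pow_const 2))).sub ((h4.pow_const 3).const_mul c)

/-- The energy. -/
def energy (c s N γ t : ℝ) (v θ : ℤ × ℝ → ℂ) : ℝ :=
  ∫ p, wgt c s N t p ^ 2 * (‖v p‖ ^ 2 + γ ^ 2 * ‖θ p‖ ^ 2 +
    nv t p 0 * (v p * (starRingEnd ℂ) (θ p)).re) ∂freqMeasure

section Energy

variable {c s N t T γ ν μ : ℝ}

/-- On the support of the cutoff ⟨p⟩ ≤ N, so ⟨p⟩⁴ is harmless. The bound depends on N, which only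
matters for justifying the differentiation. -/
lemma isWeight_wgt_mul (hc : 0 ≤ c) (hs : 0 ≤ s) (hN : 0 < N) (ht : t ∈ Icc 0 T) {n : ℤ × ℝ → ℝ}
    {B : ℝ} (hn : Measurable n) (hnB : ∀ p, |n p| ≤ B) :
    IsWeight ((1 + T) * N ^ (2 * s + 1) * N ^ 4 * B)
      fun p => wgt c s N t p ^ 2 * n p * jb 0 p ^ 4 := by
  refine ⟨(((measurable_wgt c s N t).pow_const 2).mul hn).mul ((measurable_jb 0).pow_const 4),
    fun p _ => ?_⟩
  have hj := jb_pos 0 p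
  have h1 : (1 + t) * N ^ (2 * s + 1) * N ^ 4 ≤ (1 + T) * N ^ (2 * s + 1) * N ^ 4 := by
    gcongr; exact ht.2
  have h2 : 0 ≤ wgt c s N t p ^ 2 * jb 0 p ^ 4 := by positivity
  have e : wgt c s N t p ^ 2 * n p * jb 0 p ^ 4 = wgt c s N t p ^ 2 * jb 0 p ^ 4 * n p := by ring
  dsimp only
  rw [e, abs_mul, abs_of_nonneg h2]
  exact mul_le_mul ((wgt_sq_mul_le hc hs hN ht.1 4 p).trans h1) (hnB p) (abs_nonneg _)
    (h2.trans ((wgt_sq_mul_le hc hs hN ht.1 4 p).trans h1))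

lemma IsWeight.mono {C D : ℝ} {m : ℤ × ℝ → ℝ} (h : IsWeight C m) (hCD : C ≤ D) : IsWeight D m :=
  ⟨h.1, fun p hp => (h.2 p hp).trans hCD⟩

variable {v θ : ℝ → ℤ × ℝ → ℂ}

lemma FreqSol.contL_v {σ : ℝ} (h : FreqSol ν μ γ σ T v θ) : ContL σ T v :=
  ⟨h.meas_v, h.norm_v, h.cont_v⟩

lemma FreqSol.contL_θ {σ : ℝ} (h : FreqSol ν μ γ σ T v θ) : ContL σ T θ :=
  ⟨h.meas_θ, h.norm_θ, h.cont_θ⟩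

lemma ContL.both {σ : ℝ} {f : ℝ → ℤ × ℝ → ℂ} (hσ : 1 < σ) (hf : ContL σ T f) (ht : t ∈ Icc 0 T) :
    Both (f t) :=
  ⟨integrable_of_wnorm hσ (hf.meas t ht) (hf.fin t ht),
    hf.meas t ht, (eLpNorm_two_le_wnorm (by linarith) _).trans_lt (hf.fin t ht)⟩

/-- The energy decreases up to a cubic term. -/
lemma FreqSol.hasDerivWithinAt_energy (hsol : FreqSol ν μ γ (s + 1 / 2) T v θ) (hT : 0 ≤ T)
    (hs : 3 / 2 < s) (hN : 0 < N) (hγ : 1 / 2 < γ) (hc : 3 ≤ c * (1 - 1 / (2 * γ))) (hc0 : 0 ≤ c)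
    (hν : 0 < ν) (hμ : 0 < μ) (hνμ : (ν + μ) ^ 2 ≤ 16 * γ ^ 2 * (ν * μ)) (ht : t ∈ Icc 0 T)
    (ev : en s t (v t) < ⊤) (eθ : en s t (θ t) < ⊤) :
    ∃ D, HasDerivWithinAt (fun τ => energy c s N γ τ (v τ) (θ τ)) D (Icc 0 T) t ∧
      D ≤ nlConst c s γ * (1 + t) * amplitude s t (v t) (θ t) ^ 3 := by
  have hσ : 1 < s + 1 / 2 := by linarith
  have hs0 : 0 ≤ s := by linarith
  have cv := hsol.contL_v
  have cθ := hsol.contL_θ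
  have cv2 := cv.mono (by linarith : (-2 : ℝ) ≤ s + 1 / 2)
  have cθ2 := cθ.mono (by linarith : (-2 : ℝ) ≤ s + 1 / 2)
  have cRv := cv.rhsV ν γ hT hσ cθ
  have cRθ := cv.rhsT μ hT hσ cθ
  have dv := cv2.hasDerivWithinAt_lp hT cRv hsol.weak_v t ht
  have dθ := cθ2.hasDerivWithinAt_lp hT cRθ hsol.weak_θ t ht
  -- The auxiliary factors are 1, the rate, nv₀, and rate times nv₀ plus nv₁³. They are bounded by
  -- 1, 1 + c, 1 and 2 + c, so 2 + c serves for all of them.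
  set C := (1 + T) * N ^ (2 * s + 1) * N ^ 4 * (2 + c) with hC
  have hC0 : 0 ≤ C := by positivity
  have hw := fun {t : ℝ} (ht : t ∈ Icc 0 T) {n : ℤ × ℝ → ℝ} {B : ℝ}
      (hn : Measurable n) (hnB : ∀ p, |n p| ≤ B) (hBc : B ≤ 2 + c) =>
    (isWeight_wgt_mul hc0 hs0 hN ht hn hnB).mono (D := C)
      (mul_le_mul_of_nonneg_left hBc (by positivity))
  have w1 : ∀ t ∈ Icc 0 T, IsWeight C fun p => wgt c s N t p ^ 2 * jb 0 p ^ 4 := fun t ht => by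
    have := hw ht (n := fun _ => 1) (B := 1) measurable_const (by simp) (by linarith)
    simpa only [mul_one] using this
  have wr : ∀ t ∈ Icc 0 T, IsWeight C fun p => wgt c s N t p ^ 2 * rate c t p * jb 0 p ^ 4 :=
    fun t ht => hw ht (measurable_rate c t) (abs_rate_le hc0 t) (by linarith)
  have w0 : ∀ t ∈ Icc 0 T, IsWeight C fun p => wgt c s N t p ^ 2 * nv t p 0 * jb 0 p ^ 4 :=
    fun t ht => hw ht (measurable_nv t 0) (fun p => abs_nv_le t p 0) (by linarith)
  have wr0 : ∀ t ∈ Icc 0 T, IsWeight C fun p =>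
      (wgt c s N t p ^ 2 * rate c t p * nv t p 0 + wgt c s N t p ^ 2 * nv t p 1 ^ 3) *
        jb 0 p ^ 4 := fun t ht => by
    have := hw ht (n := fun p => rate c t p * nv t p 0 + nv t p 1 ^ 3) (B := 2 + c)
      (((measurable_rate c t).mul (measurable_nv t 0)).add ((measurable_nv t 1).pow_const 3))
      (fun p => ?_) le_rfl
    · simpa only [mul_add, mul_assoc] using this
    · refine (abs_add_le _ _).trans ?_
      rw [abs_mul, abs_pow]
      have h1 := mul_le_mul (abs_rate_le hc0 t p) (abs_nv_le t p 0) (abs_nonneg _) (by linarith)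
      have h2 := pow_le_one₀ (n := 3) (abs_nonneg _) (abs_nv_le t p 1)
      linarith
  have d1 : ∀ t ∈ Icc 0 T, ∀ p, p ≠ 0 → HasDerivAt (fun τ => wgt c s N τ p ^ 2 * jb 0 p ^ 4)
      (wgt c s N t p ^ 2 * rate c t p * jb 0 p ^ 4) t := fun t _ p hp =>
    (hasDerivAt_wgt_sq c s N hp t).mul_const _
  have d0 : ∀ t ∈ Icc 0 T, ∀ p, p ≠ 0 →
      HasDerivAt (fun τ => wgt c s N τ p ^ 2 * nv τ p 0 * jb 0 p ^ 4)
      ((wgt c s N t p ^ 2 * rate c t p * nv t p 0 + wgt c s N t p ^ 2 * nv t p 1 ^ 3) *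
        jb 0 p ^ 4) t := fun t _ p hp =>
    ((hasDerivAt_wgt_sq c s N hp t).mul (hasDerivAt_nv_zero hp t)).mul_const _
  have D1 := hasDerivWithinAt_form hC0 w1 d1 (fun t ht => (wr t ht).2) ht dv dv
  have D2 := hasDerivWithinAt_form hC0 w1 d1 (fun t ht => (wr t ht).2) ht dθ dθ
  have D3 := hasDerivWithinAt_form hC0 w0 d0 (fun t ht => (wr0 t ht).2) ht dv dθ
  have DC := (D1.add (D2.const_mul ((γ ^ 2 : ℝ) : ℂ))).add D3
  have DR := Complex.reCLM.hasFDerivAt.comp_hasDerivWithinAt t DC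
  have hE : ∀ τ ∈ Icc 0 T, energy c s N γ τ (v τ) (θ τ) = Complex.reCLM
      (form (fun p => wgt c s N τ p ^ 2 * jb 0 p ^ 4) (lp (-2) (v τ)) (lp (-2) (v τ)) +
      ((γ ^ 2 : ℝ) : ℂ) * form (fun p => wgt c s N τ p ^ 2 * jb 0 p ^ 4) (lp (-2) (θ τ))
        (lp (-2) (θ τ)) +
      form (fun p => wgt c s N τ p ^ 2 * nv τ p 0 * jb 0 p ^ 4) (lp (-2) (v τ))
        (lp (-2) (θ τ))) := by
    intro τ hτ
    have mv := cv2.meas τ hτ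
    have fv := cv2.fin τ hτ
    have mθ := cθ2.meas τ hτ
    have fθ := cθ2.fin τ hτ
    obtain ⟨i1, e1⟩ := form_lp_eq (w1 τ hτ) mv mv fv fv
    obtain ⟨i2, e2⟩ := form_lp_eq (w1 τ hτ) mθ mθ fθ fθ
    obtain ⟨i3, e3⟩ := form_lp_eq (w0 τ hτ) mv mθ fv fθ
    rw [e1, e2, e3, ← integral_const_mul, ← integral_add i1 (i2.const_mul _),
      ← integral_add (i1.fun_add (i2.const_mul _)) i3, ← Complex.reCLM.integral_comp_comm
        ((i1.fun_add (i2.const_mul _)).fun_add i3), energy]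
    congr 1; ext p
    simp only [Complex.reCLM_apply, Complex.add_re, Complex.re_ofReal_mul, Complex.mul_conj,
      Complex.ofReal_re, ← Complex.sq_norm]
    ring
  refine ⟨_, DR.congr hE (hE t ht), ?_⟩
  have mv := cv2.meas t ht
  have fv := cv2.fin t ht
  have mθ := cθ2.meas t ht
  have fθ := cθ2.fin t ht
  have mR := cRv.meas t ht
  have fR := cRv.fin t ht
  have mS := cRθ.meas t ht
  have fS := cRθ.fin t ht
  obtain ⟨i1, e1⟩ := form_lp_eq (wr t ht) mv mv fv fv
  obtain ⟨i2, e2⟩ := form_lp_eq (w1 t ht) mR mv fR fv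
  obtain ⟨i3, e3⟩ := form_lp_eq (w1 t ht) mv mR fv fR
  obtain ⟨i4, e4⟩ := form_lp_eq (wr t ht) mθ mθ fθ fθ
  obtain ⟨i5, e5⟩ := form_lp_eq (w1 t ht) mS mθ fS fθ
  obtain ⟨i6, e6⟩ := form_lp_eq (w1 t ht) mθ mS fθ fS
  obtain ⟨i7, e7⟩ := form_lp_eq (wr0 t ht) mv mθ fv fθ
  obtain ⟨i8, e8⟩ := form_lp_eq (w0 t ht) mR mθ fR fθ
  obtain ⟨i9, e9⟩ := form_lp_eq (w0 t ht) mv mS fv fS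
  have j1 := (i1.fun_add i2).fun_add i3
  have j2 := ((i4.fun_add i5).fun_add i6).const_mul ((γ ^ 2 : ℝ) : ℂ)
  have j3 := (i7.fun_add i8).fun_add i9
  have bv := cv.both hσ ht
  have bθ := cθ.both hσ ht
  have inl := integrable_nonlin (γ := γ) hc0 (by linarith : 1 ≤ s) hN ht.1 bv bθ
  rw [e1, e2, e3, e4, e5, e6, e7, e8, e9, ← integral_add i1 i2, ← integral_add (i1.fun_add i2) i3,
    ← integral_add i4 i5, ← integral_add (i4.fun_add i5) i6, ← integral_const_mul,
    ← integral_add i7 i8, ← integral_add (i7.fun_add i8) i9, ← integral_add j1 j2,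
    ← integral_add (j1.fun_add j2) j3, ← Complex.reCLM.integral_comp_comm
      ((j1.fun_add j2).fun_add j3)]
  refine le_trans ?_ (norm_integral_nonlin_le hc0 hs hN ht.1 bv bθ (hsol.real_v t ht) ev eθ)
  refine le_trans ?_ ((le_abs_self _).trans (Complex.abs_re_le_norm _))
  rw [← Complex.reCLM_apply, ← Complex.reCLM.integral_comp_comm inl]
  refine integral_mono_ae (Complex.reCLM.integrable_comp ((j1.fun_add j2).fun_add j3))
    (Complex.reCLM.integrable_comp inl) ?_
  filter_upwards [ae_ne_zero] with p hp
  -- At each frequency the density of the derivative is a nonpositive linear part plus the real part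
  -- of the nonlinear density, so only the integral of the latter remains.
  have halg := energy_density_eq (W := wgt c s N t p ^ 2) (r := rate c t p) (ν := ν) (μ := μ)
    (γ := γ) (M := modL t p ^ 2) (nv_sq_add hp t) (v t p) (θ t p) (adv t (v t) (vel t (v t) 0) p)
    (adv t (v t) (vel t (v t) 1) p) (adv t (v t) (θ t) p)
  have hlin := linear_energy_le hγ hc hc0 hν hμ hνμ t hp (a := ‖v t p‖) (b := ‖θ t p‖)
    (X := (v t p * (starRingEnd ℂ) (θ t p)).re)
    ((Complex.abs_re_le_norm _).trans_eq (by rw [norm_mul, RCLike.norm_conj]))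
  have hneg := mul_nonpos_of_nonneg_of_nonpos (sq_nonneg (wgt c s N t p)) hlin
  simp only [Complex.reCLM_apply, rhsV, rhsT, nonlin, press, trans, Fin.sum_univ_two]
  simp only [vel] at halg ⊢
  rw [halg]
  linarith

end Energy


/-! ### Comparison of energy and norm, and removal of the cutoff -/

lemma en_eq_eLpNorm (s t : ℝ) (f : ℤ × ℝ → ℂ) :
    en s t f = eLpNorm (fun p => ((amp s t p : ℝ) : ℂ) * f p) 2 freqMeasure := ltwo_enorm _

lemma amp_le {t : ℝ} (ht : 0 ≤ t) (s : ℝ) (p : ℤ × ℝ) :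
    amp s t p ≤ √(1 + t) * jb 0 p ^ (s + 1 / 2) := by
  have h0 := jb_pos 0 p
  have e : jb 0 p ^ (s + 1 / 2) = jb 0 p ^ s * √(jb 0 p) := by
    rw [Real.rpow_add h0, Real.sqrt_eq_rpow]
  have h1 : √(jb t p) ≤ √(1 + t) * √(jb 0 p) := by
    rw [← Real.sqrt_mul (by linarith)]; exact Real.sqrt_le_sqrt (jb_le_mul ht p)
  rw [e, amp]
  calc _ ≤ jb 0 p ^ s * (√(1 + t) * √(jb 0 p)) := by gcongr
    _ = _ := by ring

lemma en_le_wnorm {t : ℝ} (ht : 0 ≤ t) (s : ℝ) (f : ℤ × ℝ → ℂ) :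
    en s t f ≤ ENNReal.ofReal √(1 + t) * wnorm (s + 1 / 2) f := by
  rw [en_eq_eLpNorm]
  refine eLpNorm_le_mul_eLpNorm_of_ae_le_mul (Eventually.of_forall fun p => ?_) 2
  rw [norm_mul, norm_mul, Complex.norm_real, Complex.norm_real,
    Real.norm_of_nonneg (amp_pos s t p).le,
    Real.norm_of_nonneg (Real.rpow_nonneg (jb_pos 0 p).le _), ← mul_assoc]
  exact mul_le_mul_of_nonneg_right (amp_le ht s p) (norm_nonneg _)

lemma en_toReal_sq {s t : ℝ} {f : ℤ × ℝ → ℂ} (hf : AEStronglyMeasurable f freqMeasure)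
    (h : en s t f < ⊤) : Integrable (fun p => amp s t p ^ 2 * ‖f p‖ ^ 2) freqMeasure ∧
      (en s t f).toReal ^ 2 = ∫ p, amp s t p ^ 2 * ‖f p‖ ^ 2 ∂freqMeasure := by
  have hm := aestronglyMeasurable_amp_mul s t hf
  have e : ∀ p, amp s t p ^ 2 * ‖f p‖ ^ 2 = ‖((amp s t p : ℝ) : ℂ) * f p‖ ^ 2 := fun p => by
    rw [norm_mul, Complex.norm_real, Real.norm_of_nonneg (amp_pos s t p).le, mul_pow]
  simp_rw [e]
  have hL : MemLp (fun p => ((amp s t p : ℝ) : ℂ) * f p) 2 freqMeasure :=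
    ⟨hm, by rwa [← en_eq_eLpNorm]⟩
  refine ⟨(memLp_two_iff_integrable_sq_norm hm).1 hL, ?_⟩
  rw [integral_eq_lintegral_of_nonneg_ae (Eventually.of_forall fun p => sq_nonneg _)
    (hm.norm.pow 2), ← ENNReal.toReal_pow, en_eq_eLpNorm, eLpNorm_two_sq]
  congr 1
  refine lintegral_congr fun p => ?_
  rw [ENNReal.ofReal_pow (norm_nonneg _), ofReal_norm]

lemma amplitude_sq (s t : ℝ) (v θ : ℤ × ℝ → ℂ) :
    amplitude s t v θ ^ 2 = (en s t v).toReal ^ 2 + (en s t θ).toReal ^ 2 :=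
  Real.sq_sqrt (by positivity)

lemma continuous_jb (p : ℤ × ℝ) : Continuous fun t => jb t p := by
  unfold jb bracket; fun_prop

/-- The time dependence of the norm is moved into the weight ⟨p_t⟩/⟨p⟩, which is bounded by 1 + T
and continuous in time, against the fixed norm of order s + 1/2. -/
lemma ContL.continuousOn_en {s T : ℝ} {f : ℝ → ℤ × ℝ → ℂ} (hf : ContL (s + 1 / 2) T f) :
    ContinuousOn (fun t => (en s t (f t)).toReal ^ 2) (Icc 0 T) := by
  have hfin : ∀ t ∈ Icc 0 T, en s t (f t) < ⊤ := fun t ht => (en_le_wnorm ht.1 s _).trans_lt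
    (ENNReal.mul_lt_top ENNReal.ofReal_lt_top (hf.fin t ht))
  have e : ∀ t ∈ Icc 0 T, (en s t (f t)).toReal ^ 2 =
      (form (fun p => jb t p / jb 0 p) (lp (s + 1 / 2) (f t)) (lp (s + 1 / 2) (f t))).re := by
    intro t ht
    rw [(en_toReal_sq (hf.meas t ht) (hfin t ht)).2]
    have : form (fun p => jb t p / jb 0 p) (lp (s + 1 / 2) (f t)) (lp (s + 1 / 2) (f t)) =
        ((∫ p, amp s t p ^ 2 * ‖f t p‖ ^ 2 ∂freqMeasure : ℝ) : ℂ) := by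
      rw [← integral_complex_ofReal, form]
      refine integral_congr_ae ?_
      filter_upwards [coeFn_lp (hf.meas t ht) (hf.fin t ht)] with p hp
      have h0 := jb_pos 0 p
      have e1 : jb t p / jb 0 p * (jb 0 p ^ (s + 1 / 2) * jb 0 p ^ (s + 1 / 2)) =
          amp s t p ^ 2 := by
        rw [amp, mul_pow, Real.sq_sqrt (jb_pos t p).le, ← Real.rpow_add h0,
          show s + 1 / 2 + (s + 1 / 2) = s + s + 1 by ring, Real.rpow_add_one h0.ne',
          Real.rpow_add h0]
        field_simp
      rw [hp, Complex.mul_conj, Complex.normSq_mul, Complex.normSq_ofReal, ← Complex.sq_norm,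
        ← Complex.ofReal_mul, ← mul_assoc, e1]
    rw [this, Complex.ofReal_re]
  refine ContinuousOn.congr ?_ e
  intro t ht
  have hc := hf.continuousOn_lp t ht
  refine (Complex.continuous_re.tendsto _).comp (tendsto_form (C := 1 + T)
    (by linarith [ht.1, ht.2]) ?_ (fun p _ => ?_) hc hc)
  · filter_upwards [self_mem_nhdsWithin] with τ hτ
    refine ⟨(measurable_jb τ).div (measurable_jb 0), fun p _ => ?_⟩
    have h0 := jb_pos 0 p
    rw [abs_of_pos (div_pos (jb_pos τ p) h0), div_le_iff₀ h0]
    refine (jb_le_mul hτ.1 p).trans ?_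
    gcongr; exact hτ.2
  · exact (((continuous_jb p).div_const _).tendsto t).mono_left nhdsWithin_le_nhds

section Bounds

variable {c s N t γ : ℝ} {v θ : ℤ × ℝ → ℂ}

/-- This is |V||Θ| ≤ (|V|² + γ²|Θ|²)/(2γ). The factor 1/(2γ) is less than one exactly for γ > 1/2,
which makes the energy coercive. -/
lemma abs_cross_le (hγ : 0 < γ) (n : ℝ) (hn : |n| ≤ 1) (V Θ : ℂ) :
    |n * (V * (starRingEnd ℂ) Θ).re| ≤ 1 / (2 * γ) * (‖V‖ ^ 2 + γ ^ 2 * ‖Θ‖ ^ 2) := by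
  have h1 : |(V * (starRingEnd ℂ) Θ).re| ≤ ‖V‖ * ‖Θ‖ :=
    (Complex.abs_re_le_norm _).trans_eq (by rw [norm_mul, RCLike.norm_conj])
  rw [abs_mul]
  refine ((mul_le_of_le_one_left (abs_nonneg _) hn).trans h1).trans ?_
  rw [one_div, inv_mul_eq_div, le_div_iff₀ (by positivity)]
  nlinarith [sq_nonneg (‖V‖ - γ * ‖Θ‖)]

lemma tendsto_cut (p : ℤ × ℝ) : Tendsto (fun N : ℝ => cut N p) atTop (𝓝 1) := by
  have h : Tendsto (fun N : ℝ => max 0 (1 - jb 0 p / N)) atTop (𝓝 (max 0 (1 - 0))) :=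
    tendsto_const_nhds.max (tendsto_const_nhds.sub (tendsto_const_nhds.div_atTop tendsto_id))
  simpa [cut] using h

lemma integrable_amp_sq_mul (hv : AEStronglyMeasurable v freqMeasure)
    (hθ : AEStronglyMeasurable θ freqMeasure) (ev : en s t v < ⊤) (eθ : en s t θ < ⊤) :
    Integrable (fun p => amp s t p ^ 2 * (‖v p‖ ^ 2 + ‖θ p‖ ^ 2)) freqMeasure ∧
    ∫ p, amp s t p ^ 2 * (‖v p‖ ^ 2 + ‖θ p‖ ^ 2) ∂freqMeasure = amplitude s t v θ ^ 2 := by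
  obtain ⟨i1, e1⟩ := en_toReal_sq hv ev
  obtain ⟨i2, e2⟩ := en_toReal_sq hθ eθ
  rw [amplitude_sq, e1, e2, ← integral_add i1 i2]
  simp only [mul_add]
  exact ⟨i1.fun_add i2, trivial⟩

lemma integrable_energy (hc : 0 ≤ c) (hN : 0 < N) (ht : 0 ≤ t) (hγ : 1 / 2 < γ)
    (hv : AEStronglyMeasurable v freqMeasure) (hθ : AEStronglyMeasurable θ freqMeasure)
    (ev : en s t v < ⊤) (eθ : en s t θ < ⊤) :
    Integrable (fun p => wgt c s N t p ^ 2 * (‖v p‖ ^ 2 + γ ^ 2 * ‖θ p‖ ^ 2 +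
      nv t p 0 * (v p * (starRingEnd ℂ) (θ p)).re)) freqMeasure ∧
    energy c s N γ t v θ ≤ 2 * (1 + γ ^ 2) * amplitude s t v θ ^ 2 := by
  obtain ⟨i, e⟩ := integrable_amp_sq_mul hv hθ ev eθ
  have hb : ∀ p, |wgt c s N t p ^ 2 * (‖v p‖ ^ 2 + γ ^ 2 * ‖θ p‖ ^ 2 +
      nv t p 0 * (v p * (starRingEnd ℂ) (θ p)).re)| ≤
      2 * (1 + γ ^ 2) * (amp s t p ^ 2 * (‖v p‖ ^ 2 + ‖θ p‖ ^ 2)) := by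
    intro p
    have h1 := abs_cross_le (by linarith : 0 < γ) _ (abs_nv_le t p 0) (v p) (θ p)
    have h2 : 1 / (2 * γ) ≤ 1 := by rw [div_le_one (by linarith)]; linarith
    have h3 : 0 ≤ ‖v p‖ ^ 2 + γ ^ 2 * ‖θ p‖ ^ 2 := by positivity
    have h4 := h1.trans (mul_le_mul_of_nonneg_right h2 h3)
    have h5 := pow_le_pow_left₀ (wgt_nonneg c s N t p) (wgt_le_amp hc hN ht s p) 2
    rw [abs_mul, abs_of_nonneg (sq_nonneg _)]
    have h6 : |‖v p‖ ^ 2 + γ ^ 2 * ‖θ p‖ ^ 2 + nv t p 0 * (v p * (starRingEnd ℂ) (θ p)).re| ≤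
        2 * (1 + γ ^ 2) * (‖v p‖ ^ 2 + ‖θ p‖ ^ 2) := by
      refine (abs_add_le _ _).trans ?_
      rw [abs_of_nonneg h3]
      nlinarith [sq_nonneg ‖v p‖, sq_nonneg ‖θ p‖, sq_nonneg γ,
        mul_nonneg (sq_nonneg γ) (sq_nonneg ‖v p‖)]
    refine (mul_le_mul h5 h6 (abs_nonneg _) (sq_nonneg _)).trans_eq (by ring)
  have hm : AEStronglyMeasurable (fun p => wgt c s N t p ^ 2 * (‖v p‖ ^ 2 + γ ^ 2 * ‖θ p‖ ^ 2 +
      nv t p 0 * (v p * (starRingEnd ℂ) (θ p)).re)) freqMeasure := by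
    have hx := hv.mul (Complex.continuous_conj.comp_aestronglyMeasurable hθ)
    exact ((measurable_wgt c s N t).pow_const 2).aestronglyMeasurable.mul
      (((hv.norm.pow 2).add ((hθ.norm.pow 2).const_mul _)).add
        ((measurable_nv t 0).aestronglyMeasurable.mul
          (Complex.continuous_re.comp_aestronglyMeasurable hx)))
  have hi := (i.const_mul (2 * (1 + γ ^ 2))).mono' hm (Eventually.of_forall hb)
  refine ⟨hi, ?_⟩
  rw [← e, ← integral_const_mul]
  exact integral_mono hi (i.const_mul _) fun p => (le_abs_self _).trans (hb p)

/-- The constant of coercivity of the energy. -/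
def coerConst (c γ : ℝ) : ℝ := Real.exp (-(2 * c)) * ((1 - 1 / (2 * γ)) / 4)

lemma coerConst_pos (hγ : 1 / 2 < γ) : 0 < coerConst c γ := by
  have : 1 / (2 * γ) < 1 := by rw [div_lt_one (by linarith)]; linarith
  exact mul_pos (Real.exp_pos _) (by linarith)

/-- The squared damping is at least e^{-2c}, since the ghost exponent is at most 2. The remaining
fraction 1 - 1/(2γ) is what the cross term leaves, and 1/4 comes from γ² > 1/4. -/
lemma integral_cut_le_energy (hc : 0 ≤ c) (hN : 0 < N) (ht : 0 ≤ t) (hγ : 1 / 2 < γ)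
    (hv : AEStronglyMeasurable v freqMeasure) (hθ : AEStronglyMeasurable θ freqMeasure)
    (ev : en s t v < ⊤) (eθ : en s t θ < ⊤) :
    coerConst c γ * ∫ p, cut N p ^ 2 * (amp s t p ^ 2 * (‖v p‖ ^ 2 + ‖θ p‖ ^ 2)) ∂freqMeasure ≤
      energy c s N γ t v θ := by
  obtain ⟨i, -⟩ := integrable_amp_sq_mul hv hθ ev eθ
  have hi := (integrable_energy hc hN ht hγ hv hθ ev eθ).1
  have icut : Integrable (fun p => cut N p ^ 2 * (amp s t p ^ 2 * (‖v p‖ ^ 2 + ‖θ p‖ ^ 2)))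
      freqMeasure := by
    refine i.bdd_mul (c := 1) ((measurable_cut N).pow_const 2).aestronglyMeasurable
      (Eventually.of_forall fun p => ?_)
    rw [Real.norm_of_nonneg (sq_nonneg _)]
    exact pow_le_one₀ (cut_nonneg N p) (cut_le_one hN p)
  rw [← integral_const_mul]
  refine integral_mono (icut.const_mul _) hi fun p => ?_
  have h1 := (abs_le.1 (abs_cross_le (by linarith : 0 < γ) _ (abs_nv_le t p 0) (v p) (θ p))).1
  have hg : 0 < 1 - 1 / (2 * γ) := by
    have : 1 / (2 * γ) < 1 := by rw [div_lt_one (by linarith)]; linarith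
    linarith
  have h2 : (1 - 1 / (2 * γ)) / 4 * (‖v p‖ ^ 2 + ‖θ p‖ ^ 2) ≤ ‖v p‖ ^ 2 + γ ^ 2 * ‖θ p‖ ^ 2 +
      nv t p 0 * (v p * (starRingEnd ℂ) (θ p)).re := by
    have h3 : (‖v p‖ ^ 2 + ‖θ p‖ ^ 2) / 4 ≤ ‖v p‖ ^ 2 + γ ^ 2 * ‖θ p‖ ^ 2 := by
      nlinarith [sq_nonneg ‖v p‖, sq_nonneg ‖θ p‖,
        mul_nonneg (by nlinarith : 0 ≤ γ ^ 2 - 1 / 4) (sq_nonneg ‖θ p‖)]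
    nlinarith [mul_le_mul_of_nonneg_left h3 hg.le]
  have hd : Real.exp (-(2 * c)) ≤ damp c t p ^ 2 := by
    rw [damp, ← Real.exp_nat_mul]
    refine Real.exp_le_exp.2 ?_
    have := (abs_le.1 (abs_ghost_le_two t p)).2
    push_cast
    nlinarith
  have e : wgt c s N t p ^ 2 = damp c t p ^ 2 * (cut N p ^ 2 * amp s t p ^ 2) := by
    rw [wgt]; ring
  dsimp only
  rw [e, coerConst]
  calc _ = Real.exp (-(2 * c)) * (cut N p ^ 2 * amp s t p ^ 2) *
        ((1 - 1 / (2 * γ)) / 4 * (‖v p‖ ^ 2 + ‖θ p‖ ^ 2)) := by ring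
    _ ≤ _ := by gcongr

lemma tendsto_integral_cut (hv : AEStronglyMeasurable v freqMeasure)
    (hθ : AEStronglyMeasurable θ freqMeasure) (ev : en s t v < ⊤) (eθ : en s t θ < ⊤) :
    Tendsto (fun N : ℝ => ∫ p, cut N p ^ 2 * (amp s t p ^ 2 * (‖v p‖ ^ 2 + ‖θ p‖ ^ 2))
      ∂freqMeasure) atTop (𝓝 (amplitude s t v θ ^ 2)) := by
  obtain ⟨i, e⟩ := integrable_amp_sq_mul hv hθ ev eθ
  rw [← e]
  refine tendsto_integral_filter_of_dominated_convergence _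
    (Eventually.of_forall fun N => ?_) ?_ i.norm (Eventually.of_forall fun p => ?_)
  · exact ((measurable_cut N).pow_const 2).aestronglyMeasurable.mul i.aestronglyMeasurable
  · filter_upwards [eventually_gt_atTop 0] with N hN
    refine Eventually.of_forall fun p => ?_
    rw [norm_mul, Real.norm_of_nonneg (sq_nonneg (cut N p))]
    exact mul_le_of_le_one_left (norm_nonneg _) (pow_le_one₀ (cut_nonneg N p) (cut_le_one hN p))
  · simpa using ((tendsto_cut p).pow 2).mul_const (amp s t p ^ 2 * (‖v p‖ ^ 2 + ‖θ p‖ ^ 2))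

end Bounds

/-- The integral inequality for the amplitude. -/
lemma FreqSol.amplitude_sq_le {c s γ ν μ T : ℝ} {v θ : ℝ → ℤ × ℝ → ℂ}
    (hsol : FreqSol ν μ γ (s + 1 / 2) T v θ) (hT : 0 ≤ T)
    (hs : 3 / 2 < s) (hγ : 1 / 2 < γ) (hc : 3 ≤ c * (1 - 1 / (2 * γ))) (hc0 : 0 ≤ c)
    (hν : 0 < ν) (hμ : 0 < μ) (hνμ : (ν + μ) ^ 2 ≤ 16 * γ ^ 2 * (ν * μ)) :
    ∃ A : ℝ → ℝ, Continuous A ∧ (∀ t ∈ Icc 0 T, A t = amplitude s t (v t) (θ t)) ∧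
      ∀ t ∈ Icc 0 T, coerConst c γ * A t ^ 2 ≤ 2 * (1 + γ ^ 2) * A 0 ^ 2 +
        ∫ τ in (0 : ℝ)..t, nlConst c s γ * (1 + τ) * A τ ^ 3 := by
  have cv := hsol.contL_v
  have cθ := hsol.contL_θ
  have fin : ∀ {f : ℝ → ℤ × ℝ → ℂ}, ContL (s + 1 / 2) T f → ∀ t ∈ Icc 0 T, en s t (f t) < ⊤ :=
    fun hf t ht => (en_le_wnorm ht.1 s _).trans_lt
      (ENNReal.mul_lt_top ENNReal.ofReal_lt_top (hf.fin t ht))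
  have hA0 : ContinuousOn (fun t => amplitude s t (v t) (θ t)) (Icc 0 T) :=
    (cv.continuousOn_en.add cθ.continuousOn_en).sqrt
  set A := IccExtend hT ((Icc 0 T).domRestrict fun t => amplitude s t (v t) (θ t)) with hA
  have hAc : Continuous A := (continuousOn_iff_continuous_domRestrict.1 hA0).Icc_extend'
  have hAe : ∀ t ∈ Icc 0 T, A t = amplitude s t (v t) (θ t) := fun t ht =>
    IccExtend_of_mem hT _ ht
  refine ⟨A, hAc, hAe, fun t ht => ?_⟩
  have h0 : (0 : ℝ) ∈ Icc 0 T := ⟨le_rfl, hT⟩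
  have hcont : Continuous fun τ => nlConst c s γ * (1 + τ) * A τ ^ 3 := by fun_prop
  have key : ∀ N : ℝ, 0 < N → energy c s N γ t (v t) (θ t) ≤ 2 * (1 + γ ^ 2) * A 0 ^ 2 +
      ∫ τ in (0 : ℝ)..t, nlConst c s γ * (1 + τ) * A τ ^ 3 := by
    intro N hN
    choose! D hD hDle using fun t ht => hsol.hasDerivWithinAt_energy hT hs hN hγ hc hc0 hν hμ hνμ
      ht (fin cv t ht) (fin cθ t ht)
    refine image_le_of_deriv_right_le_deriv_boundary (a := 0) (b := T)
      (fun t ht => (hD t ht).continuousWithinAt)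
      (fun t ht => (hD t (Ico_subset_Icc_self ht)).mono_of_mem_nhdsWithin
        (Icc_mem_nhdsGE_of_mem ht)) ?_ ?_
      (fun t _ => ((hcont.integral_hasStrictDerivAt 0 t).hasDerivAt.const_add _).hasDerivWithinAt)
      (fun t ht => ?_) ht
    · rw [intervalIntegral.integral_same, add_zero, hAe 0 h0]
      exact (integrable_energy hc0 hN le_rfl hγ (cv.meas 0 h0) (cθ.meas 0 h0) (fin cv 0 h0)
        (fin cθ 0 h0)).2
    · exact fun t _ => ((hcont.integral_hasStrictDerivAt 0 t).hasDerivAt.const_add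
        _).continuousAt.continuousWithinAt
    · rw [hAe t (Ico_subset_Icc_self ht)]
      exact hDle t (Ico_subset_Icc_self ht)
  rw [hAe t ht]
  -- The upper bound does not involve N, so the cutoff is removed on the left-hand side alone.
  refine le_of_tendsto ((tendsto_integral_cut (cv.meas t ht) (cθ.meas t ht) (fin cv t ht)
    (fin cθ t ht)).const_mul (coerConst c γ)) ?_
  filter_upwards [eventually_gt_atTop 0] with N hN
  exact (integral_cut_le_energy hc0 hN ht.1 hγ (cv.meas t ht) (cθ.meas t ht) (fin cv t ht)
    (fin cθ t ht)).trans (key N hN)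


/-! ### The cubic integral inequality -/

/-- A cubic integral inequality with small data has a solution of the size of the data. -/
lemma sq_le_of_integral_cubic {A : ℝ → ℝ} {T k L M a : ℝ} (hA : Continuous A)
    (hA0 : ∀ t ∈ Icc 0 T, 0 ≤ A t) (hk : 0 < k) (hL : 0 ≤ L) (hM : 0 ≤ M)
    (hle : ∀ t ∈ Icc 0 T, k * A t ^ 2 ≤ M * a ^ 2 + ∫ τ in (0 : ℝ)..t, L * (1 + τ) * A τ ^ 3)
    {t : ℝ} (ht : t ∈ Icc 0 T)
    (hsmall : M / k * (L / k) ^ 2 * (a * (t + t ^ 2 / 2)) ^ 2 ≤ 1 / 4) :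
    A t ^ 2 ≤ 4 * (M / k) * a ^ 2 := by
  have hcont : Continuous fun τ => L * (1 + τ) * A τ ^ 3 := by fun_prop
  set X := t + t ^ 2 / 2 with hX
  have hX0 : 0 ≤ X := by have := ht.1; positivity
  set K := L / k with hK
  have hK0 : 0 ≤ K := by positivity
  -- The shift by η keeps the majorant strictly positive even for zero data; it is sent to zero at
  -- the end.
  have main : ∀ η : ℝ, 0 < η → (M / k * a ^ 2 + η) * (K * X) ^ 2 ≤ 1 →
      A t ^ 2 ≤ 4 * (M / k * a ^ 2 + η) := by
    intro η hη hη1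
    set G := fun t => M / k * a ^ 2 + η + k⁻¹ * ∫ τ in (0 : ℝ)..t, L * (1 + τ) * A τ ^ 3 with hG
    have hG0 : G 0 = M / k * a ^ 2 + η := by simp [hG]
    have hint : ∀ t ∈ Icc 0 T, 0 ≤ ∫ τ in (0 : ℝ)..t, L * (1 + τ) * A τ ^ 3 := fun t ht =>
      intervalIntegral.integral_nonneg ht.1 fun τ hτ => by
        have := hA0 τ ⟨hτ.1, hτ.2.trans ht.2⟩
        have := hτ.1
        positivity
    have hGpos : ∀ t ∈ Icc 0 T, 0 < G t := fun t ht => by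
      have := mul_nonneg (inv_nonneg.2 hk.le) (hint t ht)
      simp only [hG]; positivity
    have hAG : ∀ t ∈ Icc 0 T, A t ^ 2 ≤ G t := fun t ht => by
      have h := mul_le_mul_of_nonneg_left (hle t ht) (inv_nonneg.2 hk.le)
      rw [inv_mul_cancel_left₀ hk.ne', mul_add] at h
      have e : k⁻¹ * (M * a ^ 2) = M / k * a ^ 2 := by field_simp
      simp only [hG]; linarith
    have hGd : ∀ t, HasDerivAt G (k⁻¹ * (L * (1 + t) * A t ^ 3)) t := fun t =>
      ((hcont.integral_hasStrictDerivAt 0 t).hasDerivAt.const_mul _).const_add _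
    -- From A² ≤ G it follows that G' ≤ K(1 + t)G^{3/2}, hence (-G^{-1/2})' ≤ K(1 + t)/2.
    -- Integration gives G(t)^{-1/2} ≥ G(0)^{-1/2} - KX/2, and KX ≤ G(0)^{-1/2} leaves at least
    -- half, that is G(t) ≤ 4G(0).
    have hd : ∀ t ∈ Icc 0 T, HasDerivAt (fun t => -(√(G t))⁻¹)
        (k⁻¹ * (L * (1 + t) * A t ^ 3) / (2 * √(G t)) / G t) t := fun t ht => by
      have h := ((hGd t).sqrt (hGpos t ht).ne').inv (Real.sqrt_pos.2 (hGpos t ht)).ne'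
      refine h.neg.congr_deriv ?_
      rw [Real.sq_sqrt (hGpos t ht).le]; ring
    have hB : ∀ t : ℝ, HasDerivAt (fun t => -(√(G 0))⁻¹ + K / 2 * (t + t ^ 2 / 2))
        (K / 2 * (1 + t)) t := fun t => by
      have h := ((hasDerivAt_id t).add ((hasDerivAt_pow 2 t).div_const 2)).const_mul (K / 2)
      refine (h.const_add _).congr_deriv ?_
      push_cast; ring
    have hfin := image_le_of_deriv_right_le_deriv_boundary (a := 0) (b := T)
      (fun t ht => (hd t ht).continuousAt.continuousWithinAt)
      (fun t ht => (hd t (Ico_subset_Icc_self ht)).hasDerivWithinAt)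
      (B := fun t => -(√(G 0))⁻¹ + K / 2 * (t + t ^ 2 / 2)) (by simp)
      (fun t _ => (hB t).continuousAt.continuousWithinAt) (fun t _ => (hB t).hasDerivWithinAt)
      (fun t ht => by
        have ht' := Ico_subset_Icc_self ht
        have hp := hGpos t ht'
        have hs := Real.sqrt_pos.2 hp
        have h1 : A t ≤ √(G t) := Real.le_sqrt_of_sq_le (hAG t ht')
        have h2 : A t ^ 3 ≤ √(G t) * G t := by
          calc A t ^ 3 ≤ √(G t) ^ 3 := pow_le_pow_left₀ (hA0 t ht') h1 3
            _ = √(G t) * (√(G t) ^ 2) := by ring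
            _ = _ := by rw [Real.sq_sqrt hp.le]
        have h3 : 0 ≤ K / 2 * (1 + t) := mul_nonneg (by positivity) (by linarith [ht'.1])
        rw [div_div, div_le_iff₀ (by positivity)]
        calc k⁻¹ * (L * (1 + t) * A t ^ 3) = K / 2 * (1 + t) * (2 * A t ^ 3) := by
              rw [hK]; field_simp
          _ ≤ K / 2 * (1 + t) * (2 * (√(G t) * G t)) := by gcongr
          _ = _ := by ring) ht
    have g0 : 0 < G 0 := hGpos 0 ⟨le_rfl, ht.1.trans ht.2⟩
    have hs0 := Real.sqrt_pos.2 g0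
    have hst := Real.sqrt_pos.2 (hGpos t ht)
    have hKX : K * X ≤ (√(G 0))⁻¹ := by
      rw [← one_div, le_div_iff₀ hs0]
      refine abs_le_of_sq_le_sq' ?_ zero_le_one |>.2
      rw [mul_pow, Real.sq_sqrt g0.le, hG0]
      linarith
    have h1 : (√(G 0))⁻¹ / 2 ≤ (√(G t))⁻¹ := by
      rw [← hX] at hfin
      linarith
    have h2 : √(G t) ≤ 2 * √(G 0) := by
      rw [div_eq_mul_inv, ← mul_inv] at h1
      have := (inv_le_inv₀ (by positivity) hst).1 h1
      linarith
    have h3 := pow_le_pow_left₀ hst.le h2 2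
    rw [mul_pow, Real.sq_sqrt g0.le, Real.sq_sqrt (hGpos t ht).le, hG0] at h3
    linarith [hAG t ht]
  refine le_of_forall_pos_le_add fun ε hε => ?_
  set P := (K * X) ^ 2 with hP
  have hP0 : 0 ≤ P := sq_nonneg _
  -- The first entry keeps 4η below the admitted error. The second makes ηP ≤ 1/2, which together
  -- with the assumed 1/4 stays below the required 1.
  set η := min (ε / 4) (1 / (2 * (P + 1))) with hη
  have hη0 : 0 < η := lt_min (by positivity) (by positivity)
  have h := main η hη0 (by
    have h1 : η * P ≤ 1 / 2 := by
      calc η * P ≤ 1 / (2 * (P + 1)) * (P + 1) :=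
            mul_le_mul (min_le_right _ _) (by linarith) hP0 (by positivity)
        _ = 1 / 2 := by field_simp
    have h2 : M / k * a ^ 2 * P = M / k * K ^ 2 * (a * X) ^ 2 := by rw [hP]; ring
    rw [add_mul, h2]
    linarith)
  have := min_le_left (ε / 4) (1 / (2 * (P + 1)))
  linarith

lemma add_sq_div_two_le {κ t : ℝ} (hκ : 0 < κ) (hκ1 : κ < 1) (ht : 0 ≤ t)
    (htκ : t ≤ κ ^ (-(1 / 6) : ℝ)) : t + t ^ 2 / 2 ≤ 3 / 2 * κ ^ (-(1 / 3) : ℝ) := by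
  have h1 : κ ^ (-(1 / 6) : ℝ) ≤ κ ^ (-(1 / 3) : ℝ) :=
    Real.rpow_le_rpow_of_exponent_ge hκ hκ1.le (by norm_num)
  have h2 : t ^ 2 ≤ κ ^ (-(1 / 3) : ℝ) := by
    refine (pow_le_pow_left₀ ht htκ 2).trans_eq ?_
    rw [← Real.rpow_mul_natCast hκ.le]; norm_num
  linarith

/-! ### Return to the norms in physical space -/

lemma sqrt_sq_add_sq_eq {x y : ℝ≥0∞} (hx : x < ⊤) (hy : y < ⊤) :
    (x ^ 2 + y ^ 2) ^ (1 / 2 : ℝ) = ENNReal.ofReal √(x.toReal ^ 2 + y.toReal ^ 2) := by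
  rw [Real.sqrt_eq_rpow, ← ENNReal.ofReal_rpow_of_nonneg (by positivity) (by norm_num),
    ENNReal.ofReal_add (by positivity) (by positivity), ENNReal.ofReal_pow ENNReal.toReal_nonneg,
    ENNReal.ofReal_pow ENNReal.toReal_nonneg, ENNReal.ofReal_toReal hx.ne,
    ENNReal.ofReal_toReal hy.ne]

lemma en_congr {s t : ℝ} {f g : ℤ × ℝ → ℂ} (h : f =ᵐ[freqMeasure] g) : en s t f = en s t g := by
  rw [en_eq_eLpNorm, en_eq_eLpNorm]
  exact eLpNorm_congr_ae (by filter_upwards [h] with p hp; rw [hp])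

lemma en_sq (s t : ℝ) (f : ℤ × ℝ → ℂ) :
    en s t f ^ 2 = ∫⁻ p, ENNReal.ofReal (amp s t p ^ 2) * ‖f p‖ₑ ^ 2 ∂freqMeasure := by
  rw [en_eq_eLpNorm, eLpNorm_two_sq]
  exact lintegral_congr fun p => enorm_ofReal_mul_sq (amp_pos s t p).le _

/-- As `nv` is a unit vector almost everywhere, passing from u to the scalar v preserves all these
norms exactly. -/
lemma sum_en_vel_sq (s t : ℝ) {v : ℤ × ℝ → ℂ} (hv : AEStronglyMeasurable v freqMeasure) :
    ∑ i, en s t (vel t v i) ^ 2 = en s t v ^ 2 := by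
  have hm : AEMeasurable (fun p => ENNReal.ofReal (amp s t p ^ 2) * ‖vel t v 0 p‖ₑ ^ 2)
      freqMeasure :=
    ((measurable_amp s t).pow_const 2).ennreal_ofReal.aemeasurable.mul
      ((aestronglyMeasurable_nv_mul t 0 hv).enorm.pow_const 2)
  simp only [Fin.sum_univ_two, en_sq]
  rw [← lintegral_add_left' hm]
  refine lintegral_congr_ae ?_
  filter_upwards [ae_ne_zero] with p hp
  have e : ∀ i, ‖vel t v i p‖ₑ ^ 2 = ENNReal.ofReal (nv t p i ^ 2) * ‖v p‖ₑ ^ 2 := fun i => by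
    rw [vel, enorm_mul, mul_pow, ← ofReal_norm, Complex.norm_real,
      ← ENNReal.ofReal_pow (norm_nonneg _), Real.norm_eq_abs, sq_abs]
  rw [e, e, ← mul_add, ← add_mul, ← ENNReal.ofReal_add (sq_nonneg _) (sq_nonneg _),
    nv_sq_add hp t, ENNReal.ofReal_one, one_mul]

lemma wnorm_sqrt_jb_mul (s t : ℝ) (f : ℤ × ℝ → ℂ) :
    wnorm s (fun p => ((bracket p.1 (p.2 - p.1 * t) ^ (1 / 2 : ℝ) : ℝ) : ℂ) * f p) = en s t f := by
  rw [en_eq_eLpNorm, wnorm]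
  congr 1; ext p
  rw [amp, ← mul_assoc, ← Complex.ofReal_mul, Real.sqrt_eq_rpow]; rfl

lemma wnorm_eq_en_zero (s : ℝ) (f : ℤ × ℝ → ℂ) : wnorm (s + 1 / 2) f = en s 0 f := by
  rw [en_eq_eLpNorm, wnorm]
  congr 1; ext p
  rw [amp, Real.rpow_add (jb_pos 0 p), Real.sqrt_eq_rpow]

/-- For s > 1 the multiplied transform is still integrable, so it is a genuine Fourier transform and
its Sobolev norm can be read off from the symbol. -/
lemma sobolevNorm_bracketGradL {s t : ℝ} (hs : 1 < s) {f : ℝ × ℝ → ℂ} {g : ℤ × ℝ → ℂ}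
    (hfg : fourierT f =ᵐ[freqMeasure] g) (hg : AEStronglyMeasurable g freqMeasure)
    (hen : en s t g < ⊤) : sobolevNorm s (bracketGradL t (1 / 2) f) = en s t g := by
  have hen' : en s t (fourierT f) = en s t g := en_congr hfg
  have hm : AEStronglyMeasurable (fun p : ℤ × ℝ =>
      ((bracket p.1 (p.2 - p.1 * t) ^ (1 / 2 : ℝ) : ℝ) : ℂ) * fourierT f p) freqMeasure :=
    aestronglyMeasurable_jb_mul (hg.congr hfg.symm) (1 / 2) t
  have hF : HasFourier (bracketGradL t (1 / 2) f) (fun p : ℤ × ℝ =>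
      ((bracket p.1 (p.2 - p.1 * t) ^ (1 / 2 : ℝ) : ℝ) : ℂ) * fourierT f p) :=
    ⟨integrable_of_wnorm hs hm (by rwa [wnorm_sqrt_jb_mul, hen']), Eventually.of_forall fun _ => rfl⟩
  rw [hF.sobolevNorm_eq, wnorm_sqrt_jb_mul, hen']

section Norms

variable {ν μ γ s T : ℝ} {uin : Fin 2 → ℝ × ℝ → ℝ} {θin : ℝ × ℝ → ℝ}
  {u : Fin 2 → ℝ → ℝ × ℝ → ℝ} {θ : ℝ → ℝ × ℝ → ℝ}

lemma IsSolution.pairNorm_bracketGradL (hsol : IsSolution ν μ γ (s + 1 / 2) T uin θin u θ)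
    (hs : 3 / 2 < s) {t : ℝ} (ht : t ∈ Icc 0 T) :
    pairNorm s (fun i => bracketGradL t (1 / 2) (toC (u i t)))
      (bracketGradL t (1 / 2) (toC (θ t))) =
      ENNReal.ofReal (amplitude s t (velT u t) (tempT θ t)) := by
  have hF := hsol.freqSol (by linarith : 1 < s + 1 / 2)
  have hmv := hF.meas_v t ht
  have hmθ := hF.meas_θ t ht
  have ev : en s t (velT u t) < ⊤ := (en_le_wnorm ht.1 s _).trans_lt
    (ENNReal.mul_lt_top ENNReal.ofReal_lt_top (hF.norm_v t ht))
  have eθ : en s t (tempT θ t) < ⊤ := (en_le_wnorm ht.1 s _).trans_lt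
    (ENNReal.mul_lt_top ENNReal.ofReal_lt_top (hF.norm_θ t ht))
  have h1 : ∀ i, sobolevNorm s (bracketGradL t (1 / 2) (toC (u i t))) =
      en s t (vel t (velT u t) i) := fun i =>
    sobolevNorm_bracketGradL (by linarith) (hsol.fourierT_u ht i)
      (aestronglyMeasurable_nv_mul t i hmv) ((en_vel_le s t _ i).trans_lt ev)
  have h2 : sobolevNorm s (bracketGradL t (1 / 2) (toC (θ t))) = en s t (tempT θ t) :=
    sobolevNorm_bracketGradL (by linarith) (EventuallyEq.refl _ _) hmθ eθ
  rw [pairNorm]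
  simp only [h1, h2]
  rw [sum_en_vel_sq s t hmv, sqrt_sq_add_sq_eq ev eθ, amplitude]

lemma IsSolution.pairNorm_initial (hsol : IsSolution ν μ γ (s + 1 / 2) T uin θin u θ)
    (hT : 0 ≤ T) (hs : 3 / 2 < s) :
    pairNorm (s + 1 / 2) (fun i => toC (uin i)) (toC θin) =
      ENNReal.ofReal (amplitude s 0 (velT u 0) (tempT θ 0)) := by
  have h0 : (0 : ℝ) ∈ Icc 0 T := ⟨le_rfl, hT⟩
  have hF := hsol.freqSol (by linarith : 1 < s + 1 / 2)
  have hmv := hF.meas_v 0 h0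
  have ev : en s 0 (velT u 0) < ⊤ := by
    rw [← wnorm_eq_en_zero]; exact hF.norm_v 0 h0
  have eθ : en s 0 (tempT θ 0) < ⊤ := by
    rw [← wnorm_eq_en_zero]; exact hF.norm_θ 0 h0
  have h1 : ∀ i, sobolevNorm (s + 1 / 2) (toC (uin i)) = en s 0 (vel 0 (velT u 0) i) := fun i => by
    have hi : ∀ᵐ z, toC (u i 0) z = toC (uin i) z := by
      filter_upwards [hsol.initial_u i] with z hz
      rw [toC, toC, hz]
    rw [(((hsol.continuous_u i).hasFourier h0).congr hi).sobolevNorm_eq, wnorm_eq_en_zero]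
    exact en_congr (hsol.fourierT_u h0 i)
  have h2 : sobolevNorm (s + 1 / 2) (toC θin) = en s 0 (tempT θ 0) := by
    have hi : ∀ᵐ z, toC (θ 0) z = toC θin z := by
      filter_upwards [hsol.initial_θ] with z hz
      rw [toC, toC, hz]
    rw [((hsol.continuous_θ.hasFourier h0).congr hi).sobolevNorm_eq, wnorm_eq_en_zero]
    rfl
  rw [pairNorm]
  simp only [h1, h2]
  rw [sum_en_vel_sq s 0 hmv, sqrt_sq_add_sq_eq ev eθ, amplitude]

end Norms

/-- Since 2 - ε < 2, the hypothesis gives ν + μ ≤ 4γ√(νμ), the discriminant condition for the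
viscous form. -/
lemma sq_le_of_div_lt {ν μ γ ε : ℝ} (hν : 0 < ν) (hμ : 0 < μ) (hγ : 0 < γ) (hε : 0 < ε)
    (h : (ν + μ) / (2 * γ * √(ν * μ)) < 2 - ε) : (ν + μ) ^ 2 ≤ 16 * γ ^ 2 * (ν * μ) := by
  have hs : 0 < √(ν * μ) := Real.sqrt_pos.2 (mul_pos hν hμ)
  rw [div_lt_iff₀ (by positivity)] at h
  have h1 : ν + μ ≤ 4 * γ * √(ν * μ) := by
    nlinarith [mul_pos hε (mul_pos hγ hs)]
  refine (pow_le_pow_left₀ (by positivity) h1 2).trans_eq ?_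
  rw [mul_pow, Real.sq_sqrt (mul_pos hν hμ).le]; ring

end Boussinesq

end

/-! ### Choice of constants and conclusion -/

theorem proposition2p1 (γ s ε : ℝ) (hγ : 1 / 2 < γ) (hs : 3 / 2 < s) (hε : 0 < ε)
    (hεγ : ε < 1 / γ) :
    ∃ c₁ C : ℝ, 0 < c₁ ∧ 0 < C ∧
      ∀ ν μ κ : ℝ, κ = min ν μ → 0 < κ → κ < 1 →
        (ν + μ) / (2 * γ * √(ν * μ)) < 2 - ε →
        ∀ (T : ℝ) (uin : Fin 2 → ℝ × ℝ → ℝ) (θin : ℝ × ℝ → ℝ)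
          (u : Fin 2 → ℝ → ℝ × ℝ → ℝ) (θ : ℝ → ℝ × ℝ → ℝ),
          0 < T →
          Boussinesq.IsSolution ν μ γ (s + 1 / 2) T uin θin u θ →
          Boussinesq.pairNorm (s + 1 / 2) (fun i => Boussinesq.toC (uin i))
              (Boussinesq.toC θin) ≤ ENNReal.ofReal (c₁ * κ ^ (1 / 3 : ℝ)) →
          ∀ t : ℝ, 0 ≤ t → t ≤ T → t ≤ κ ^ (-(1 / 6) : ℝ) →
            Boussinesq.pairNorm s
                (fun i => Boussinesq.bracketGradL t (1 / 2) (Boussinesq.toC (u i t)))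
                (Boussinesq.bracketGradL t (1 / 2) (Boussinesq.toC (θ t)))
              ≤ ENNReal.ofReal C *
                Boussinesq.pairNorm (s + 1 / 2) (fun i => Boussinesq.toC (uin i))
                  (Boussinesq.toC θin) := by
  have hγ0 : 0 < γ := by linarith
  -- This gives c(1 - 1/(2γ)) = 4, above the threshold 3 of the linear estimate.
  set c := 4 / (1 - 1 / (2 * γ)) with hc
  have hd : 0 < 1 - 1 / (2 * γ) := by
    have : 1 / (2 * γ) < 1 := by rw [div_lt_one (by linarith)]; linarith
    linarith
  have hc0 : 0 ≤ c := by positivity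
  have hc3 : 3 ≤ c * (1 - 1 / (2 * γ)) := by rw [hc, div_mul_cancel₀ _ hd.ne']; norm_num
  set k := Boussinesq.coerConst c γ with hk
  have hk0 : 0 < k := Boussinesq.coerConst_pos hγ
  set L := Boussinesq.nlConst c s γ with hL
  have hL0 : 0 ≤ L := Boussinesq.nlConst_nonneg hc0 (by linarith)
  set M := 2 * (1 + γ ^ 2) with hM
  have hM0 : 0 < M := by positivity
  -- Chosen so that √(M/k) (L/k + 1) times (3/2) c₁ is exactly 1/2; the added 1 keeps the inverse
  -- meaningful when L = 0.
  set c₁ := (3 * √(M / k) * (L / k + 1))⁻¹ with hc₁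
  have hMk : 0 < √(M / k) := Real.sqrt_pos.2 (by positivity)
  have hc₁0 : 0 < c₁ := by positivity
  refine ⟨c₁, √(4 * (M / k)), hc₁0, Real.sqrt_pos.2 (by positivity), ?_⟩
  intro ν μ κ hκ hκ0 hκ1 hνμ T uin θin u θ hT hsol hin t ht htT htκ
  have hν : 0 < ν := hκ0.trans_le (hκ ▸ min_le_left ν μ)
  have hμ : 0 < μ := hκ0.trans_le (hκ ▸ min_le_right ν μ)
  have htI : t ∈ Set.Icc 0 T := ⟨ht, htT⟩
  have h0I : (0 : ℝ) ∈ Set.Icc 0 T := ⟨le_rfl, hT.le⟩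
  obtain ⟨A, hA, hAe, hle⟩ := (hsol.freqSol (by linarith)).amplitude_sq_le hT.le hs hγ hc3 hc0 hν hμ
    (Boussinesq.sq_le_of_div_lt hν hμ hγ0 hε hνμ)
  have hA0 : ∀ t ∈ Set.Icc 0 T, 0 ≤ A t := fun t ht => by
    rw [hAe t ht]; exact Real.sqrt_nonneg _
  rw [hsol.pairNorm_initial hT.le hs, ← hAe 0 h0I] at hin ⊢
  rw [hsol.pairNorm_bracketGradL hs htI, ← hAe t htI, ← ENNReal.ofReal_mul (Real.sqrt_nonneg _)]
  have hκ3 : 0 < κ ^ (1 / 3 : ℝ) := Real.rpow_pos_of_pos hκ0 _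
  rw [ENNReal.ofReal_le_ofReal_iff (by positivity)] at hin
  refine ENNReal.ofReal_le_ofReal ?_
  have hX := Boussinesq.add_sq_div_two_le hκ0 hκ1 ht htκ
  have hX0 : 0 ≤ t + t ^ 2 / 2 := by positivity
  -- The size κ^{1/3} of the data exactly offsets t + t²/2 ≤ (3/2) κ^{-1/3}. This balance is what
  -- fixes the time scale κ^{-1/6}.
  have hAX : A 0 * (t + t ^ 2 / 2) ≤ c₁ * (3 / 2) := by
    refine (mul_le_mul hin hX hX0 (by positivity)).trans_eq ?_
    have e : κ ^ (1 / 3 : ℝ) * κ ^ (-(1 / 3) : ℝ) = 1 := by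
      rw [← Real.rpow_add hκ0]; norm_num
    linear_combination (c₁ * (3 / 2)) * e
  have hsmall : M / k * (L / k) ^ 2 * (A 0 * (t + t ^ 2 / 2)) ^ 2 ≤ 1 / 4 := by
    have h1 : √(M / k) * (L / k) * (A 0 * (t + t ^ 2 / 2)) ≤ 1 / 2 := by
      calc _ ≤ √(M / k) * (L / k + 1) * (c₁ * (3 / 2)) := by
            refine mul_le_mul ?_ hAX (mul_nonneg (hA0 0 h0I) hX0) (by positivity)
            gcongr; linarith
        _ = 1 / 2 := by rw [hc₁]; field_simp
    have h2 := pow_le_pow_left₀ (mul_nonneg (by positivity) (mul_nonneg (hA0 0 h0I) hX0)) h1 2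
    rw [mul_pow, mul_pow, Real.sq_sqrt (by positivity)] at h2
    linarith
  have h := Boussinesq.sq_le_of_integral_cubic hA hA0 hk0 hL0 hM0.le hle htI hsmall
  refine abs_le_of_sq_le_sq' ?_ (mul_nonneg (Real.sqrt_nonneg _) (hA0 0 h0I)) |>.2
  rw [mul_pow, Real.sq_sqrt (by positivity)]
  exact h
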